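/- Let $\mathcal H,\mathcal K$ be complex Hilbert spaces, let $X_1,\dots,X_N$ be strongly commuting self-adjoint operators on $\mathcal H$ and $Y_1,\dots,Y_N$ strongly commuting self-adjoint operators on $\mathcal K$ (all possibly unbounded), with joint spectral measures $E^{\mathbf X}$, $E^{\mathbf Y}$ on $\mathbb R^N$, and write $e^{i\mathbf y\cdot\mathbf X}=\int e^{i\mathbf y\cdot\mathbf s}\,dE^{\mathbf X}(\mathbf s)$, and similarly $e^{i\mathbf y\cdot\mathbf Y}$. Let $E^{\mathbf X\otimes\mathbf Y}$ be the product spectral measure on $\mathbb R^{2N}$, $E^{\mathbf X\otimes\mathbf Y}(B\times C)=E^{\mathbf X}(B)\otimes E^{\mathbf Y}(C)$ (the joint spectral measure of the operators $X_\mu\otimes 1$, $1\otimes Y_\mu$), let $e^{\pm i\mathbf X\otimes\mathbf Y}=\int e^{\pm i\mathbf x\cdot\mathbf y}\,dE^{\mathbf X\otimes\mathbf Y}(\mathbf x,\mathbf y)$, and let $$U(\mathbf x,\mathbf y)=e^{-i\mathbf x\cdot\mathbf X}\otimes e^{i\mathbf y\cdot\mathbf Y},\qquad \Theta=\begin{pmatrix}0&1\\-1&0\end{pmatrix}.$$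 Let $A$ be a closable operator on $\mathcal H$ with domain $\mathcal D_A$, and let $A\otimes 1$ denote the closure of $\psi\otimes\phi\mapsto A\psi\otimes\phi$ on $\mathcal D_A\odot\mathcal K$. Suppose there are a dense subspace $\mathcal D\subset\mathcal H$, contained in the domains of $A$ and of all $X_\mu$, with $$A\mathcal D\subset\mathcal D,\qquad X_\mu\mathcal D\subset\mathcal D\ (\mu=1,\dots,N),\qquad e^{-i\mathbf x\cdot\mathbf X}\mathcal D\subset\mathcal D\ (\mathbf x\in\mathbb R^N),$$ and an $m\in\mathbb N$ such that for every $\psi\in\mathcal D$ there is a constant $c_\psi$ with $$\|Ae^{-i\mathbf y\cdot\mathbf X}\psi\|\le c_\psi(1+\|\mathbf y\|^2)^{m/2}\qquad\text{for all }\mathbf y\in\mathbb R^N .$$ Let $\mathcal D_{\mathbf Y}^\infty\subset\mathcal K$ be the intersection of the domains of all powers of each $Y_\mu$. Then the following expressions are well defined on the algebraic tensor product $\mathcal D\odot\mathcal D_{\mathbf Y}^\infty$ (the last two in the weak sense) and are equal there: $$e^{i\mathbf X\otimes\mathbf Y}(A\otimes 1)e^{-i\mathbf X\otimes\mathbf Y}=\int_{\mathrm{Spec}\,\mathbf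 Y}e^{i\mathbf y\cdot\mathbf X}Ae^{-i\mathbf y\cdot\mathbf X}\otimes dE^{\mathbf Y}(\mathbf y)=\int_{\mathbb R^{2N}}dE^{\mathbf X\otimes\mathbf Y}(z)\,U(\Theta z)^{-1}(A\otimes 1)U(\Theta z)=:(A\otimes 1)_\Theta .$$ Explicitly, write $T=e^{i\mathbf X\otimes\mathbf Y}(A\otimes 1)e^{-i\mathbf X\otimes\mathbf Y}$. (i) $\mathcal D\odot\mathcal D_{\mathbf Y}^\infty$ is contained in the domain of $T$, i.e. $e^{-i\mathbf X\otimes\mathbf Y}$ maps it into the domain of $A\otimes 1$. (ii) For $\psi\in\mathcal D$, $\phi\in\mathcal D_{\mathbf Y}^\infty$, $\psi'\in\mathcal H$, $\phi'\in\mathcal K$, $$\langle\psi'\otimes\phi',T(\psi\otimes\phi)\rangle=\int_{\mathrm{Spec}\,\mathbf Y}\langle\psi',e^{i\mathbf y\cdot\mathbf X}Ae^{-i\mathbf y\cdot\mathbf X}\psi\rangle\,d\langle\phi',E^{\mathbf Y}(\mathbf y)\phi\rangle ,$$ where $\mathrm{Spec}\,\mathbf Y$ is the joint spectrum (the support of $E^{\mathbf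 Y}$) and the integrand is integrable with respect to the total variation of the complex measure. (iii) With $V(p)=\int_{\mathbb R^{2N}}e^{ip\cdot w}\,dE^{\mathbf X\otimes\mathbf Y}(w)$, for all $\Psi\in\mathcal D\odot\mathcal D_{\mathbf Y}^\infty$ the vector $U(\Theta z)\Psi$ lies in the domain of $A\otimes 1$ for every $z$, and for all $\Phi\in\mathcal H\odot\mathcal K$ and every Schwartz function $\chi$ on $\mathbb R^{2N}\times\mathbb R^{2N}$ with $\chi(0)=1$, $$\langle\Phi,T\Psi\rangle=\lim_{\varepsilon\downarrow0}\frac1{(2\pi)^{2N}}\int\!\!\int\chi(\varepsilon z,\varepsilon p)\,e^{-iz\cdot p}\,\langle\Phi,V(p)\,U(\Theta z)^{-1}(A\otimes1)U(\Theta z)\Psi\rangle\,dz\,dp ,$$ where the integrals for $\varepsilon>0$ converge absolutely. -/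

import Mathlib

open MeasureTheory Filter Topology
open scoped TensorProduct InnerProductSpace SchwartzMap

noncomputable section

namespace WarpedConv

/-! ### Projection-valued measures and integrals of scalar functions against them -/

/-- A projection-valued (spectral) measure on `Ω` with values in the orthogonal projections of the
Hilbert space `H`, countably additive in the strong sense. Non-measurable sets get the value `0`
(the convention of `VectorMeasure`). -/
structure PVM (Ω : Type*) [MeasurableSpace Ω] (H : Type*) [NormedAddCommGroup H]
    [InnerProductSpace ℂ H] [CompleteSpace H] where
  proj : Set Ω → H →L[ℂ] H
  isStarProjection : ∀ B, MeasurableSet B → IsStarProjection (proj B)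
  proj_univ : proj Set.univ = 1
  not_measurable : ∀ B, ¬ MeasurableSet B → proj B = 0
  hasSum : ∀ B : ℕ → Set Ω, (∀ n, MeasurableSet (B n)) → Pairwise (Function.onFun Disjoint B) →
    ∀ ψ : H, HasSum (fun n => proj (B n) ψ) (proj (⋃ n, B n) ψ)

namespace PVM

variable {Ω : Type*} [MeasurableSpace Ω] {H : Type*} [NormedAddCommGroup H]
  [InnerProductSpace ℂ H] [CompleteSpace H]

theorem proj_empty (E : PVM Ω H) : E.proj ∅ = 0 := by
  ext ψ
  have h := E.hasSum (fun _ => ∅) (fun _ => MeasurableSet.empty)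
    (fun _ _ _ => by simp [Function.onFun]) ψ
  simpa using tendsto_nhds_unique tendsto_const_nhds h.summable.tendsto_atTop_zero

/-- The complex measure `B ↦ ⟪φ, E(B) ψ⟫`. -/
def matrixElement (E : PVM Ω H) (φ ψ : H) : VectorMeasure Ω ℂ where
  measureOf' B := ⟪φ, E.proj B ψ⟫_ℂ
  empty' := by simp [E.proj_empty]
  not_measurable' := fun B hB => by simp [E.not_measurable B hB]
  m_iUnion' := fun B hB hd => (E.hasSum B hB hd ψ).mapL (innerSL ℂ φ)

/-- The integral `∫ f(s) d⟪φ, E(s) ψ⟫` of a complex function against a complex measure. -/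
def integral (E : PVM Ω H) (f : Ω → ℂ) (φ ψ : H) : ℂ :=
  (E.matrixElement φ ψ).integral f (ContinuousLinearMap.mul ℝ ℂ)

/-- The same integral over a measurable set `S`. -/
def setIntegral (E : PVM Ω H) (S : Set Ω) (f : Ω → ℂ) (φ ψ : H) : ℂ :=
  ((E.matrixElement φ ψ).restrict S).integral f (ContinuousLinearMap.mul ℝ ℂ)

/-- The bounded operator `∫ f dE` for a bounded measurable function `f`: the operator whose matrix
elements are `∫ f(s) d⟪φ, E(s) ψ⟫`. -/
def calculus (E : PVM Ω H) (f : Ω → ℂ) : H →L[ℂ] H :=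
  Classical.epsilon fun T : H →L[ℂ] H => ∀ φ ψ : H, ⟪φ, T ψ⟫_ℂ = E.integral f φ ψ

/-- The support of a projection-valued measure. -/
def support [TopologicalSpace Ω] (E : PVM Ω H) : Set Ω :=
  {a | ∀ O : Set Ω, IsOpen O → a ∈ O → E.proj O ≠ 0}

open Classical in
/-- The projection-valued measure concentrated in one point. -/
def dirac (a : Ω) : PVM Ω H where
  proj B := if MeasurableSet B ∧ a ∈ B then 1 else 0
  isStarProjection := fun B _ => by
    split_ifs
    · exact .one _
    · exact .zero _
  proj_univ := by simp
  not_measurable := fun B hB => by simp [hB]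
  hasSum := fun B hB hd ψ => by
    by_cases h : ∃ n, a ∈ B n
    · obtain ⟨n, hn⟩ := h
      have hu : a ∈ ⋃ n, B n := Set.mem_iUnion.2 ⟨n, hn⟩
      have key := hasSum_single (f := fun k =>
        (if MeasurableSet (B k) ∧ a ∈ B k then (1 : H →L[ℂ] H) else 0) ψ) n (fun k hk => by
          have : a ∉ B k := fun hak => Set.disjoint_left.1 (hd hk) hak hn
          simp [this])
      have h1 : MeasurableSet (B n) ∧ a ∈ B n := ⟨hB n, hn⟩
      have h2 : MeasurableSet (⋃ n, B n) ∧ a ∈ ⋃ n, B n := ⟨MeasurableSet.iUnion hB, hu⟩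
      rw [if_pos h1] at key
      rw [if_pos h2]
      exact key
    · have hu : a ∉ ⋃ n, B n := fun hu => h (Set.mem_iUnion.1 hu)
      have h' : ∀ n, a ∉ B n := fun n hn => h ⟨n, hn⟩
      simp only [hu, h', and_false, if_false, zero_apply]
      exact hasSum_zero

instance [Nonempty Ω] : Nonempty (PVM Ω H) := ⟨dirac (Classical.arbitrary Ω)⟩

end PVM

/-! ### Unbounded operators -/

section Operators

variable {H : Type*} [NormedAddCommGroup H] [InnerProductSpace ℂ H] [CompleteSpace H]

/-- `R` is the bounded two-sided inverse of `T - z`. -/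
def IsResolventAt (T : H →ₗ.[ℂ] H) (z : ℂ) (R : H →L[ℂ] H) : Prop :=
  (∀ v : H, ∃ h : R v ∈ T.domain, T ⟨R v, h⟩ - z • R v = v) ∧
    ∀ x : T.domain, R (T x - z • (x : H)) = x

/-- Strong commutativity of self-adjoint operators (all resolvents at non-real points commute;
for self-adjoint operators this says that their spectral projections commute). -/
def StronglyCommute (S T : H →ₗ.[ℂ] H) : Prop :=
  ∀ z w : ℂ, z.im ≠ 0 → w.im ≠ 0 → ∀ P Q : H →L[ℂ] H,
    IsResolventAt S z P → IsResolventAt T w Q → Commute P Q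

/-- A tuple of self-adjoint operators that commute strongly with each other. -/
def IsCommutingSelfAdjoint {ι : Type*} (X : ι → H →ₗ.[ℂ] H) : Prop :=
  (∀ μ, IsSelfAdjoint (X μ)) ∧ ∀ μ ν, StronglyCommute (X μ) (X ν)

/-- `E` is the joint spectral measure of the tuple `X`: `X_μ = ∫ s_μ dE(s)` for every `μ`,
domains included. -/
def IsJointSpectralMeasure {ι : Type*} (X : ι → H →ₗ.[ℂ] H) (E : PVM (ι → ℝ) H) : Prop :=
  ∀ μ, (∀ ψ : H, ψ ∈ (X μ).domain ↔
      (E.matrixElement ψ ψ).Integrable fun s => (((s μ) ^ 2 : ℝ) : ℂ)) ∧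
    ∀ (ψ : (X μ).domain) (φ : H), ⟪φ, X μ ψ⟫_ℂ = E.integral (fun s => ((s μ : ℝ) : ℂ)) φ ψ

/-- The joint spectral measure `E^X` on `ℝ^ι` of a tuple of commuting self-adjoint operators. -/
def jointSpectralMeasure {ι : Type*} (X : ι → H →ₗ.[ℂ] H) : PVM (ι → ℝ) H :=
  Classical.epsilon fun E => IsJointSpectralMeasure X E

/-- The unitary operator `e^{i y·X}`. -/
def expI {ι : Type*} [Fintype ι] (X : ι → H →ₗ.[ℂ] H) (y : ι → ℝ) : H →L[ℂ] H :=
  (jointSpectralMeasure X).calculus fun s => Complex.exp (Complex.I * ((y ⬝ᵥ s : ℝ) : ℂ))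

/-- The domain of the power `T^k` of an unbounded operator. -/
def powDomain (T : H →ₗ.[ℂ] H) : ℕ → Submodule ℂ H
  | 0 => ⊤
  | k + 1 => ((powDomain T k).comap T.toFun).map T.domain.subtype

/-- The smooth domain of a tuple of operators: the vectors in the domains of all powers of each
of the operators. -/
def smoothDomain {ι : Type*} (T : ι → H →ₗ.[ℂ] H) : Submodule ℂ H :=
  ⨅ μ, ⨅ k, powDomain (T μ) k

/-- The operator product `S A R` with `S`, `R` bounded, on its natural domain `{x | R x ∈ D_A}`. -/
def sandwich (S : H →L[ℂ] H) (A : H →ₗ.[ℂ] H) (R : H →L[ℂ] H) : H →ₗ.[ℂ] H where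
  domain := A.domain.comap R.toLinearMap
  toFun := S.toLinearMap ∘ₗ A.toFun ∘ₗ (R.toLinearMap.restrict fun _ h => h)

open Classical in
/-- The value of an unbounded operator, extended by `0` outside of its domain. -/
def valueAt (A : H →ₗ.[ℂ] H) (x : H) : H := if h : x ∈ A.domain then A ⟨x, h⟩ else 0

end Operators

/-! ### Tensor products -/

section Tensor

variable {H K : Type*} [NormedAddCommGroup H] [InnerProductSpace ℂ H] [CompleteSpace H]
  [NormedAddCommGroup K] [InnerProductSpace ℂ K] [CompleteSpace K]

/-- The Hilbert space tensor product: the completion of the algebraic tensor product. -/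
abbrev HilbertTensor (H K : Type*) [NormedAddCommGroup H] [InnerProductSpace ℂ H]
    [NormedAddCommGroup K] [InnerProductSpace ℂ K] : Type _ :=
  UniformSpace.Completion (H ⊗[ℂ] K)

/-- The product vector `ψ ⊗ φ`. -/
def tmulVec (ψ : H) (φ : K) : HilbertTensor H K := ((ψ ⊗ₜ[ℂ] φ : H ⊗[ℂ] K) : HilbertTensor H K)

/-- The algebraic tensor product `D ⊙ D'` of two subspaces, inside the Hilbert tensor product. -/
def algTensor (D : Submodule ℂ H) (D' : Submodule ℂ K) : Submodule ℂ (HilbertTensor H K) :=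
  Submodule.span ℂ {Ψ | ∃ ψ ∈ D, ∃ φ ∈ D', Ψ = tmulVec ψ φ}

/-- The bounded operator `S ⊗ R`. -/
def tensorOp (S : H →L[ℂ] H) (R : K →L[ℂ] K) : HilbertTensor H K →L[ℂ] HilbertTensor H K :=
  ((UniformSpace.Completion.toComplL : H ⊗[ℂ] K →L[ℂ] HilbertTensor H K) ∘L
    TensorProduct.mapL S R).extend UniformSpace.Completion.toComplL

/-- The operator `A ⊗ 1` for a closable densely defined operator `A`: the closure of the operator
`ψ ⊗ φ ↦ A ψ ⊗ φ` on `D_A ⊙ K`. -/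
def tensorOne (A : H →ₗ.[ℂ] H) : HilbertTensor H K →ₗ.[ℂ] HilbertTensor H K :=
  (Submodule.span ℂ {p : HilbertTensor H K × HilbertTensor H K |
    ∃ (ψ : A.domain) (φ : K), p = (tmulVec (ψ : H) φ, tmulVec (A ψ) φ)}).topologicalClosure.toLinearPMap

/-- `E` is the product spectral measure on `ℝ^ι × ℝ^ι`: `E(B × C) = E₁(B) ⊗ E₂(C)`. -/
def IsProductPVM {ι : Type*} (E₁ : PVM (ι → ℝ) H) (E₂ : PVM (ι → ℝ) K)
    (E : PVM (ι ⊕ ι → ℝ) (HilbertTensor H K)) : Prop :=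
  ∀ B C : Set (ι → ℝ), MeasurableSet B → MeasurableSet C →
    E.proj {w | w ∘ Sum.inl ∈ B ∧ w ∘ Sum.inr ∈ C} = tensorOp (E₁.proj B) (E₂.proj C)

/-- The joint spectral measure `E^{X⊗Y}` on `ℝ^{2N}` of the `2N` commuting operators `X_μ ⊗ 1` and
`1 ⊗ Y_μ`, i.e. the product of the spectral measures of `X` and of `Y`. -/
def tensorSpectralMeasure {ι : Type*} (X : ι → H →ₗ.[ℂ] H) (Y : ι → K →ₗ.[ℂ] K) :
    PVM (ι ⊕ ι → ℝ) (HilbertTensor H K) :=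
  Classical.epsilon fun E => IsProductPVM (jointSpectralMeasure X) (jointSpectralMeasure Y) E

/-- The unitary operator `e^{i t X⊗Y}`, where `X⊗Y = ∑_μ X_μ ⊗ Y_μ` is the function
`(x, y) ↦ ∑_μ x_μ y_μ` of the `2N` commuting operators `X_μ ⊗ 1`, `1 ⊗ Y_μ`. -/
def expTensor {ι : Type*} [Fintype ι] (X : ι → H →ₗ.[ℂ] H) (Y : ι → K →ₗ.[ℂ] K) (t : ℝ) :
    HilbertTensor H K →L[ℂ] HilbertTensor H K :=
  (tensorSpectralMeasure X Y).calculus fun w =>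
    Complex.exp (Complex.I * ((t * ∑ μ, w (Sum.inl μ) * w (Sum.inr μ) : ℝ) : ℂ))

/-- The representation `U(x, y) = e^{-i x·X} ⊗ e^{i y·Y}` of `ℝ^{2N}`. -/
def rep {ι : Type*} [Fintype ι] (X : ι → H →ₗ.[ℂ] H) (Y : ι → K →ₗ.[ℂ] K) (w : ι ⊕ ι → ℝ) :
    HilbertTensor H K →L[ℂ] HilbertTensor H K :=
  tensorOp (expI X (-(w ∘ Sum.inl))) (expI Y (w ∘ Sum.inr))

/-- `T = ∫_S F(y) ⊗ dE(y)` on `D ⊙ D'` in the weak sense: for `ψ ∈ D`, `φ ∈ D'` and all product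
vectors `ψ' ⊗ φ'` one has
`⟪ψ' ⊗ φ', T (ψ ⊗ φ)⟫ = ∫_S ⟪ψ', F(y) ψ⟫ d⟪φ', E(y) φ⟫`, with an absolutely convergent integral. -/
def IsWeakTensorIntegral {Ω : Type*} [MeasurableSpace Ω] (S : Set Ω) (F : Ω → H →ₗ.[ℂ] H)
    (E : PVM Ω K) (D : Submodule ℂ H) (D' : Submodule ℂ K)
    (T : HilbertTensor H K →ₗ.[ℂ] HilbertTensor H K) : Prop :=
  ∀ ψ ∈ D, ∀ φ ∈ D', (∀ y ∈ S, ψ ∈ (F y).domain) ∧ ∀ (ψ' : H) (φ' : K),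
    (E.matrixElement φ' φ).IntegrableOn (fun y => ⟪ψ', valueAt (F y) ψ⟫_ℂ) S ∧
    ⟪tmulVec ψ' φ', valueAt T (tmulVec ψ φ)⟫_ℂ =
      E.setIntegral S (fun y => ⟪ψ', valueAt (F y) ψ⟫_ℂ) φ' φ

end Tensor

/-! ### Warped convolutions -/

section Warped

variable {n : Type*} [Fintype n] {G : Type*} [NormedAddCommGroup G] [InnerProductSpace ℂ G]
  [CompleteSpace G]

/-- The integrand of the regularised oscillatory integral which defines `∫ dE(z) F(z)`: the
function `χ(εz, εp) e^{-i z·p} ⟪Φ, V(p) F(z) Ψ⟫` of `(z, p)`, with `V(p) = ∫ e^{i p·w} dE(w)`. -/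
def oscIntegrand (E : PVM (n → ℝ) G) (F : (n → ℝ) → G →ₗ.[ℂ] G)
    (χ : 𝓢((n → ℝ) × (n → ℝ), ℂ)) (ε : ℝ) (Φ Ψ : G) (q : (n → ℝ) × (n → ℝ)) : ℂ :=
  χ (ε • q) * Complex.exp (-(Complex.I * ((q.1 ⬝ᵥ q.2 : ℝ) : ℂ))) *
    ⟪Φ, E.calculus (fun w => Complex.exp (Complex.I * ((q.2 ⬝ᵥ w : ℝ) : ℂ)))
      (valueAt (F q.1) Ψ)⟫_ℂ

/-- `T = ∫ dE(z) F(z)` on `𝒟` in the weak sense, with test vectors in `𝒯`, as an oscillatory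
integral: `⟪Φ, T Ψ⟫` is the limit as `ε → 0+` of
`(2π)^{-n} ∫∫ χ(εz, εp) e^{-i z·p} ⟪Φ, V(p) F(z) Ψ⟫ dz dp`
for every Schwartz function `χ` with `χ(0) = 1`. -/
def IsWeakOscillatoryIntegral (E : PVM (n → ℝ) G) (F : (n → ℝ) → G →ₗ.[ℂ] G)
    (𝒯 𝒟 : Submodule ℂ G) (T : G →ₗ.[ℂ] G) : Prop :=
  ∀ Ψ ∈ 𝒟, (∀ z, Ψ ∈ (F z).domain) ∧
    ∀ Φ ∈ 𝒯, ∀ χ : 𝓢((n → ℝ) × (n → ℝ), ℂ), χ 0 = 1 →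
      (∀ ε : ℝ, 0 < ε → Integrable (oscIntegrand E F χ ε Φ Ψ)) ∧
      Tendsto (fun ε : ℝ => ((((2 * Real.pi) ^ Fintype.card n)⁻¹ : ℝ) : ℂ) *
          ∫ q, oscIntegrand E F χ ε Φ Ψ q)
        (𝓝[>] 0) (𝓝 ⟪Φ, valueAt T Ψ⟫_ℂ)

/-- `T` is, on `𝒟` and in the weak sense, the warped convolution
`B_Θ = ∫ dE(z) U(Θz)⁻¹ B U(Θz)`. -/
def IsWarpedConvolution (E : PVM (n → ℝ) G) (U : (n → ℝ) → G →L[ℂ] G) (Θ : Matrix n n ℝ)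
    (B : G →ₗ.[ℂ] G) (𝒯 𝒟 : Submodule ℂ G) (T : G →ₗ.[ℂ] G) : Prop :=
  IsWeakOscillatoryIntegral E
    (fun z => sandwich (Ring.inverse (U (Θ.mulVec z))) B (U (Θ.mulVec z))) 𝒯 𝒟 T

end Warped

/-- The standard symplectic matrix `(0 1; -1 0)`. -/
def stdSymplectic (ι : Type*) [DecidableEq ι] : Matrix (ι ⊕ ι) (ι ⊕ ι) ℝ :=
  Matrix.fromBlocks 0 1 (-1) 0

end WarpedConv

end

set_option linter.unusedSectionVars false

noncomputable section

namespace WarpedConv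

namespace PVM

variable {Ω : Type*} [MeasurableSpace Ω] {H : Type*} [NormedAddCommGroup H]
  [InnerProductSpace ℂ H] [CompleteSpace H]

/-! ### Elementary properties of projection-valued measures -/

/-! All three expressions have the same matrix elements, namely integrals of one scalar function.
For `ψ ∈ D` and arbitrary `ψ'`, put `g(q, y) = ⟪ψ', e^{iq·X} e^{iy·X} A e^{-iy·X} ψ⟫`
(`orbitElement`). It grows at most polynomially in `y`, and it is continuous although `y ↦ A
e^{-iy·X} ψ` need not be norm continuous: closability of `A` makes the domain of the adjoint dense,
which with local boundedness gives weak continuity. A smooth vector `φ` has a spectral measure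
`‖E^Y(·) φ‖²` for which all polynomials are square integrable. The common matrix element is `∫ g(0,
y) d⟪φ', E^Y(y) φ⟫`.

Conjugation (`IsPolyBoundedAt.exists_tensorOne`): replacing the identity of `ℝ^N` by simple
functions `σ_n`, the vector `e^{-iX⊗Y}(ψ ⊗ φ)` is a norm limit of the finite sums `∑_r e^{-ir·X} ψ ⊗
E^Y(σ_n = r) φ`. The operator `A ⊗ 1` sends these to `∑_r A e^{-ir·X} ψ ⊗ E^Y(σ_n = r) φ`, which
stay bounded. A weak limit point exists, and closed subspaces are weakly closed, so the limit vector
lies in the domain of `A ⊗ 1`. Orthogonality of the fibre projections makes the matrix elements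
single integrals of `g(0, σ_n(y))`, which converge by dominated convergence.

Oscillatory integral (`IsPolyBoundedAt.hasRegularizedLimit`): with `z = (x, y)`, `p = (q, r)`, one
has `U(Θz) = e^{-iy·X} ⊗ e^{-ix·Y}`. The `Y`-exponentials cancel on conjugation, so the matrix
element is `g(q, y) ∫ e^{ir·s} d⟪φ', E^Y(s) φ⟫`. Regrouping the variables into `(x, r)` and `(q, y)`
preserves the phase `z·p`. Then `g` depends only on the second group, and the integral over the
first group is a Fourier transform of the cutoff which concentrates the second group at `(0, s)` as
`ε → 0`. Fourier inversion supplies the factor `(2π)^{2N}`, and dominated convergence gives the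
limit.

The spectral measures are chosen by `Classical.epsilon`, so their existence must be proved.
Commuting normal resolvents generate a commutative C*-algebra; Gelfand duality and Riesz–Markov
yield a projection-valued measure on its spectrum, transported to `ℝ^ι` by `w ↦ w⁻¹ + i`
(`exists_pvm_of_resolvents`). The same construction, applied to the resolvents of `X_μ ⊗ 1` and `1 ⊗
Y_μ`, gives the product measure (`exists_isProductPVM`). -/

theorem proj_mul_self (E : PVM Ω H) {B : Set Ω} (hB : MeasurableSet B) :
    E.proj B * E.proj B = E.proj B :=
  (E.isStarProjection B hB).isIdempotentElem

theorem proj_proj_self (E : PVM Ω H) {B : Set Ω} (hB : MeasurableSet B) (φ : H) :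
    E.proj B (E.proj B φ) = E.proj B φ :=
  congrArg (fun T : H →L[ℂ] H => T φ) (E.proj_mul_self hB)

theorem star_proj (E : PVM Ω H) {B : Set Ω} (hB : MeasurableSet B) :
    star (E.proj B) = E.proj B :=
  (E.isStarProjection B hB).isSelfAdjoint

theorem inner_proj_left (E : PVM Ω H) {B : Set Ω} (hB : MeasurableSet B) (φ ψ : H) :
    ⟪E.proj B φ, ψ⟫_ℂ = ⟪φ, E.proj B ψ⟫_ℂ := by
  have h := ContinuousLinearMap.adjoint_inner_left (E.proj B) ψ φ
  rwa [← ContinuousLinearMap.star_eq_adjoint, E.star_proj hB] at h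

theorem inner_proj_self (E : PVM Ω H) {B : Set Ω} (hB : MeasurableSet B) (φ : H) :
    ⟪φ, E.proj B φ⟫_ℂ = ((‖E.proj B φ‖ ^ 2 : ℝ) : ℂ) := by
  have h := inner_self_eq_norm_sq_to_K (𝕜 := ℂ) (E.proj B φ)
  rw [E.inner_proj_left hB, E.proj_proj_self hB] at h
  simpa using h

theorem proj_union (E : PVM Ω H) {B C : Set Ω} (hB : MeasurableSet B) (hC : MeasurableSet C)
    (h : Disjoint B C) : E.proj (B ∪ C) = E.proj B + E.proj C := by
  ext φ
  -- Finite additivity is countable additivity for the sequence `B, C, ∅, ∅, …`.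
  have key := E.hasSum (fun n => if n = 0 then B else if n = 1 then C else ∅)
    (fun n => by split_ifs <;> simp [*])
    (fun i j hij => by
      simp only [Function.onFun]
      split_ifs <;> simp_all [disjoint_comm]) φ
  have hU : (⋃ n : ℕ, if n = 0 then B else if n = 1 then C else ∅) = B ∪ C := by
    ext x
    simp only [Set.mem_iUnion, Set.mem_union]
    constructor
    · rintro ⟨n, hn⟩
      split_ifs at hn
      · exact Or.inl hn
      · exact Or.inr hn
      · exact hn.elim
    · rintro (hx | hx)
      · exact ⟨0, by simpa using hx⟩
      · exact ⟨1, by simpa using hx⟩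
  rw [hU] at key
  have h2 : HasSum (fun n : ℕ => E.proj (if n = 0 then B else if n = 1 then C else ∅) φ)
      (∑ n ∈ Finset.range 2, E.proj (if n = 0 then B else if n = 1 then C else ∅) φ) :=
    hasSum_sum_of_ne_finset_zero (by
      intro n hn
      have h0 : n ≠ 0 := by rintro rfl; simp at hn
      have h1 : n ≠ 1 := by rintro rfl; simp at hn
      simp [h0, h1, E.proj_empty])
  have := key.unique h2
  simpa [Finset.sum_range_succ] using this

/-- Since `P + Q` is again idempotent, `PQ + QP = 0`. Multiplying by `P` on the left and on the
right gives `PQ = -PQP = QP`, so `2PQ = 0`. -/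
theorem proj_mul_of_disjoint (E : PVM Ω H) {B C : Set Ω} (hB : MeasurableSet B)
    (hC : MeasurableSet C) (h : Disjoint B C) : E.proj B * E.proj C = 0 := by
  have h1 := E.proj_mul_self (hB.union hC)
  rw [E.proj_union hB hC h] at h1
  set P := E.proj B
  set Q := E.proj C
  have hP : P * P = P := E.proj_mul_self hB
  have hQ : Q * Q = Q := E.proj_mul_self hC
  have h2 : P * Q + Q * P = 0 := by
    have : (P + Q) * (P + Q) = P * P + Q * Q + (P * Q + Q * P) := by noncomm_ring
    rw [this, hP, hQ] at h1
    simpa using h1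
  have h3 : P * Q + P * (Q * P) = 0 := by
    have := congrArg (fun T => P * T) h2
    simpa [mul_add, ← mul_assoc, hP] using this
  have h4 : P * (Q * P) + Q * P = 0 := by
    have := congrArg (fun T => T * P) h2
    simpa [add_mul, mul_assoc, hP] using this
  have h5 : P * Q = Q * P := by
    have h6 := h3.trans h4.symm
    rw [add_comm (P * (Q * P))] at h6
    exact add_right_cancel h6
  rw [← h5] at h2
  have h7 : (2 : ℂ) • (P * Q) = 0 := by rw [two_smul]; exact h2
  simpa using h7

theorem proj_mul (E : PVM Ω H) {B C : Set Ω} (hB : MeasurableSet B)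
    (hC : MeasurableSet C) : E.proj B * E.proj C = E.proj (B ∩ C) := by
  have h1 : E.proj B = E.proj (B ∩ C) + E.proj (B \ C) := by
    rw [← E.proj_union (hB.inter hC) (hB.diff hC) (Set.disjoint_sdiff_inter.symm)]
    rw [Set.inter_union_sdiff]
  have h2 : E.proj C = E.proj (B ∩ C) + E.proj (C \ B) := by
    rw [← E.proj_union (hB.inter hC) (hC.diff hB)
      (by rw [Set.inter_comm]; exact Set.disjoint_sdiff_inter.symm)]
    rw [Set.inter_comm, Set.inter_union_sdiff]
  rw [h2, mul_add, E.proj_mul_of_disjoint hB (hC.diff hB) Set.disjoint_sdiff_right, add_zero, h1,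
    add_mul, E.proj_mul_self (hB.inter hC),
    E.proj_mul_of_disjoint (hB.diff hC) (hB.inter hC) Set.disjoint_sdiff_inter, add_zero]

theorem proj_proj (E : PVM Ω H) {B C : Set Ω} (hB : MeasurableSet B)
    (hC : MeasurableSet C) (φ : H) : E.proj B (E.proj C φ) = E.proj (B ∩ C) φ :=
  congrArg (fun T : H →L[ℂ] H => T φ) (E.proj_mul hB hC)

theorem inner_proj_proj (E : PVM Ω H) {B C : Set Ω} (hB : MeasurableSet B)
    (hC : MeasurableSet C) (φ ψ : H) :
    ⟪E.proj B φ, E.proj C ψ⟫_ℂ = ⟪φ, E.proj (B ∩ C) ψ⟫_ℂ := by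
  rw [E.inner_proj_left hB, E.proj_proj hB hC]

theorem hasSum_norm_sq (E : PVM Ω H) (φ : H) (B : ℕ → Set Ω) (hB : ∀ n, MeasurableSet (B n))
    (hd : Pairwise (Function.onFun Disjoint B)) :
    HasSum (fun n => ‖E.proj (B n) φ‖ ^ 2) (‖E.proj (⋃ n, B n) φ‖ ^ 2) := by
  have h := (E.hasSum B hB hd φ).mapL (innerSL ℂ φ)
  simp only [innerSL_apply_apply, E.inner_proj_self (hB _),
    E.inner_proj_self (MeasurableSet.iUnion hB)] at h
  exact_mod_cast h

/-- The positive measure `B ↦ ‖E(B) φ‖² = ⟪φ, E(B) φ⟫`. -/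
def meas (E : PVM Ω H) (φ : H) : Measure Ω :=
  Measure.ofMeasurable (fun B _ => ENNReal.ofReal (‖E.proj B φ‖ ^ 2)) (by simp [E.proj_empty])
    (fun B hB hd => by
      have h := E.hasSum_norm_sq φ B hB hd
      rw [← h.tsum_eq, ENNReal.ofReal_tsum_of_nonneg (fun _ => sq_nonneg _) h.summable])

theorem meas_apply (E : PVM Ω H) (φ : H) {B : Set Ω} (hB : MeasurableSet B) :
    E.meas φ B = ENNReal.ofReal (‖E.proj B φ‖ ^ 2) :=
  Measure.ofMeasurable_apply B hB

theorem meas_real_apply (E : PVM Ω H) (φ : H) {B : Set Ω} (hB : MeasurableSet B) :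
    (E.meas φ).real B = ‖E.proj B φ‖ ^ 2 := by
  rw [measureReal_def, E.meas_apply φ hB, ENNReal.toReal_ofReal (sq_nonneg _)]

instance isFiniteMeasure_meas (E : PVM Ω H) (φ : H) : IsFiniteMeasure (E.meas φ) :=
  ⟨by rw [E.meas_apply φ MeasurableSet.univ]; exact ENNReal.ofReal_lt_top⟩

theorem inner_proj_proj_eq_measureReal (E : PVM Ω H) {B C : Set Ω} (hB : MeasurableSet B)
    (hC : MeasurableSet C) (φ : H) :
    ⟪E.proj B φ, E.proj C φ⟫_ℂ = (((E.meas φ).real (B ∩ C) : ℝ) : ℂ) := by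
  rw [E.inner_proj_proj hB hC, E.inner_proj_self (hB.inter hC), E.meas_real_apply _ (hB.inter hC)]

/-! ### The cyclic isometry `L²(⟪φ, E φ⟫) → H` -/

/-- Formal linear combinations of indicator functions, as elements of `L²`. -/
def formalLp (μ : Measure Ω) [IsFiniteMeasure μ] :
    ({B : Set Ω // MeasurableSet B} →₀ ℂ) →ₗ[ℂ] Lp ℂ 2 μ :=
  Finsupp.linearCombination ℂ fun B => indicatorConstLp 2 B.2 (measure_ne_top μ B.1) (1 : ℂ)

/-- Formal linear combinations of projections applied to a vector. -/
def formalVec (E : PVM Ω H) (φ : H) : ({B : Set Ω // MeasurableSet B} →₀ ℂ) →ₗ[ℂ] H :=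
  Finsupp.linearCombination ℂ fun B => E.proj B.1 φ

theorem denseRange_formalLp (μ : Measure Ω) [IsFiniteMeasure μ] :
    DenseRange (formalLp μ) := by
  intro f
  change f ∈ closure (LinearMap.range (formalLp μ) : Set (Lp ℂ 2 μ))
  rw [← Submodule.topologicalClosure_coe]
  induction f using Lp.induction (hp_ne_top := (ENNReal.ofNat_ne_top : (2 : ENNReal) ≠ ⊤)) with
  | indicatorConst c hB hμ =>
    apply Submodule.le_topologicalClosure
    refine ⟨Finsupp.single ⟨_, hB⟩ c, ?_⟩
    rw [formalLp, Finsupp.linearCombination_single, Lp.simpleFunc.coe_indicatorConst]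
    ext1
    filter_upwards [Lp.coeFn_smul c (indicatorConstLp 2 hB hμ.ne (1 : ℂ)),
      indicatorConstLp_coeFn (p := 2) (hs := hB) (hμs := hμ.ne) (c := (1 : ℂ)),
      indicatorConstLp_coeFn (p := 2) (hs := hB) (hμs := hμ.ne) (c := c)] with x h1 h2 h3
    rw [h1, h3, Pi.smul_apply, h2]
    simp [Set.indicator]
  | add hf hg hd h1 h2 => exact Submodule.add_mem _ h1 h2
  | isClosed => exact Submodule.isClosed_topologicalClosure _

/-- The vectors `E(B) φ` and the indicators of `B` in `L²` have the same Gram matrix, the measure of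
intersections. Hence the correspondence is well defined and extends to an isometry. -/
theorem inner_formalVec (E : PVM Ω H) (φ : H) (c d : {B : Set Ω // MeasurableSet B} →₀ ℂ) :
    ⟪E.formalVec φ c, E.formalVec φ d⟫_ℂ =
      ⟪formalLp (E.meas φ) c, formalLp (E.meas φ) d⟫_ℂ := by
  simp only [formalVec, formalLp, Finsupp.linearCombination_apply, Finsupp.sum, sum_inner,
    inner_sum, inner_smul_left, inner_smul_right]
  refine Finset.sum_congr rfl fun B _ => congrArg _ (Finset.sum_congr rfl fun C _ => ?_)
  rw [E.inner_proj_proj_eq_measureReal C.2 B.2, L2.inner_indicatorConstLp_indicatorConstLp]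
  simp

theorem norm_formalVec (E : PVM Ω H) (φ : H) (c : {B : Set Ω // MeasurableSet B} →₀ ℂ) :
    ‖E.formalVec φ c‖ = ‖formalLp (E.meas φ) c‖ := by
  have h := E.inner_formalVec φ c c
  rw [inner_self_eq_norm_sq_to_K, inner_self_eq_norm_sq_to_K] at h
  have h' : ‖E.formalVec φ c‖ ^ 2 = ‖formalLp (E.meas φ) c‖ ^ 2 := by exact_mod_cast h
  exact (sq_eq_sq₀ (norm_nonneg _) (norm_nonneg _)).1 h'

/-- The isometry `f ↦ ∫ f dE φ` of `L²(⟪φ, E φ⟫)` into `H`. -/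
def cycL (E : PVM Ω H) (φ : H) : Lp ℂ 2 (E.meas φ) →L[ℂ] H :=
  (E.formalVec φ).extendOfNorm (formalLp (E.meas φ))

theorem cycL_formalLp (E : PVM Ω H) (φ : H) (c : {B : Set Ω // MeasurableSet B} →₀ ℂ) :
    E.cycL φ (formalLp (E.meas φ) c) = E.formalVec φ c :=
  LinearMap.extendOfNorm_eq (denseRange_formalLp _)
    ⟨1, fun x => by rw [one_mul, E.norm_formalVec]⟩ c

theorem norm_cycL (E : PVM Ω H) (φ : H) (f : Lp ℂ 2 (E.meas φ)) : ‖E.cycL φ f‖ = ‖f‖ := by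
  induction f using (denseRange_formalLp (E.meas φ)).induction_on with
  | hp => exact isClosed_eq (by fun_prop) (by fun_prop)
  | ih c => rw [cycL_formalLp, norm_formalVec]

theorem inner_cycL (E : PVM Ω H) (φ : H) (f g : Lp ℂ 2 (E.meas φ)) :
    ⟪E.cycL φ f, E.cycL φ g⟫_ℂ = ⟪f, g⟫_ℂ :=
  (⟨(E.cycL φ).toLinearMap, E.norm_cycL φ⟩ : Lp ℂ 2 (E.meas φ) →ₗᵢ[ℂ] H).inner_map_map f g

open Classical in
/-- The vector `∫ f dE φ`, for `f` square integrable with respect to `⟪φ, E φ⟫`. -/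
def cyc (E : PVM Ω H) (φ : H) (f : Ω → ℂ) : H :=
  if h : MemLp f 2 (E.meas φ) then E.cycL φ h.toLp else 0

theorem cyc_eq (E : PVM Ω H) {φ : H} {f : Ω → ℂ} (h : MemLp f 2 (E.meas φ)) :
    E.cyc φ f = E.cycL φ h.toLp := dif_pos h

theorem cyc_congr (E : PVM Ω H) {φ : H} {f g : Ω → ℂ} (h : f =ᵐ[E.meas φ] g) :
    E.cyc φ f = E.cyc φ g := by
  by_cases hf : MemLp f 2 (E.meas φ)
  · have hg := hf.ae_eq h
    rw [E.cyc_eq hf, E.cyc_eq hg, MemLp.toLp_congr hf hg h]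
  · have hg : ¬ MemLp g 2 (E.meas φ) := fun hg => hf (hg.ae_eq h.symm)
    rw [cyc, cyc, dif_neg hf, dif_neg hg]

theorem cyc_add (E : PVM Ω H) {φ : H} {f g : Ω → ℂ} (hf : MemLp f 2 (E.meas φ))
    (hg : MemLp g 2 (E.meas φ)) : E.cyc φ (f + g) = E.cyc φ f + E.cyc φ g := by
  rw [E.cyc_eq hf, E.cyc_eq hg, E.cyc_eq (hf.add hg), MemLp.toLp_add, map_add]

theorem cyc_sub (E : PVM Ω H) {φ : H} {f g : Ω → ℂ} (hf : MemLp f 2 (E.meas φ))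
    (hg : MemLp g 2 (E.meas φ)) : E.cyc φ (f - g) = E.cyc φ f - E.cyc φ g := by
  rw [E.cyc_eq hf, E.cyc_eq hg, E.cyc_eq (hf.sub hg), MemLp.toLp_sub, map_sub]

theorem cyc_smul (E : PVM Ω H) {φ : H} {f : Ω → ℂ} (hf : MemLp f 2 (E.meas φ)) (c : ℂ) :
    E.cyc φ (c • f) = c • E.cyc φ f := by
  rw [E.cyc_eq hf, E.cyc_eq (hf.const_smul c), MemLp.toLp_const_smul, map_smul]

theorem inner_cyc (E : PVM Ω H) {φ : H} {f g : Ω → ℂ} (hf : MemLp f 2 (E.meas φ))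
    (hg : MemLp g 2 (E.meas φ)) :
    ⟪E.cyc φ f, E.cyc φ g⟫_ℂ = ∫ x, g x * star (f x) ∂E.meas φ := by
  rw [E.cyc_eq hf, E.cyc_eq hg, inner_cycL, L2.inner_def]
  refine integral_congr_ae ?_
  filter_upwards [hf.coeFn_toLp, hg.coeFn_toLp] with x h1 h2
  rw [h1, h2]
  rfl

theorem norm_cyc_sq (E : PVM Ω H) {φ : H} {f : Ω → ℂ} (hf : MemLp f 2 (E.meas φ)) :
    ‖E.cyc φ f‖ ^ 2 = ∫ x, ‖f x‖ ^ 2 ∂E.meas φ := by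
  have h := E.inner_cyc hf hf
  rw [inner_self_eq_norm_sq_to_K] at h
  have h2 : ∀ x, f x * star (f x) = ((‖f x‖ ^ 2 : ℝ) : ℂ) := fun x => by
    rw [Complex.star_def, Complex.mul_conj, Complex.normSq_eq_norm_sq]
  simp only [h2, integral_complex_ofReal] at h
  exact Complex.ofReal_injective (by simpa using h)

theorem memLp_indicator (μ : Measure Ω) [IsFiniteMeasure μ] {B : Set Ω}
    (hB : MeasurableSet B) (c : ℂ) : MemLp (B.indicator fun _ => c) 2 μ :=
  memLp_indicator_const 2 hB c (Or.inr (measure_ne_top _ _))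

theorem cyc_indicator (E : PVM Ω H) (φ : H) {B : Set Ω} (hB : MeasurableSet B) (c : ℂ) :
    E.cyc φ (B.indicator fun _ => c) = c • E.proj B φ := by
  have h1 : (B.indicator fun _ => c) = c • (B.indicator fun _ => (1 : ℂ)) := by
    ext x; simp [Set.indicator]
  have hm := memLp_indicator (E.meas φ) hB 1
  rw [h1, E.cyc_smul hm, E.cyc_eq hm]
  congr 1
  have h := E.cycL_formalLp φ (Finsupp.single ⟨B, hB⟩ 1)
  rw [formalLp, formalVec, Finsupp.linearCombination_single, Finsupp.linearCombination_single,
    one_smul, one_smul] at h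
  exact h

theorem cyc_one (E : PVM Ω H) (φ : H) : E.cyc φ (fun _ => 1) = φ := by
  have h := E.cyc_indicator φ MeasurableSet.univ 1
  simpa [E.proj_univ] using h

/-- Dominated convergence for `f ↦ ∫ f dE φ`. -/
theorem tendsto_cyc (E : PVM Ω H) {φ : H} {F : ℕ → Ω → ℂ} {f : Ω → ℂ} {b : Ω → ℝ}
    (hF : ∀ n, AEStronglyMeasurable (F n) (E.meas φ)) (hb : MemLp b 2 (E.meas φ))
    (hFb : ∀ n, ∀ᵐ x ∂E.meas φ, ‖F n x‖ ≤ b x)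
    (hlim : ∀ᵐ x ∂E.meas φ, Tendsto (fun n => F n x) atTop (𝓝 (f x))) :
    Tendsto (fun n => E.cyc φ (F n)) atTop (𝓝 (E.cyc φ f)) := by
  have hfm : AEStronglyMeasurable f (E.meas φ) := aestronglyMeasurable_of_tendsto_ae _ hF hlim
  have hfb : ∀ᵐ x ∂E.meas φ, ‖f x‖ ≤ b x := by
    filter_upwards [hlim, ae_all_iff.2 hFb] with x h1 h2
    exact le_of_tendsto h1.norm (Eventually.of_forall h2)
  have hf2 : MemLp f 2 (E.meas φ) := hb.mono' hfm hfb
  have hF2 : ∀ n, MemLp (F n) 2 (E.meas φ) := fun n => hb.mono' (hF n) (hFb n)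
  rw [tendsto_iff_norm_sub_tendsto_zero]
  have hsq : Tendsto (fun n => ‖E.cyc φ (F n) - E.cyc φ f‖ ^ 2) atTop (𝓝 0) := by
    have h1 : ∀ n, ‖E.cyc φ (F n) - E.cyc φ f‖ ^ 2 = ∫ x, ‖F n x - f x‖ ^ 2 ∂E.meas φ := fun n => by
      rw [← E.cyc_sub (hF2 n) hf2, E.norm_cyc_sq ((hF2 n).sub hf2)]
      rfl
    simp only [h1]
    have h0 : (0 : ℝ) = ∫ x, (0 : ℝ) ∂E.meas φ := by simp
    rw [h0]
    refine tendsto_integral_of_dominated_convergence (fun x => (2 * b x) ^ 2)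
      (fun n => ((hF n).sub hfm).norm.pow 2) ((hb.const_mul 2).integrable_sq) (fun n => ?_) ?_
    · filter_upwards [hFb n, hfb] with x h1 h2
      rw [Real.norm_of_nonneg (sq_nonneg _)]
      refine pow_le_pow_left₀ (norm_nonneg _) ((norm_sub_le _ _).trans (by linarith)) 2
    · filter_upwards [hlim] with x hx
      have := (tendsto_iff_norm_sub_tendsto_zero.1 hx).pow 2
      simpa using this
  have := hsq.sqrt
  simpa using this

end PVM

/-! ### Simple approximation, bounded calculus and densities of matrix elements -/

namespace PVM

variable {Ω : Type*} [MeasurableSpace Ω] {H : Type*} [NormedAddCommGroup H]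
  [InnerProductSpace ℂ H] [CompleteSpace H]

theorem cyc_finsetSum (E : PVM Ω H) {φ : H} {ι : Type*} (s : Finset ι) {f : ι → Ω → ℂ}
    (hf : ∀ i ∈ s, MemLp (f i) 2 (E.meas φ)) :
    E.cyc φ (∑ i ∈ s, f i) = ∑ i ∈ s, E.cyc φ (f i) := by
  classical
  induction s using Finset.induction_on with
  | empty =>
    have h := E.cyc_indicator φ MeasurableSet.empty 0
    simpa [Pi.zero_def] using h
  | insert i s hi ih =>
    rw [Finset.sum_insert hi, Finset.sum_insert hi,
      E.cyc_add (hf i (by simp)) (memLp_finsetSum' s fun j hj => hf j (by simp [hj])),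
      ih fun j hj => hf j (by simp [hj])]

theorem simpleFunc_eq_sum_indicator (s : SimpleFunc Ω ℂ) :
    (s : Ω → ℂ) = ∑ c ∈ s.range, (s ⁻¹' {c}).indicator fun _ => c := by
  classical
  ext x
  rw [Finset.sum_apply, Finset.sum_eq_single (s x)]
  · simp
  · intro c _ hc
    simp [Set.indicator, hc.symm]
  · intro h
    exact (h (s.mem_range_self x)).elim

theorem cyc_simpleFunc (E : PVM Ω H) (φ : H) (s : SimpleFunc Ω ℂ) :
    E.cyc φ s = ∑ c ∈ s.range, c • E.proj (s ⁻¹' {c}) φ := by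
  rw [simpleFunc_eq_sum_indicator s, cyc_finsetSum _ _ fun c _ =>
    memLp_indicator _ (s.measurableSet_fiber c) c]
  rw [← simpleFunc_eq_sum_indicator s]
  exact Finset.sum_congr rfl fun c _ => E.cyc_indicator φ (s.measurableSet_fiber c) c

/-- The standard approximation of a measurable function by simple functions. -/
def approx {f : Ω → ℂ} (hf : Measurable f) (n : ℕ) : SimpleFunc Ω ℂ :=
  SimpleFunc.approxOn f hf Set.univ 0 (Set.mem_univ 0) n

theorem tendsto_approx {f : Ω → ℂ} (hf : Measurable f) (x : Ω) :
    Tendsto (fun n => approx hf n x) atTop (𝓝 (f x)) :=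
  SimpleFunc.tendsto_approxOn hf (Set.mem_univ 0) (by simp)

theorem norm_approx_le {f : Ω → ℂ} (hf : Measurable f) (n : ℕ) (x : Ω) :
    ‖approx hf n x‖ ≤ ‖f x‖ + ‖f x‖ :=
  SimpleFunc.norm_approxOn_zero_le hf (Set.mem_univ 0) x n

theorem tendsto_cyc_approx (E : PVM Ω H) {φ : H} {f : Ω → ℂ} (hf : Measurable f)
    (h2 : MemLp f 2 (E.meas φ)) :
    Tendsto (fun n => E.cyc φ (approx hf n)) atTop (𝓝 (E.cyc φ f)) :=
  E.tendsto_cyc (fun n => (approx hf n).aestronglyMeasurable) (h2.norm.add h2.norm)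
    (fun n => Eventually.of_forall fun x => norm_approx_le hf n x)
    (Eventually.of_forall fun x => tendsto_approx hf x)

/-- For simple `f` this is `E(B) E(C) = E(B ∩ C)`; dominated convergence extends it to every square
integrable `f`. -/
theorem proj_cyc (E : PVM Ω H) {φ : H} {f : Ω → ℂ} (hf : Measurable f)
    (h2 : MemLp f 2 (E.meas φ)) {B : Set Ω} (hB : MeasurableSet B) :
    E.proj B (E.cyc φ f) = E.cyc φ (B.indicator f) := by
  have h1 := ((E.proj B).continuous.tendsto _).comp (E.tendsto_cyc_approx hf h2)
  have h3 : Tendsto (fun n => E.cyc φ (B.indicator (approx hf n))) atTop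
      (𝓝 (E.cyc φ (B.indicator f))) := by
    refine E.tendsto_cyc (fun n => (approx hf n).aestronglyMeasurable.indicator hB)
      (h2.norm.add h2.norm) (fun n => Eventually.of_forall fun x => ?_)
      (Eventually.of_forall fun x => ?_)
    · exact (norm_indicator_le_norm_self _ _).trans (norm_approx_le hf n x)
    · by_cases hx : x ∈ B
      · simpa [hx] using tendsto_approx hf x
      · simp [hx]
  refine tendsto_nhds_unique h1 (h3.congr fun n => ?_)
  set s := approx hf n
  have hi : B.indicator (s : Ω → ℂ) = ∑ c ∈ s.range, (B ∩ s ⁻¹' {c}).indicator fun _ => c := by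
    conv_lhs => rw [simpleFunc_eq_sum_indicator s]
    ext x
    by_cases hx : x ∈ B <;> simp [Finset.sum_apply, Set.indicator, hx]
  rw [Function.comp_apply, E.cyc_simpleFunc, hi, cyc_finsetSum _ _ fun c _ =>
    memLp_indicator _ (hB.inter (s.measurableSet_fiber c)) c, map_sum]
  refine Finset.sum_congr rfl fun c _ => ?_
  rw [E.cyc_indicator φ (hB.inter (s.measurableSet_fiber c)), map_smul,
    E.proj_proj hB (s.measurableSet_fiber c)]

/-- `E(B)` acts on `∫ f dE φ` by cutting `f` off to `B`, and the cyclic map is isometric. This is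
what turns statements about domains of iterated operators into moment conditions. -/
theorem meas_cyc (E : PVM Ω H) {φ : H} {f : Ω → ℂ} (hf : Measurable f)
    (h2 : MemLp f 2 (E.meas φ)) :
    E.meas (E.cyc φ f) = (E.meas φ).withDensity fun x => ((‖f x‖₊ ^ 2 : NNReal) : ENNReal) := by
  ext B hB
  rw [E.meas_apply _ hB, E.proj_cyc hf h2 hB, withDensity_apply _ hB,
    E.norm_cyc_sq (h2.indicator hB), ← lintegral_indicator hB,
    ofReal_integral_eq_lintegral_ofReal (h2.indicator hB).norm.integrable_sq
      (Eventually.of_forall fun x => sq_nonneg _)]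
  refine lintegral_congr fun x => ?_
  by_cases hx : x ∈ B
  · simp only [hx, Set.indicator_of_mem]
    rw [ENNReal.ofReal_pow (norm_nonneg _), ofReal_norm, ENNReal.coe_pow, enorm_eq_nnnorm]
  · simp [hx]

theorem memLp_cyc_iff (E : PVM Ω H) {φ : H} {f g : Ω → ℂ} (hf : Measurable f)
    (h2 : MemLp f 2 (E.meas φ)) (hg : Measurable g) :
    MemLp g 2 (E.meas (E.cyc φ f)) ↔ MemLp (fun x => g x * f x) 2 (E.meas φ) := by
  rw [memLp_two_iff_integrable_sq_norm hg.aestronglyMeasurable,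
    memLp_two_iff_integrable_sq_norm (f := fun x => g x * f x) (hg.mul hf).aestronglyMeasurable,
    E.meas_cyc hf h2,
    integrable_withDensity_iff_integrable_coe_smul (by fun_prop)]
  refine iff_of_eq (congrArg (fun k => Integrable k (E.meas φ)) ?_)
  ext x
  simp [mul_pow, mul_comm]

/-- Multiplicativity of the calculus, unbounded functions included. Only `g` is approximated, so
that the products are dominated by a multiple of `|g f|`, which is square integrable by assumption.
-/
theorem cyc_cyc (E : PVM Ω H) {φ : H} {f g : Ω → ℂ} (hf : Measurable f)
    (h2 : MemLp f 2 (E.meas φ)) (hg : Measurable g)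
    (hgf : MemLp (fun x => g x * f x) 2 (E.meas φ)) :
    E.cyc (E.cyc φ f) g = E.cyc φ (fun x => g x * f x) := by
  have hg2 := (E.memLp_cyc_iff hf h2 hg).2 hgf
  have h1 := E.tendsto_cyc_approx hg hg2
  have h3 : Tendsto (fun n => E.cyc φ (fun x => approx hg n x * f x)) atTop
      (𝓝 (E.cyc φ (fun x => g x * f x))) := by
    refine E.tendsto_cyc
      (fun n => ((approx hg n).measurable.mul hf).aestronglyMeasurable)
      (hgf.norm.add hgf.norm) (fun n => Eventually.of_forall fun x => ?_)
      (Eventually.of_forall fun x => ?_)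
    · have := mul_le_mul_of_nonneg_right (norm_approx_le hg n x) (norm_nonneg (f x))
      simpa [add_mul] using this
    · exact (tendsto_approx hg x).mul_const _
  refine tendsto_nhds_unique h1 (h3.congr fun n => ?_)
  set s := approx hg n
  have hi : (fun x => s x * f x) = ∑ c ∈ s.range, c • (s ⁻¹' {c}).indicator f := by
    conv_lhs => rw [simpleFunc_eq_sum_indicator s]
    ext x
    simp [Finset.sum_apply, Set.indicator]
  rw [E.cyc_simpleFunc, hi, cyc_finsetSum _ _ fun c _ =>
    (h2.indicator (s.measurableSet_fiber c)).const_smul c]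
  refine Finset.sum_congr rfl fun c _ => ?_
  rw [E.cyc_smul (h2.indicator (s.measurableSet_fiber c)), E.proj_cyc hf h2 (s.measurableSet_fiber c)]

/-! ### The bounded functional calculus -/

theorem memLp_of_bound (μ : Measure Ω) [IsFiniteMeasure μ] {f : Ω → ℂ} (hf : Measurable f) {C : ℝ}
    (hC : ∀ x, ‖f x‖ ≤ C) : MemLp f 2 μ :=
  MemLp.of_bound hf.aestronglyMeasurable C (Eventually.of_forall hC)

theorem norm_cyc_le (E : PVM Ω H) {f : Ω → ℂ} (hf : Measurable f) {C : ℝ}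
    (hC : ∀ x, ‖f x‖ ≤ C) (hC0 : 0 ≤ C) (φ : H) : ‖E.cyc φ f‖ ≤ C * ‖φ‖ := by
  refine abs_le_of_sq_le_sq' ?_ (by positivity) |>.2
  rw [E.norm_cyc_sq (memLp_of_bound _ hf hC)]
  refine (integral_mono (memLp_of_bound _ hf hC).norm.integrable_sq
    (integrable_const (C ^ 2)) fun x => ?_).trans ?_
  · exact pow_le_pow_left₀ (norm_nonneg _) (hC x) 2
  · rw [integral_const, E.meas_real_apply φ MeasurableSet.univ, E.proj_univ]
    simp [mul_pow, mul_comm]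

/-- Linearity in `φ` is not automatic, because the space `L²(⟪φ, E φ⟫)` changes with `φ`. The simple
approximants of `f` do not depend on `φ`, and for them the expression is visibly linear. -/
theorem exists_forall_eq_cyc (E : PVM Ω H) {f : Ω → ℂ} (hf : Measurable f) {C : ℝ}
    (hC : ∀ x, ‖f x‖ ≤ C) : ∃ T : H →L[ℂ] H, ∀ φ, T φ = E.cyc φ f := by
  have hlim : ∀ φ, Tendsto (fun n => ∑ c ∈ (approx hf n).range, c • E.proj (approx hf n ⁻¹' {c}) φ)
      atTop (𝓝 (E.cyc φ f)) := fun φ =>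
    (E.tendsto_cyc_approx hf (memLp_of_bound _ hf hC)).congr fun n => E.cyc_simpleFunc φ _
  refine ⟨LinearMap.mkContinuous
    { toFun := fun φ => E.cyc φ f
      map_add' := fun φ ψ => ?_
      map_smul' := fun a φ => ?_ } C fun φ => ?_, fun φ => rfl⟩
  · refine tendsto_nhds_unique (hlim (φ + ψ)) (((hlim φ).add (hlim ψ)).congr fun n => ?_)
    simp [Finset.sum_add_distrib]
  · refine tendsto_nhds_unique (hlim (a • φ)) (((hlim φ).const_smul a).congr fun n => ?_)
    simp [Finset.smul_sum, smul_comm a]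
  · by_cases hC0 : 0 ≤ C
    · exact E.norm_cyc_le hf hC hC0 φ
    -- A negative bound on a norm forces `Ω` to be empty, and then `H` is trivial because `E(Ω) =
    -- 1`.
    · have : IsEmpty Ω := ⟨fun x => hC0 ((norm_nonneg _).trans (hC x))⟩
      have h0 : E.proj Set.univ φ = 0 := by
        rw [Set.eq_empty_of_isEmpty Set.univ, E.proj_empty]; rfl
      have h1 : φ = 0 := by simpa [E.proj_univ] using h0
      have h2 : f = Set.indicator ∅ fun _ => 0 := Subsingleton.elim _ _
      change ‖E.cyc φ f‖ ≤ _
      rw [h1, h2, E.cyc_indicator _ MeasurableSet.empty]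
      simp

/-! ### Matrix elements as measures with density -/

/-- The density of the complex measure `⟪ψ, E φ⟫` with respect to `⟪φ, E φ⟫`. -/
def density (E : PVM Ω H) (ψ φ : H) (x : Ω) : ℂ :=
  star (((E.cycL φ).adjoint ψ : Lp ℂ 2 (E.meas φ)) x)

theorem memLp_density (E : PVM Ω H) (ψ φ : H) : MemLp (E.density ψ φ) 2 (E.meas φ) :=
  (Lp.memLp ((E.cycL φ).adjoint ψ)).star

theorem integrable_density (E : PVM Ω H) (ψ φ : H) : Integrable (E.density ψ φ) (E.meas φ) :=
  (E.memLp_density ψ φ).integrable one_le_two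

theorem inner_cyc_eq_integral (E : PVM Ω H) (ψ : H) {φ : H} {f : Ω → ℂ}
    (hf : MemLp f 2 (E.meas φ)) :
    ⟪ψ, E.cyc φ f⟫_ℂ = ∫ x, f x * E.density ψ φ x ∂E.meas φ := by
  rw [E.cyc_eq hf, ← ContinuousLinearMap.adjoint_inner_left, L2.inner_def]
  refine integral_congr_ae ?_
  filter_upwards [hf.coeFn_toLp] with x h1
  rw [h1]
  rfl

theorem integrable_mul_density (E : PVM Ω H) (ψ : H) {φ : H} {f : Ω → ℂ}
    (hf : MemLp f 2 (E.meas φ)) : Integrable (fun x => f x * E.density ψ φ x) (E.meas φ) :=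
  hf.integrable_mul (E.memLp_density ψ φ)

/-- The adjoint of the cyclic isometry, applied to `ψ`, represents the functional `f ↦ ⟪ψ, ∫ f dE
φ⟫`. Thus integrals against complex matrix elements, and their total variations, become integrals
against one finite positive measure. -/
theorem matrixElement_eq_withDensity (E : PVM Ω H) (ψ φ : H) :
    E.matrixElement ψ φ = (E.meas φ).withDensityᵥ (E.density ψ φ) := by
  ext B hB
  rw [withDensityᵥ_apply (E.integrable_density ψ φ) hB, ← integral_indicator hB]
  have h := E.inner_cyc_eq_integral ψ (memLp_indicator (E.meas φ) hB 1)
  rw [E.cyc_indicator φ hB, one_smul] at h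
  refine h.trans (integral_congr_ae (Eventually.of_forall fun x => ?_))
  by_cases hx : x ∈ B <;> simp [hx]

theorem variation_matrixElement (E : PVM Ω H) (ψ φ : H) :
    (E.matrixElement ψ φ).variation = (E.meas φ).withDensity fun x => (‖E.density ψ φ x‖₊ : ENNReal) := by
  rw [matrixElement_eq_withDensity, Measure.variation_withDensityᵥ (E.integrable_density ψ φ)]
  rfl

theorem integrable_matrixElement_iff (E : PVM Ω H) {ψ φ : H} {f : Ω → ℂ} (hf : Measurable f) :
    (E.matrixElement ψ φ).Integrable f ↔
      Integrable (fun x => f x * E.density ψ φ x) (E.meas φ) := by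
  rw [VectorMeasure.Integrable, variation_matrixElement,
    integrable_withDensity_iff_integrable_coe_smul₀
      (E.memLp_density ψ φ).aestronglyMeasurable.aemeasurable.nnnorm]
  have hd := (E.memLp_density ψ φ).aestronglyMeasurable
  refine integrable_congr' (by fun_prop) (hf.aestronglyMeasurable.mul hd)
    (Eventually.of_forall fun x => ?_)
  simp [mul_comm]

theorem integral_eq_integral_density (E : PVM Ω H) {ψ φ : H} {f : Ω → ℂ} (hf : Measurable f)
    (hi : Integrable (fun x => f x * E.density ψ φ x) (E.meas φ)) :
    E.integral f ψ φ = ∫ x, f x * E.density ψ φ x ∂E.meas φ := by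
  have hfi : (E.matrixElement ψ φ).Integrable f := (E.integrable_matrixElement_iff hf).2 hi
  have h1 : Tendsto (fun n => E.integral (approx hf n) ψ φ) atTop (𝓝 (E.integral f ψ φ)) :=
    VectorMeasure.tendsto_integral_of_dominated_convergence (fun x => ‖f x‖ + ‖f x‖)
      (fun n => (approx hf n).aestronglyMeasurable) (hfi.norm.add hfi.norm)
      (fun n => Eventually.of_forall fun x => norm_approx_le hf n x)
      (Eventually.of_forall fun x => tendsto_approx hf x)
  have h2 : Tendsto (fun n => ∫ x, approx hf n x * E.density ψ φ x ∂E.meas φ) atTop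
      (𝓝 (∫ x, f x * E.density ψ φ x ∂E.meas φ)) := by
    refine tendsto_integral_of_dominated_convergence
      (fun x => ‖f x * E.density ψ φ x‖ + ‖f x * E.density ψ φ x‖)
      (fun n => (approx hf n).aestronglyMeasurable.mul (E.memLp_density ψ φ).aestronglyMeasurable)
      (hi.norm.add hi.norm) (fun n => Eventually.of_forall fun x => ?_)
      (Eventually.of_forall fun x => (tendsto_approx hf x).mul_const _)
    have := mul_le_mul_of_nonneg_right (norm_approx_le hf n x) (norm_nonneg (E.density ψ φ x))
    simpa [add_mul] using this
  refine tendsto_nhds_unique h1 (h2.congr fun n => ?_)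
  set s := approx hf n
  have hν : IsFiniteMeasure (E.matrixElement ψ φ).variation := by
    rw [variation_matrixElement]
    exact isFiniteMeasure_withDensity (E.integrable_density ψ φ).2.ne
  rw [← E.inner_cyc_eq_integral ψ (φ := φ) (f := s)
    ((s.memLp_of_isFiniteMeasure _ _)), E.cyc_simpleFunc, integral]
  conv_rhs => rw [simpleFunc_eq_sum_indicator s]
  have hfun : (∑ c ∈ s.range, (s ⁻¹' {c}).indicator fun _ => c) =
      fun x => ∑ c ∈ s.range, (s ⁻¹' {c}).indicator (fun _ => c) x := by
    ext x; simp [Finset.sum_apply]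
  rw [hfun, VectorMeasure.integral_finsetSum _ fun c _ =>
    (integrable_const c).indicator (s.measurableSet_fiber c), inner_sum]
  refine Finset.sum_congr rfl fun c _ => ?_
  have : IsFiniteMeasure ((E.matrixElement ψ φ).restrict (s ⁻¹' {c})).variation := by
    rw [VectorMeasure.variation_restrict (s.measurableSet_fiber c)]
    infer_instance
  rw [VectorMeasure.integral_indicator (s.measurableSet_fiber c), VectorMeasure.integral_const,
    VectorMeasure.restrict_apply _ (s.measurableSet_fiber c) MeasurableSet.univ, Set.univ_inter,
    inner_smul_right]
  rfl

theorem integral_eq_inner_cyc (E : PVM Ω H) {ψ φ : H} {f : Ω → ℂ} (hf : Measurable f)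
    (h2 : MemLp f 2 (E.meas φ)) : E.integral f ψ φ = ⟪ψ, E.cyc φ f⟫_ℂ := by
  rw [E.integral_eq_integral_density hf (E.integrable_mul_density ψ h2), E.inner_cyc_eq_integral ψ h2]

/-! ### The operator `∫ f dE` -/

/-- An operator with the prescribed matrix elements exists, so the choice made in `calculus`
satisfies its specification, and matrix elements determine the vector. -/
theorem calculus_apply (E : PVM Ω H) {f : Ω → ℂ} (hf : Measurable f) {C : ℝ}
    (hC : ∀ x, ‖f x‖ ≤ C) (φ : H) : E.calculus f φ = E.cyc φ f := by
  have hex : ∃ T : H →L[ℂ] H, ∀ φ ψ : H, ⟪φ, T ψ⟫_ℂ = E.integral f φ ψ := by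
    obtain ⟨T, hT⟩ := E.exists_forall_eq_cyc hf hC
    exact ⟨T, fun φ ψ => by rw [hT, E.integral_eq_inner_cyc hf (memLp_of_bound _ hf hC)]⟩
  have h := Classical.epsilon_spec hex
  refine ext_inner_left ℂ fun ψ => ?_
  rw [calculus, h, E.integral_eq_inner_cyc hf (memLp_of_bound _ hf hC)]

theorem calculus_mul (E : PVM Ω H) {f g : Ω → ℂ} (hf : Measurable f) {C : ℝ}
    (hC : ∀ x, ‖f x‖ ≤ C) (hg : Measurable g) {D : ℝ} (hD : ∀ x, ‖g x‖ ≤ D) :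
    E.calculus (fun x => f x * g x) = E.calculus f * E.calculus g := by
  have hfg : ∀ x, ‖f x * g x‖ ≤ C * D := fun x => by
    rw [norm_mul]
    exact mul_le_mul (hC x) (hD x) (norm_nonneg _) ((norm_nonneg _).trans (hC x))
  ext φ
  rw [E.calculus_apply (f := fun x => f x * g x) (hf.mul hg) hfg, mul_apply_eq_comp, E.calculus_apply hg hD,
    E.calculus_apply hf hC, E.cyc_cyc hg (memLp_of_bound _ hg hD) hf
      (memLp_of_bound (f := fun x => f x * g x) _ (hf.mul hg) hfg)]

theorem calculus_one (E : PVM Ω H) : E.calculus (fun _ => 1) = 1 := by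
  ext φ
  rw [E.calculus_apply measurable_const (C := 1) (by simp), E.cyc_one]
  rfl

/-- On a complex space an operator is determined by its quadratic form, so only diagonal matrix
elements have to be compared. -/
theorem calculus_star (E : PVM Ω H) {f : Ω → ℂ} (hf : Measurable f) {C : ℝ}
    (hC : ∀ x, ‖f x‖ ≤ C) : E.calculus (fun x => star (f x)) = star (E.calculus f) := by
  have hs : Measurable fun x => star (f x) := continuous_star.measurable.comp hf
  have hsC : ∀ x, ‖star (f x)‖ ≤ C := fun x => by rw [norm_star]; exact hC x
  apply ContinuousLinearMap.coe_injective
  rw [← ext_inner_map]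
  intro φ
  rw [ContinuousLinearMap.star_eq_adjoint, ContinuousLinearMap.coe_coe, ContinuousLinearMap.coe_coe,
    ContinuousLinearMap.adjoint_inner_left, E.calculus_apply hs hsC, E.calculus_apply hf hC]
  have h1 := E.inner_cyc (φ := φ) (memLp_of_bound _ hs hsC) (memLp_const 1)
  have h2 := E.inner_cyc (φ := φ) (memLp_const 1) (memLp_of_bound _ hf hC)
  rw [E.cyc_one] at h1 h2
  rw [h1, h2]
  simp

theorem calculus_indicator (E : PVM Ω H) {B : Set Ω} (hB : MeasurableSet B) :
    E.calculus (B.indicator fun _ => 1) = E.proj B := by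
  ext φ
  rw [E.calculus_apply (measurable_const.indicator hB) (C := 1), E.cyc_indicator φ hB, one_smul]
  intro x
  by_cases hx : x ∈ B <;> simp [hx]

theorem tendsto_calculus (E : PVM Ω H) {F : ℕ → Ω → ℂ} {f : Ω → ℂ} (hF : ∀ n, Measurable (F n))
    (hf : Measurable f) {C : ℝ} (hC : ∀ n x, ‖F n x‖ ≤ C)
    (hlim : ∀ x, Tendsto (fun n => F n x) atTop (𝓝 (f x))) (φ : H) :
    Tendsto (fun n => E.calculus (F n) φ) atTop (𝓝 (E.calculus f φ)) := by
  have hfC : ∀ x, ‖f x‖ ≤ C := fun x =>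
    le_of_tendsto (hlim x).norm (Eventually.of_forall fun n => hC n x)
  rw [E.calculus_apply hf hfC]
  simp_rw [fun n => E.calculus_apply (hF n) (hC n) φ]
  exact E.tendsto_cyc (fun n => (hF n).aestronglyMeasurable) (memLp_const C)
    (fun n => Eventually.of_forall (hC n)) (Eventually.of_forall hlim)

end PVM

namespace PVM

/-- Indicators span a dense subspace of `L²`. The measure `ν` is a variable with an equation because
`L²` spaces of two equal measures are not definitionally the same type. -/
theorem cycL_unique {Ω : Type*} [MeasurableSpace Ω] {H : Type*} [NormedAddCommGroup H]
    [InnerProductSpace ℂ H] [CompleteSpace H] (E : PVM Ω H) (φ : H) (ν : Measure Ω)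
    [IsFiniteMeasure ν] (hν : ν = E.meas φ) (V : Lp ℂ 2 ν →L[ℂ] H)
    (hV : ∀ B (hB : MeasurableSet B),
      V (indicatorConstLp 2 hB (measure_ne_top ν B) 1) = E.proj B φ)
    {f : Ω → ℂ} (hf : MemLp f 2 ν) : V hf.toLp = E.cyc φ f := by
  subst hν
  rw [E.cyc_eq hf]
  suffices h : V = E.cycL φ by rw [h]
  refine ContinuousLinearMap.coeFn_injective
    ((denseRange_formalLp _).equalizer V.continuous (E.cycL φ).continuous ?_)
  ext c
  rw [Function.comp_apply, Function.comp_apply, cycL_formalLp]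
  simp only [formalLp, formalVec, Finsupp.linearCombination_apply, Finsupp.sum, map_sum, map_smul,
    hV]

end PVM

/-! ### The spectral measure of a representation of `C(Δ)` -/

section Representation

variable {Δ : Type*} [TopologicalSpace Δ] [CompactSpace Δ] [T2Space Δ] [MeasurableSpace Δ]
  [BorelSpace Δ] {G : Type*} [NormedAddCommGroup G] [InnerProductSpace ℂ G] [CompleteSpace G]
  (π : C(Δ, ℂ) →⋆ₐ[ℂ] (G →L[ℂ] G))

/-- A real continuous function as a complex one. -/
def ofRealMap (g : C(Δ, ℝ)) : C(Δ, ℂ) := ⟨fun x => (g x : ℂ), by fun_prop⟩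

theorem inner_rep_left (g : C(Δ, ℂ)) (φ ψ : G) : ⟪π g φ, ψ⟫_ℂ = ⟪φ, π (star g) ψ⟫_ℂ := by
  rw [map_star, ContinuousLinearMap.star_eq_adjoint, ContinuousLinearMap.adjoint_inner_right]

theorem star_ofRealMap (g : C(Δ, ℝ)) : star (ofRealMap g) = ofRealMap g := by
  ext x; simp [ofRealMap]

theorem im_inner_ofRealMap (g : C(Δ, ℝ)) (φ : G) : (⟪φ, π (ofRealMap g) φ⟫_ℂ).im = 0 := by
  have h := inner_rep_left π (ofRealMap g) φ φ
  rw [star_ofRealMap, ← inner_conj_symm] at h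
  exact Complex.conj_eq_iff_im.1 h

/-- The state `g ↦ ⟪φ, π(g) φ⟫`, as a positive functional. -/
def stateFunctional (φ : G) : PositiveLinearMap ℝ (CompactlySupportedContinuousMap Δ ℝ) ℝ :=
  PositiveLinearMap.mk₀
    { toFun := fun g => (⟪φ, π (ofRealMap (g : C(Δ, ℝ))) φ⟫_ℂ).re
      map_add' := fun f g => by
        have : ofRealMap ((f + g : CompactlySupportedContinuousMap Δ ℝ) : C(Δ, ℝ)) =
            ofRealMap (f : C(Δ, ℝ)) + ofRealMap (g : C(Δ, ℝ)) := by
          ext x; simp [ofRealMap]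
        rw [this, map_add, add_apply, inner_add_right, Complex.add_re]
      map_smul' := fun c f => by
        have : ofRealMap ((c • f : CompactlySupportedContinuousMap Δ ℝ) : C(Δ, ℝ)) =
            (c : ℂ) • ofRealMap (f : C(Δ, ℝ)) := by
          ext x; simp [ofRealMap]
        rw [this, map_smul, smul_apply, inner_smul_right]
        simp }
    (fun g hg => by
      -- Positivity comes from `g = h²` with `h = √g`, which gives `⟪φ, π(g) φ⟫ = ‖π(h) φ‖²`.
      let h : C(Δ, ℝ) := ⟨fun x => √(g x), by fun_prop⟩
      have hg' : ofRealMap (g : C(Δ, ℝ)) = star (ofRealMap h) * ofRealMap h := by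
        rw [star_ofRealMap]
        ext x
        have hx : 0 ≤ g x := hg x
        simp only [ofRealMap, ContinuousMap.coe_mk, ContinuousMap.mul_apply, h]
        rw [← Complex.ofReal_mul, Real.mul_self_sqrt hx]
      simp only [LinearMap.coe_mk, AddHom.coe_mk]
      rw [hg', map_mul, mul_apply_eq_comp, ← inner_rep_left]
      exact inner_self_nonneg (𝕜 := ℂ) (x := π (ofRealMap h) φ))

/-- The measure representing the state `g ↦ ⟪φ, π(g) φ⟫`. -/
def stateMeasure (φ : G) : Measure Δ := RealRMK.rieszMeasure (stateFunctional π φ)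

instance regular_stateMeasure (φ : G) : (stateMeasure π φ).Regular :=
  RealRMK.regular_rieszMeasure _

theorem integral_stateMeasure_real (g : C(Δ, ℝ)) (φ : G) :
    ((∫ x, g x ∂stateMeasure π φ : ℝ) : ℂ) = ⟪φ, π (ofRealMap g) φ⟫_ℂ := by
  have h := RealRMK.integral_rieszMeasure (stateFunctional π φ)
    ⟨g, HasCompactSupport.of_compactSpace _⟩
  refine Complex.ext ?_ ?_
  · exact h
  · rw [im_inner_ofRealMap, Complex.ofReal_im]

theorem integral_stateMeasure (g : C(Δ, ℂ)) (φ : G) :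
    ∫ x, g x ∂stateMeasure π φ = ⟪φ, π g φ⟫_ℂ := by
  let gr : C(Δ, ℝ) := ⟨fun x => (g x).re, by fun_prop⟩
  let gi : C(Δ, ℝ) := ⟨fun x => (g x).im, by fun_prop⟩
  have hg : g = ofRealMap gr + Complex.I • ofRealMap gi := by
    ext x
    simp only [ofRealMap, gr, gi, ContinuousMap.add_apply, ContinuousMap.smul_apply,
      ContinuousMap.coe_mk, smul_eq_mul, mul_comm Complex.I, Complex.re_add_im]
  have hi : Integrable g (stateMeasure π φ) :=
    g.continuous.integrable_of_hasCompactSupport (HasCompactSupport.of_compactSpace _)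
  conv_rhs => rw [hg]
  rw [map_add, map_smul, add_apply, smul_apply, inner_add_right, inner_smul_right,
    ← integral_stateMeasure_real, ← integral_stateMeasure_real,
    ← integral_re_add_im hi]
  simp [gr, gi, mul_comm]

theorem norm_rep_sq (g : C(Δ, ℂ)) (φ : G) :
    ‖π g φ‖ ^ 2 = ∫ x, ‖g x‖ ^ 2 ∂stateMeasure π φ := by
  have h := integral_stateMeasure π (star g * g) φ
  rw [map_mul, mul_apply_eq_comp, ← inner_rep_left, inner_self_eq_norm_sq_to_K] at h
  have h2 : ∀ x, (star g * g) x = ((‖g x‖ ^ 2 : ℝ) : ℂ) := fun x => by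
    simp [Complex.conj_mul']
  simp only [h2, integral_complex_ofReal] at h
  exact (Complex.ofReal_injective (by simpa using h)).symm

theorem norm_toLp_stateMeasure (g : C(Δ, ℂ)) (φ : G) :
    ‖π g φ‖ = ‖ContinuousMap.toLp 2 (stateMeasure π φ) ℂ g‖ := by
  have h : ‖ContinuousMap.toLp 2 (stateMeasure π φ) ℂ g‖ ^ 2 =
      ∫ x, ‖g x‖ ^ 2 ∂stateMeasure π φ := by
    have h1 := L2.inner_def (𝕜 := ℂ) (ContinuousMap.toLp 2 (stateMeasure π φ) ℂ g)
      (ContinuousMap.toLp 2 (stateMeasure π φ) ℂ g)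
    rw [inner_self_eq_norm_sq_to_K] at h1
    have h2 : ∫ x, ⟪ContinuousMap.toLp 2 (stateMeasure π φ) ℂ g x,
        ContinuousMap.toLp 2 (stateMeasure π φ) ℂ g x⟫_ℂ ∂stateMeasure π φ =
        ∫ x, ((‖g x‖ ^ 2 : ℝ) : ℂ) ∂stateMeasure π φ := by
      refine integral_congr_ae ?_
      filter_upwards [ContinuousMap.coeFn_toLp (p := 2) (𝕜 := ℂ) (stateMeasure π φ) g] with x hx
      rw [hx, inner_self_eq_norm_sq_to_K]
      simp
    rw [h2, integral_complex_ofReal] at h1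
    exact Complex.ofReal_injective (by simpa using h1)
  rw [← norm_rep_sq] at h
  exact ((sq_eq_sq₀ (norm_nonneg _) (norm_nonneg _)).1 h).symm

/-- The isometry `L²(⟪φ, π φ⟫) → G` extending `g ↦ π(g) φ`. -/
def repL (φ : G) : Lp ℂ 2 (stateMeasure π φ) →L[ℂ] G :=
  ((LinearMap.applyₗ φ : (G →ₗ[ℂ] G) →ₗ[ℂ] G) ∘ₗ ContinuousLinearMap.coeLM ℂ ∘ₗ
    π.toAlgHom.toLinearMap).extendOfNorm (ContinuousMap.toLp 2 (stateMeasure π φ) ℂ).toLinearMap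

theorem denseRange_toLp_stateMeasure (φ : G) :
    DenseRange (ContinuousMap.toLp 2 (stateMeasure π φ) ℂ : C(Δ, ℂ) →L[ℂ] _) :=
  ContinuousMap.toLp_denseRange ℂ _ ℂ (by simp)

theorem repL_toLp (g : C(Δ, ℂ)) (φ : G) :
    repL π φ (ContinuousMap.toLp 2 (stateMeasure π φ) ℂ g) = π g φ :=
  LinearMap.extendOfNorm_eq (denseRange_toLp_stateMeasure π φ)
    ⟨1, fun g => by rw [one_mul]; exact (norm_toLp_stateMeasure π g φ).le⟩ g

theorem norm_repL (φ : G) (f : Lp ℂ 2 (stateMeasure π φ)) : ‖repL π φ f‖ = ‖f‖ := by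
  induction f using (denseRange_toLp_stateMeasure π φ).induction_on with
  | hp => exact isClosed_eq (by fun_prop) (by fun_prop)
  | ih g => rw [repL_toLp, norm_toLp_stateMeasure]

/-- One sequence of continuous functions serves finitely many vectors at once: approximate in `L²`
of the sum of their state measures, which dominates each of them. Linearity of the spectral
projections is inherited from `π(g n)` in this way. -/
theorem exists_approx_indicator {κ : Type*} [Fintype κ] (φ : κ → G) {B : Set Δ}
    (hB : MeasurableSet B) : ∃ g : ℕ → C(Δ, ℂ), ∀ i, Tendsto (fun n => π (g n) (φ i)) atTop
      (𝓝 (repL π (φ i) (indicatorConstLp 2 hB (measure_ne_top _ _) 1))) := by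
  set m : Measure Δ := ∑ i, stateMeasure π (φ i)
  obtain ⟨u, hu, hlim⟩ := mem_closure_iff_seq_limit.1
    ((ContinuousMap.toLp_denseRange ℂ m ℂ (p := 2) (by simp))
      (indicatorConstLp 2 hB (measure_ne_top m B) 1))
  choose g hg using hu
  refine ⟨g, fun i => ?_⟩
  simp_rw [← repL_toLp]
  refine ((repL π (φ i)).continuous.tendsto _).comp ?_
  rw [tendsto_iff_edist_tendsto_0] at hlim ⊢
  refine tendsto_of_tendsto_of_tendsto_of_le_of_le tendsto_const_nhds hlim (fun _ => zero_le)
    fun n => ?_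
  dsimp only
  rw [← hg, Lp.edist_def, Lp.edist_def]
  have hle : stateMeasure π (φ i) ≤ m := by
    classical
    simp only [m, ← Finset.add_sum_erase _ _ (Finset.mem_univ i)]
    exact Measure.le_add_right le_rfl
  refine le_trans (le_of_eq ?_) (eLpNorm_mono_measure _ hle)
  refine eLpNorm_congr_ae ?_
  have h1 := ContinuousMap.coeFn_toLp (p := 2) (𝕜 := ℂ) (stateMeasure π (φ i)) (g n)
  have h2 := hle.absolutelyContinuous.ae_le
    (ContinuousMap.coeFn_toLp (p := 2) (𝕜 := ℂ) m (g n))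
  have h3 := indicatorConstLp_coeFn (p := 2) (hs := hB)
    (hμs := measure_ne_top (stateMeasure π (φ i)) B) (c := (1 : ℂ))
  have h4 := hle.absolutelyContinuous.ae_le (indicatorConstLp_coeFn (p := 2) (hs := hB)
    (hμs := measure_ne_top m B) (c := (1 : ℂ)))
  filter_upwards [h1, h2, h3, h4] with x h1 h2 h3 h4
  simp only [Pi.sub_apply, h1, h2, h3, h4]

theorem repL_indicator_univ (φ : G) :
    repL π φ (indicatorConstLp 2 MeasurableSet.univ (measure_ne_top _ _) 1) = φ := by
  have h1 : ContinuousMap.toLp 2 (stateMeasure π φ) ℂ (1 : C(Δ, ℂ)) =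
      indicatorConstLp 2 MeasurableSet.univ (measure_ne_top _ _) 1 := by
    ext1
    filter_upwards [ContinuousMap.coeFn_toLp (p := 2) (𝕜 := ℂ) (stateMeasure π φ) (1 : C(Δ, ℂ)),
      indicatorConstLp_coeFn (p := 2) (hs := MeasurableSet.univ)
        (hμs := measure_ne_top (stateMeasure π φ) Set.univ) (c := (1 : ℂ))] with x h1 h2
    rw [h1, h2]
    simp
  rw [← h1, repL_toLp, map_one]
  rfl

theorem inner_repL_indicator (φ : G) {B : Set Δ} (hB : MeasurableSet B) :
    ⟪φ, repL π φ (indicatorConstLp 2 hB (measure_ne_top _ _) 1)⟫_ℂ =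
      (((stateMeasure π φ).real B : ℝ) : ℂ) := by
  have h3 : ∀ f g, ⟪repL π φ f, repL π φ g⟫_ℂ = ⟪f, g⟫_ℂ :=
    (⟨(repL π φ).toLinearMap, norm_repL π φ⟩ : Lp ℂ 2 (stateMeasure π φ) →ₗᵢ[ℂ] G).inner_map_map
  conv_lhs => arg 2; rw [← repL_indicator_univ π φ]
  rw [h3, L2.inner_indicatorConstLp_indicatorConstLp]
  simp

theorem norm_sq_repL_indicator (φ : G) {B : Set Δ} (hB : MeasurableSet B) :
    ‖repL π φ (indicatorConstLp 2 hB (measure_ne_top _ _) 1)‖ ^ 2 = (stateMeasure π φ).real B := by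
  rw [norm_repL, norm_indicatorConstLp (by simp) (by simp)]
  simp only [norm_one, one_mul, ENNReal.toReal_ofNat]
  rw [← Real.rpow_natCast, ← Real.rpow_mul measureReal_nonneg]
  norm_num

theorem measureReal_stateMeasure_univ (φ : G) : (stateMeasure π φ).real Set.univ = ‖φ‖ ^ 2 := by
  have h := norm_rep_sq π 1 φ
  simpa [map_one] using h.symm

open Classical in
/-- The spectral projections of a representation of `C(Δ)`. -/
def repProj (B : Set Δ) : G →L[ℂ] G :=
  if hB : MeasurableSet B then
    LinearMap.mkContinuous
      { toFun := fun φ => repL π φ (indicatorConstLp 2 hB (measure_ne_top _ _) 1)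
        map_add' := fun φ ψ => by
          obtain ⟨g, hg⟩ := exists_approx_indicator π ![φ, ψ, φ + ψ] hB
          refine tendsto_nhds_unique (hg 2) (((hg 0).add (hg 1)).congr fun n => ?_)
          exact (map_add (π (g n)) φ ψ).symm
        map_smul' := fun c φ => by
          obtain ⟨g, hg⟩ := exists_approx_indicator π ![φ, c • φ] hB
          refine tendsto_nhds_unique (hg 1) (((hg 0).const_smul c).congr fun n => ?_)
          exact (map_smul (π (g n)) c φ).symm } 1
      (fun φ => by
        rw [one_mul]
        refine (sq_le_sq₀ (norm_nonneg _) (norm_nonneg _)).1 ?_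
        simp only [LinearMap.coe_mk, AddHom.coe_mk]
        rw [norm_sq_repL_indicator, ← measureReal_stateMeasure_univ π]
        exact measureReal_mono (Set.subset_univ _))
  else 0

theorem repProj_apply {B : Set Δ} (hB : MeasurableSet B) (φ : G) :
    repProj π B φ = repL π φ (indicatorConstLp 2 hB (measure_ne_top _ _) 1) := by
  rw [repProj, dif_pos hB]; rfl

/-- The form `⟪φ, P φ⟫` is the measure of `B`, hence real, so `P` is symmetric. Since `‖P φ‖²` is
the same number, the forms of `P²` and `P` coincide. -/
theorem isStarProjection_repProj {B : Set Δ} (hB : MeasurableSet B) :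
    IsStarProjection (repProj π B) := by
  have hsymm : (repProj π B : G →ₗ[ℂ] G).IsSymmetric := by
    rw [LinearMap.isSymmetric_iff_inner_map_self_real]
    intro φ
    rw [inner_conj_symm, ContinuousLinearMap.coe_coe, repProj_apply π hB, inner_repL_indicator,
      ← inner_conj_symm, inner_repL_indicator, Complex.conj_ofReal]
  refine ⟨?_, ContinuousLinearMap.isSelfAdjoint_iff_isSymmetric.2 hsymm⟩
  apply ContinuousLinearMap.coe_injective
  rw [← ext_inner_map]
  intro φ
  have h1 := hsymm (repProj π B φ) φ
  simp only [ContinuousLinearMap.coe_coe] at h1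
  change ⟪repProj π B (repProj π B φ), φ⟫_ℂ = ⟪repProj π B φ, φ⟫_ℂ
  have h2 : ⟪repProj π B φ, φ⟫_ℂ = ⟪φ, repProj π B φ⟫_ℂ := hsymm φ φ
  rw [h1, h2, repProj_apply π hB, inner_repL_indicator, ← norm_sq_repL_indicator π φ hB,
    inner_self_eq_norm_sq_to_K]
  simp

theorem repProj_union {B C : Set Δ} (hB : MeasurableSet B) (hC : MeasurableSet C)
    (h : Disjoint B C) : repProj π (B ∪ C) = repProj π B + repProj π C := by
  ext φ
  rw [add_apply, repProj_apply π hB, repProj_apply π hC, repProj_apply π (hB.union hC), ← map_add]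
  congr 1
  exact indicatorConstLp_disjoint_union hB hC (measure_ne_top _ _) (measure_ne_top _ _) h 1

theorem repProj_empty : repProj π (∅ : Set Δ) = 0 := by
  have h := repProj_union π MeasurableSet.empty MeasurableSet.empty (Set.disjoint_empty ∅)
  simpa using h

theorem norm_sq_repProj {B : Set Δ} (hB : MeasurableSet B) (φ : G) :
    ‖repProj π B φ‖ ^ 2 = (stateMeasure π φ).real B := by
  rw [repProj_apply π hB, norm_sq_repL_indicator]

theorem repProj_biUnion {B : ℕ → Set Δ} (hB : ∀ n, MeasurableSet (B n))
    (hd : Pairwise (Function.onFun Disjoint B)) (F : Finset ℕ) :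
    repProj π (⋃ n ∈ F, B n) = ∑ n ∈ F, repProj π (B n) := by
  classical
  induction F using Finset.induction_on with
  | empty => simp [repProj_empty]
  | insert n F hn ih =>
    rw [Finset.set_biUnion_insert, Finset.sum_insert hn, repProj_union π (hB n)
      (F.measurableSet_biUnion fun k _ => hB k), ih]
    rw [Set.disjoint_iUnion₂_right]
    exact fun k hk => hd (by rintro rfl; exact hn hk)

/-- The spectral measure of a representation of `C(Δ)`. -/
def repPVM : PVM Δ G where
  proj := repProj π
  isStarProjection := fun B hB => isStarProjection_repProj π hB
  proj_univ := by
    ext φ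
    rw [repProj_apply π MeasurableSet.univ, repL_indicator_univ]
    rfl
  not_measurable := fun B hB => dif_neg hB
  hasSum := fun B hB hd φ => by
    have hU := MeasurableSet.iUnion hB
    rw [HasSum, tendsto_iff_norm_sub_tendsto_zero]
    -- The squared norm of the remainder of a partial sum is the state measure of the uncovered set,
    -- so strong additivity reduces to additivity of a scalar measure.
    have h1 : Tendsto (fun F : Finset ℕ => (stateMeasure π φ).real (⋃ n, B n) -
        ∑ n ∈ F, (stateMeasure π φ).real (B n)) atTop (𝓝 0) := by
      have h2 : HasSum (fun n => (stateMeasure π φ).real (B n)) ((stateMeasure π φ).real (⋃ n, B n)) := by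
        have h4 := measure_iUnion (μ := stateMeasure π φ) hd hB
        rw [measureReal_def, h4, ENNReal.tsum_toReal_eq fun n => measure_ne_top _ _]
        exact (ENNReal.summable_toReal (h4 ▸ measure_ne_top _ _)).hasSum
      simpa using h2.const_sub ((stateMeasure π φ).real (⋃ n, B n))
    have h3 := h1.sqrt
    rw [Real.sqrt_zero] at h3
    refine h3.congr fun F => ?_
    have hF : MeasurableSet (⋃ n ∈ F, B n) := F.measurableSet_biUnion fun k _ => hB k
    have hsub : (⋃ n ∈ F, B n) ⊆ ⋃ n, B n := Set.iUnion₂_subset_iUnion _ _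
    have hsplit : repProj π (⋃ n, B n) = ∑ n ∈ F, repProj π (B n) +
        repProj π ((⋃ n, B n) \ ⋃ n ∈ F, B n) := by
      rw [← repProj_biUnion π hB hd, ← repProj_union π hF (hU.diff hF) Set.disjoint_sdiff_right,
        Set.union_sdiff_cancel hsub]
    rw [hsplit, add_apply, sum_apply, sub_add_cancel_left, norm_neg, ← Real.sqrt_sq (norm_nonneg _),
      norm_sq_repProj π (hU.diff hF), measureReal_sdiff hsub hF,
      measureReal_biUnion_finset (fun i _ j _ hij => hd hij) fun n _ => hB n]

theorem meas_repPVM (φ : G) : (repPVM π).meas φ = stateMeasure π φ := by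
  ext B hB
  rw [PVM.meas_apply _ _ hB]
  change ENNReal.ofReal (‖repProj π B φ‖ ^ 2) = _
  rw [norm_sq_repProj π hB, ofReal_measureReal]

/-- Integrating a continuous function against the spectral measure gives back the representation,
since both are the value of the same `L²` extension. -/
theorem cyc_repPVM (g : C(Δ, ℂ)) (φ : G) : (repPVM π).cyc φ g = π g φ := by
  have hg : MemLp g 2 (stateMeasure π φ) :=
    MemLp.of_bound g.continuous.aestronglyMeasurable ‖g‖ (Eventually.of_forall g.norm_coe_le_norm)
  rw [← PVM.cycL_unique (repPVM π) φ (stateMeasure π φ) (meas_repPVM π φ).symm (repL π φ)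
    (fun B hB => (repProj_apply π hB φ).symm) hg, ← repL_toLp]
  rfl

end Representation

/-! ### Images of projection-valued measures -/

namespace PVM

variable {Ω Ω' : Type*} [MeasurableSpace Ω] [MeasurableSpace Ω'] {H : Type*} [NormedAddCommGroup H]
  [InnerProductSpace ℂ H] [CompleteSpace H]

open Classical in
/-- The image of a projection-valued measure under a measurable map. -/
def map (E : PVM Ω H) {κ : Ω → Ω'} (hκ : Measurable κ) : PVM Ω' H where
  proj B := if MeasurableSet B then E.proj (κ ⁻¹' B) else 0
  isStarProjection := fun B hB => by
    rw [if_pos hB]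
    exact E.isStarProjection _ (hκ hB)
  proj_univ := by simp [E.proj_univ]
  not_measurable := fun B hB => by simp [hB]
  hasSum := fun B hB hd ψ => by
    simp only [hB, MeasurableSet.iUnion hB, if_true, Set.preimage_iUnion]
    exact E.hasSum _ (fun n => hκ (hB n)) (fun i j hij => (hd hij).preimage κ) ψ

theorem map_proj (E : PVM Ω H) {κ : Ω → Ω'} (hκ : Measurable κ) {B : Set Ω'}
    (hB : MeasurableSet B) : (E.map hκ).proj B = E.proj (κ ⁻¹' B) := if_pos hB

theorem meas_map (E : PVM Ω H) {κ : Ω → Ω'} (hκ : Measurable κ) (φ : H) :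
    (E.map hκ).meas φ = (E.meas φ).map κ := by
  ext B hB
  rw [Measure.map_apply hκ hB, meas_apply _ _ hB, meas_apply _ _ (hκ hB), map_proj _ _ hB]

theorem memLp_map_iff (E : PVM Ω H) {κ : Ω → Ω'} (hκ : Measurable κ) {φ : H} {f : Ω' → ℂ}
    (hf : Measurable f) :
    MemLp f 2 ((E.map hκ).meas φ) ↔ MemLp (fun x => f (κ x)) 2 (E.meas φ) := by
  rw [meas_map, memLp_map_measure_iff hf.aestronglyMeasurable hκ.aemeasurable]
  rfl

theorem cyc_map (E : PVM Ω H) {κ : Ω → Ω'} (hκ : Measurable κ) {φ : H} {f : Ω' → ℂ}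
    (hf : Measurable f) (h2 : MemLp (fun x => f (κ x)) 2 (E.meas φ)) :
    (E.map hκ).cyc φ f = E.cyc φ fun x => f (κ x) := by
  have h1 := (E.map hκ).tendsto_cyc_approx hf ((E.memLp_map_iff hκ hf).2 h2)
  have h3 : Tendsto (fun n => E.cyc φ fun x => approx hf n (κ x)) atTop
      (𝓝 (E.cyc φ fun x => f (κ x))) :=
    E.tendsto_cyc (fun n => ((approx hf n).measurable.comp hκ).aestronglyMeasurable)
      (h2.norm.add h2.norm) (fun n => Eventually.of_forall fun x => norm_approx_le hf n (κ x))
      (Eventually.of_forall fun x => tendsto_approx hf (κ x))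
  refine tendsto_nhds_unique h1 (h3.congr fun n => ?_)
  set s := approx hf n
  have hi : (fun x => s (κ x)) = ∑ c ∈ s.range, (κ ⁻¹' (s ⁻¹' {c})).indicator fun _ => c := by
    ext x
    conv_lhs => rw [simpleFunc_eq_sum_indicator s]
    simp [Finset.sum_apply, Set.indicator]
  rw [cyc_simpleFunc, hi, cyc_finsetSum _ _ fun c _ =>
    memLp_indicator _ (hκ (s.measurableSet_fiber c)) c]
  refine Finset.sum_congr rfl fun c _ => ?_
  rw [E.cyc_indicator φ (hκ (s.measurableSet_fiber c)), map_proj _ _ (s.measurableSet_fiber c)]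

theorem calculus_map (E : PVM Ω H) {κ : Ω → Ω'} (hκ : Measurable κ) {f : Ω' → ℂ}
    (hf : Measurable f) {C : ℝ} (hC : ∀ x, ‖f x‖ ≤ C) :
    (E.map hκ).calculus f = E.calculus fun x => f (κ x) := by
  ext φ
  rw [calculus_apply _ hf hC, calculus_apply _ (f := fun x => f (κ x)) (hf.comp hκ) fun x => hC _,
    E.cyc_map hκ hf (memLp_of_bound (f := fun x => f (κ x)) _ (hf.comp hκ) fun x => hC _)]

end PVM

/-! ### The joint spectral measure of a family of commuting resolvents -/

/-- The function `s ↦ (s_j - i)⁻¹`. -/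
def resolventFun {ι : Type*} (j : ι) (s : ι → ℝ) : ℂ := ((s j : ℂ) - Complex.I)⁻¹

theorem measurable_resolventFun {ι : Type*} (j : ι) : Measurable (resolventFun j) := by
  unfold resolventFun
  fun_prop

theorem ofReal_sub_I_ne_zero (t : ℝ) : (t : ℂ) - Complex.I ≠ 0 := fun h => by
  have := congrArg Complex.im h
  simp at this

theorem norm_resolventFun_le {ι : Type*} (j : ι) (s : ι → ℝ) : ‖resolventFun j s‖ ≤ 1 := by
  rw [resolventFun, norm_inv]
  refine inv_le_one_of_one_le₀ ?_
  have h := Complex.abs_im_le_norm ((s j : ℂ) - Complex.I)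
  simpa using h

/-- Dividing the relation by `|w|²` shows that `w⁻¹` has imaginary part `-1`. The relation therefore
characterises the nonzero values `(t - i)⁻¹` with `t` real. -/
theorem eq_inv_sub_I {w : ℂ} (hw : w ≠ 0)
    (h : w - star w = (2 * Complex.I) * (star w * w)) : ((((w⁻¹ + Complex.I).re : ℝ) : ℂ) - Complex.I)⁻¹ = w := by
  have hw' : star w ≠ 0 := star_ne_zero.2 hw
  have h1 : (star w)⁻¹ - w⁻¹ = 2 * Complex.I := by
    field_simp
    linear_combination h
  have h2 : ((w⁻¹ + Complex.I).im) = 0 := by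
    have h3 := congrArg Complex.im h1
    rw [← star_inv₀, Complex.sub_im, Complex.star_def, Complex.conj_im] at h3
    simp only [Complex.mul_im, Complex.re_ofNat, Complex.I_im, Complex.im_ofNat, Complex.I_re] at h3
    rw [Complex.add_im, Complex.I_im]
    linarith
  have h4 : (((w⁻¹ + Complex.I).re : ℝ) : ℂ) = w⁻¹ + Complex.I :=
    Complex.ext rfl (by rw [h2]; simp)
  rw [h4, add_sub_cancel_right, inv_inv]

/-- The `a i` generate a commutative C*-algebra, on whose Gelfand spectrum they become continuous
functions `w i`. The relation `hres` says that each nonzero value of `w i` is `(t - i)⁻¹` with `t`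
real, and `hinj` makes the zeros of `w i` null. The map sending a character to the tuple of these
`t` carries the spectral measure to `ℝ^ι`. -/
theorem exists_pvm_of_resolvents {ι : Type*} [Countable ι] {G : Type*} [NormedAddCommGroup G]
    [InnerProductSpace ℂ G]
    [CompleteSpace G] (a : ι → G →L[ℂ] G) (hcomm : ∀ i j, a i * a j = a j * a i)
    (hstar : ∀ i j, a i * star (a j) = star (a j) * a i)
    (hres : ∀ i, a i - star (a i) = (2 * Complex.I) • (star (a i) * a i))
    (hinj : ∀ i φ, a i φ = 0 → φ = 0) :
    ∃ E : PVM (ι → ℝ) G, ∀ i, E.calculus (resolventFun i) = a i := by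
  let S : StarSubalgebra ℂ (G →L[ℂ] G) := (StarAlgebra.adjoin ℂ (Set.range a)).topologicalClosure
  have hclosed : IsClosed (S : Set (G →L[ℂ] G)) := StarSubalgebra.isClosed_topologicalClosure _
  have hadj : IsMulCommutative (StarAlgebra.adjoin ℂ (Set.range a)) :=
    StarAlgebra.isMulCommutative_adjoin ℂ
      (by rintro _ ⟨i, rfl⟩ _ ⟨j, rfl⟩; exact hcomm i j)
      (by rintro _ ⟨i, rfl⟩ _ ⟨j, rfl⟩; exact hstar i j)
  let _ : CStarAlgebra S := StarSubalgebra.cstarAlgebra S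
  let _ : CommCStarAlgebra S :=
    { (inferInstance : CStarAlgebra S) with
      mul_comm := fun x y =>
        (StarSubalgebra.commSemiringTopologicalClosure (StarAlgebra.adjoin ℂ (Set.range a))
          (fun x y => hadj.is_comm.comm x y)).mul_comm x y }
  let Δ := WeakDual.characterSpace ℂ S
  let _ : MeasurableSpace Δ := borel Δ
  have : BorelSpace Δ := ⟨rfl⟩
  let Γ : S ≃⋆ₐ[ℂ] C(Δ, ℂ) := gelfandStarTransform S
  let π : C(Δ, ℂ) →⋆ₐ[ℂ] (G →L[ℂ] G) := S.subtype.comp Γ.symm.toStarAlgHom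
  have hmem : ∀ i, a i ∈ S := fun i =>
    StarSubalgebra.le_topologicalClosure _ (StarAlgebra.subset_adjoin ℂ _ ⟨i, rfl⟩)
  let w : ι → C(Δ, ℂ) := fun i => Γ ⟨a i, hmem i⟩
  have hπw : ∀ i, π (w i) = a i := fun i => by
    change ((Γ.symm (Γ ⟨a i, hmem i⟩) : S) : G →L[ℂ] G) = a i
    rw [StarAlgEquiv.symm_apply_apply]
  have hw : ∀ i, w i - star (w i) = (2 * Complex.I) • (star (w i) * w i) := fun i => by
    simp only [w, ← map_star, ← map_sub, ← map_mul, ← map_smul]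
    congr 1
    exact Subtype.ext (hres i)
  let F := repPVM π
  have hF : ∀ i φ, F.cyc φ (w i) = a i φ := fun i φ => by rw [cyc_repPVM, hπw]
  have hwm : ∀ i, Measurable (w i) := fun i => (w i).continuous.measurable
  -- With `B` the zero set of `w i`, the vector `a i (E(B) φ)` is the integral of `w i` times the
  -- indicator of `B`, hence zero; injectivity of `a i` gives `E(B) φ = 0`.
  have hne : ∀ i φ, ∀ᵐ x ∂F.meas φ, w i x ≠ 0 := fun i φ => by
    have hB : MeasurableSet {x | w i x = 0} := hwm i (measurableSet_singleton 0)
    have h0 : F.proj {x | w i x = 0} φ = 0 := by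
      apply hinj i
      rw [← hF]
      have h1 := F.cyc_indicator φ hB 1
      rw [one_smul] at h1
      have hz : (fun x => w i x * {x | w i x = 0}.indicator (fun _ => (1 : ℂ)) x) =
          (∅ : Set Δ).indicator fun _ => (0 : ℂ) := by
        ext x
        by_cases hx : w i x = 0 <;> simp [hx]
      rw [← h1, F.cyc_cyc (measurable_const.indicator hB) (PVM.memLp_indicator _ hB 1) (hwm i)
        (by rw [hz]; exact PVM.memLp_indicator _ MeasurableSet.empty 0), hz,
        F.cyc_indicator _ MeasurableSet.empty, zero_smul]
    rw [ae_iff]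
    simp only [not_not]
    rw [F.meas_apply φ hB, h0]
    simp
  -- Where `w i` vanishes the inverse is the default value `0`; this happens only on a null set.
  let κ : Δ → ι → ℝ := fun x i => ((w i x)⁻¹ + Complex.I).re
  have hκ : Measurable κ := measurable_pi_lambda _ fun i =>
    Complex.measurable_re.comp ((hwm i).inv.add_const _)
  refine ⟨F.map hκ, fun i => ?_⟩
  rw [F.calculus_map hκ (measurable_resolventFun i) (norm_resolventFun_le i)]
  ext φ
  rw [F.calculus_apply (f := fun x => resolventFun i (κ x)) (C := 1) ((measurable_resolventFun i).comp hκ)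
    fun x => norm_resolventFun_le i _, ← hF]
  refine F.cyc_congr ?_
  filter_upwards [hne i φ] with x hx
  refine eq_inv_sub_I hx ?_
  have := congrArg (fun f : C(Δ, ℂ) => f x) (hw i)
  simpa using this

/-! ### Resolvents of self-adjoint operators -/

section Resolvent

variable {H : Type*} [NormedAddCommGroup H] [InnerProductSpace ℂ H] [CompleteSpace H]

theorem inner_apply_left_of_isSelfAdjoint {T : H →ₗ.[ℂ] H} (hT : IsSelfAdjoint T)
    (x y : T.domain) : ⟪T x, (y : H)⟫_ℂ = ⟪(x : H), T y⟫_ℂ := by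
  have h := LinearPMap.adjoint_isFormalAdjoint hT.dense_domain
  rw [LinearPMap.isSelfAdjoint_def.1 hT] at h
  exact h x y

/-- The cross term is twice the real part of an imaginary number times the real number `⟪T x, x⟫`.
The hypotheses on `z` mean `z = ±i`. -/
theorem norm_sub_smul_sq {T : H →ₗ.[ℂ] H} (hT : IsSelfAdjoint T) {z : ℂ} (hz : z.re = 0)
    (hz1 : ‖z‖ = 1) (x : T.domain) :
    ‖T x - z • (x : H)‖ ^ 2 = ‖T x‖ ^ 2 + ‖(x : H)‖ ^ 2 := by
  have him : (⟪T x, (x : H)⟫_ℂ).im = 0 := by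
    rw [← Complex.conj_eq_iff_im, inner_conj_symm, inner_apply_left_of_isSelfAdjoint hT]
  rw [@norm_sub_sq ℂ, inner_smul_right, norm_smul, hz1, one_mul]
  have : (z * ⟪T x, (x : H)⟫_ℂ).re = 0 := by
    rw [Complex.mul_re, hz, him]; ring
  simp only [RCLike.re_to_complex, this]
  ring

/-- The operator `T - z` on the graph of `T`. -/
def graphSub (T : H →ₗ.[ℂ] H) (z : ℂ) : T.graph →ₗ[ℂ] H :=
  (LinearMap.snd ℂ H H - z • LinearMap.fst ℂ H H) ∘ₗ T.graph.subtype

theorem graphSub_mk (T : H →ₗ.[ℂ] H) (z : ℂ) (x : T.domain) :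
    graphSub T z ⟨((x : H), T x), T.mem_graph x⟩ = T x - z • (x : H) := rfl

theorem norm_le_norm_graphSub {T : H →ₗ.[ℂ] H} (hT : IsSelfAdjoint T) {z : ℂ} (hz : z.re = 0)
    (hz1 : ‖z‖ = 1) (p : T.graph) : ‖p‖ ≤ ‖graphSub T z p‖ := by
  obtain ⟨⟨a, b⟩, hp⟩ := p
  obtain ⟨x, rfl, rfl⟩ := (LinearPMap.mem_graph_iff T).1 hp
  have h := norm_sub_smul_sq hT hz hz1 x
  change max ‖(x : H)‖ ‖T x‖ ≤ ‖T x - z • (x : H)‖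
  refine max_le ?_ ?_ <;> refine (sq_le_sq₀ (norm_nonneg _) (norm_nonneg _)).1 ?_ <;>
    nlinarith [sq_nonneg ‖(x : H)‖, sq_nonneg ‖T x‖]

/-- The graph is complete and `T - z` is bounded below on it, so the range is closed. A vector
orthogonal to the range lies in the domain of `T* = T` and is an eigenvector for the conjugate of
`z`, which the norm identity `norm_sub_smul_sq` excludes unless it is zero. -/
theorem graphSub_surjective {T : H →ₗ.[ℂ] H} (hT : IsSelfAdjoint T) {z : ℂ} (hz : z.re = 0)
    (hz1 : ‖z‖ = 1) : Function.Surjective (graphSub T z) := by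
  rw [← LinearMap.range_eq_top]
  have hcl : IsClosed (LinearMap.range (graphSub T z) : Set H) := by
    have : CompleteSpace T.graph := (hT.isClosed).completeSpace_coe
    have hanti : AntilipschitzWith 1 (graphSub T z) :=
      AddMonoidHomClass.antilipschitz_of_bound (graphSub T z) (K := 1) fun p => by
        simpa using norm_le_norm_graphSub hT hz hz1 p
    have hcont : UniformContinuous (graphSub T z) := by
      have h1 : UniformContinuous fun p : T.graph => (p : H × H).2 - z • (p : H × H).1 := by
        refine UniformContinuous.sub ?_ (UniformContinuous.const_smul ?_ z)
        · exact uniformContinuous_snd.comp uniformContinuous_subtype_val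
        · exact uniformContinuous_fst.comp uniformContinuous_subtype_val
      exact h1
    exact hanti.isClosed_range hcont
  have hcomp : (LinearMap.range (graphSub T z)).HasOrthogonalProjection := by
    have : CompleteSpace (LinearMap.range (graphSub T z)) := hcl.completeSpace_coe
    infer_instance
  rw [← Submodule.orthogonal_eq_bot_iff, Submodule.eq_bot_iff]
  intro v hv
  have hv' : ∀ x : T.domain, ⟪v, T x⟫_ℂ = z * ⟪v, (x : H)⟫_ℂ := fun x => by
    have h := Submodule.inner_left_of_mem_orthogonal (LinearMap.mem_range_self (graphSub T z)
      ⟨((x : H), T x), T.mem_graph x⟩) hv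
    rw [graphSub_mk, inner_sub_right, inner_smul_right, sub_eq_zero] at h
    exact h
  have hw : ∀ x : T.domain, ⟪(starRingEnd ℂ z) • v, (x : H)⟫_ℂ = ⟪v, T x⟫_ℂ := fun x => by
    rw [inner_smul_left, Complex.conj_conj, hv']
  have hdom : v ∈ T.adjoint.domain := LinearPMap.mem_adjoint_domain_of_exists v ⟨_, hw⟩
  have hval := LinearPMap.adjoint_apply_eq hT.dense_domain ⟨v, hdom⟩ hw
  have hTe := LinearPMap.isSelfAdjoint_def.1 hT
  have key : ∃ h : v ∈ T.domain, T ⟨v, h⟩ = (starRingEnd ℂ z) • v := by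
    have : ∀ S : H →ₗ.[ℂ] H, T.adjoint = S → ∃ h : v ∈ S.domain, S ⟨v, h⟩ = (starRingEnd ℂ z) • v := by
      rintro S rfl
      exact ⟨hdom, hval⟩
    exact this T hTe
  obtain ⟨h, hv2⟩ := key
  have h3 := norm_sub_smul_sq hT (z := starRingEnd ℂ z) (by simpa using hz) (by simpa using hz1) ⟨v, h⟩
  rw [hv2, sub_self, norm_zero] at h3
  have : ‖v‖ ^ 2 ≤ 0 := by nlinarith [sq_nonneg ‖(starRingEnd ℂ z) • v‖]
  have : ‖v‖ = 0 := by nlinarith [norm_nonneg v]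
  simpa using this

theorem exists_isResolventAt {T : H →ₗ.[ℂ] H} (hT : IsSelfAdjoint T) {z : ℂ} (hz : z.re = 0)
    (hz1 : ‖z‖ = 1) : ∃ R : H →L[ℂ] H, IsResolventAt T z R := by
  have hinj : Function.Injective (graphSub T z) := by
    rw [← LinearMap.ker_eq_bot, LinearMap.ker_eq_bot']
    intro p hp
    have := norm_le_norm_graphSub hT hz hz1 p
    rw [hp, norm_zero] at this
    exact norm_le_zero_iff.1 this
  let e := LinearEquiv.ofBijective (graphSub T z) ⟨hinj, graphSub_surjective hT hz hz1⟩
  let R : H →L[ℂ] H := LinearMap.mkContinuous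
    (LinearMap.fst ℂ H H ∘ₗ T.graph.subtype ∘ₗ e.symm.toLinearMap) 1 (fun v => by
      rw [one_mul]
      have h := norm_le_norm_graphSub hT hz hz1 (e.symm v)
      have h2 : graphSub T z (e.symm v) = v := e.apply_symm_apply v
      rw [h2] at h
      exact (norm_fst_le _).trans h)
  refine ⟨R, fun v => ?_, fun x => ?_⟩
  · obtain ⟨x, hx1, hx2⟩ := (LinearPMap.mem_graph_iff T).1 (e.symm v).2
    have hR : R v = x := hx1.symm
    have h2 : graphSub T z (e.symm v) = v := e.apply_symm_apply v
    have h3 : ((e.symm v : T.graph) : H × H).2 - z • ((e.symm v : T.graph) : H × H).1 = v := h2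
    refine ⟨by rw [hR]; exact x.2, ?_⟩
    have : (⟨R v, by rw [hR]; exact x.2⟩ : T.domain) = x := Subtype.ext hR
    rw [this, hR, hx2, hx1, h3]
  · have : e.symm (T x - z • (x : H)) = ⟨((x : H), T x), T.mem_graph x⟩ := by
      rw [LinearEquiv.symm_apply_eq]
      rfl
    change ((e.symm (T x - z • (x : H)) : T.graph) : H × H).1 = x
    rw [this]

/-- Write both arguments of the inner product as images under `T - z` and under `T` minus the
conjugate of `z`; symmetry of `T` then matches the two sides. -/
theorem star_resolvent {T : H →ₗ.[ℂ] H} (hT : IsSelfAdjoint T) {z : ℂ}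
    {R R' : H →L[ℂ] H} (hR : IsResolventAt T z R) (hR' : IsResolventAt T (starRingEnd ℂ z) R') :
    star R = R' := by
  rw [ContinuousLinearMap.star_eq_adjoint]
  symm
  rw [ContinuousLinearMap.eq_adjoint_iff]
  intro w v
  obtain ⟨h1, h1'⟩ := hR.1 v
  obtain ⟨h2, h2'⟩ := hR'.1 w
  have key := inner_apply_left_of_isSelfAdjoint hT ⟨_, h2⟩ ⟨_, h1⟩
  conv_lhs => rw [← h1']
  conv_rhs => rw [← h2']
  rw [inner_sub_right, inner_sub_left, inner_smul_right, inner_smul_left, Complex.conj_conj, key]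

theorem resolvent_identity {T : H →ₗ.[ℂ] H} {z w : ℂ} {R R' : H →L[ℂ] H}
    (hR : IsResolventAt T z R) (hR' : IsResolventAt T w R') :
    R - R' = (z - w) • (R' * R) := by
  ext v
  obtain ⟨h1, h1'⟩ := hR.1 v
  have h2 := hR'.2 ⟨_, h1⟩
  have h3 : v = (T ⟨R v, h1⟩ - w • R v) - (z - w) • R v := by
    rw [← sub_add_cancel (T ⟨R v, h1⟩) (z • R v), h1']
    module
  have h4 : R' v = R v - (z - w) • R' (R v) := by
    conv_lhs => rw [h3]
    rw [map_sub, map_smul]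
    exact congrArg (fun t => t - (z - w) • R' (R v)) h2
  change R v - R' v = (z - w) • R' (R v)
  rw [h4, sub_sub_cancel]

end Resolvent

namespace PVM

variable {Ω : Type*} [MeasurableSpace Ω] {H : Type*} [NormedAddCommGroup H]
  [InnerProductSpace ℂ H] [CompleteSpace H]

/-- The cyclic isometry sends the constant `1` to `φ`, so its adjoint sends `φ` back to `1`. -/
theorem density_self (E : PVM Ω H) (φ : H) : E.density φ φ =ᵐ[E.meas φ] fun _ => 1 := by
  have h1 : (E.cycL φ).adjoint φ = (memLp_const (1 : ℂ) : MemLp _ 2 (E.meas φ)).toLp := by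
    refine ext_inner_right ℂ fun f => ?_
    rw [ContinuousLinearMap.adjoint_inner_left, ← E.inner_cycL, ← E.cyc_eq, cyc_one]
  filter_upwards [(memLp_const (1 : ℂ) : MemLp _ 2 (E.meas φ)).coeFn_toLp] with x hx
  rw [density, h1, hx, star_one]

theorem integrable_matrixElement_self_iff (E : PVM Ω H) {φ : H} {f : Ω → ℂ} (hf : Measurable f) :
    (E.matrixElement φ φ).Integrable f ↔ Integrable f (E.meas φ) := by
  rw [E.integrable_matrixElement_iff hf]
  refine integrable_congr ?_
  filter_upwards [E.density_self φ] with x hx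
  rw [hx, mul_one]

end PVM

/-! ### The spectral theorem for commuting self-adjoint operators -/

section Joint

variable {ι : Type*} {H : Type*} [NormedAddCommGroup H] [InnerProductSpace ℂ H] [CompleteSpace H]

theorem measurable_coord (μ : ι) : Measurable fun s : ι → ℝ => ((s μ : ℝ) : ℂ) := by fun_prop

theorem integrable_coord_sq_iff (E : PVM (ι → ℝ) H) (μ : ι) (ψ : H) :
    ((E.matrixElement ψ ψ).Integrable fun s => (((s μ) ^ 2 : ℝ) : ℂ)) ↔
      MemLp (fun s : ι → ℝ => ((s μ : ℝ) : ℂ)) 2 (E.meas ψ) := by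
  rw [E.integrable_matrixElement_self_iff (by fun_prop),
    memLp_two_iff_integrable_sq_norm (measurable_coord μ).aestronglyMeasurable]
  have h1 : AEStronglyMeasurable (fun s : ι → ℝ => (((s μ) ^ 2 : ℝ) : ℂ)) (E.meas ψ) :=
    Measurable.aestronglyMeasurable (by fun_prop)
  have h2 : AEStronglyMeasurable (fun s : ι → ℝ => ‖((s μ : ℝ) : ℂ)‖ ^ 2) (E.meas ψ) :=
    Measurable.aestronglyMeasurable (by fun_prop)
  refine integrable_congr' h1 h2 (Eventually.of_forall fun s => ?_)
  simp

theorem coord_mul_resolventFun (μ : ι) (s : ι → ℝ) :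
    ((s μ : ℝ) : ℂ) * resolventFun μ s = 1 + Complex.I * resolventFun μ s := by
  have h := ofReal_sub_I_ne_zero (s μ)
  rw [resolventFun]
  field_simp
  ring

/-- The domain of `X_μ` is the range of its resolvent, and `s_μ (s_μ - i)⁻¹ = 1 + i (s_μ - i)⁻¹` is
bounded, so vectors of the domain have a second moment. Conversely, if `s_μ` is square integrable,
then `ψ` is the resolvent applied to `∫ (s_μ - i) dE ψ`. The value of `X_μ` follows from the same
identity. -/
theorem isJointSpectralMeasure_of_calculus_eq {X : ι → H →ₗ.[ℂ] H} {E : PVM (ι → ℝ) H}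
    {R : ι → H →L[ℂ] H} (hR : ∀ μ, IsResolventAt (X μ) Complex.I (R μ))
    (hE : ∀ μ, E.calculus (resolventFun μ) = R μ) : IsJointSpectralMeasure X E := by
  intro μ
  have hr := measurable_resolventFun μ
  have hr2 : ∀ φ, MemLp (resolventFun μ) 2 (E.meas φ) := fun φ =>
    PVM.memLp_of_bound _ hr (norm_resolventFun_le μ)
  have hRc : ∀ φ, R μ φ = E.cyc φ (resolventFun μ) := fun φ => by
    rw [← hE, E.calculus_apply hr (norm_resolventFun_le μ)]
  have hs := measurable_coord μ
  have hsr : ∀ φ, MemLp (fun s : ι → ℝ => ((s μ : ℝ) : ℂ) * resolventFun μ s) 2 (E.meas φ) := fun φ => by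
    have h : (fun s : ι → ℝ => ((s μ : ℝ) : ℂ) * resolventFun μ s) =
        (fun _ => (1 : ℂ)) + Complex.I • resolventFun μ := funext (coord_mul_resolventFun μ)
    rw [h]
    have h1 : MemLp (fun _ : ι → ℝ => (1 : ℂ)) 2 (E.meas φ) := memLp_const 1
    exact h1.add ((hr2 φ).const_smul Complex.I)
  have hdom : ∀ ψ ∈ (X μ).domain, MemLp (fun s : ι → ℝ => ((s μ : ℝ) : ℂ)) 2 (E.meas ψ) := fun ψ h => by
    have h1 : R μ (X μ ⟨ψ, h⟩ - Complex.I • ψ) = ψ := (hR μ).2 ⟨ψ, h⟩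
    rw [← h1, hRc, E.memLp_cyc_iff hr (hr2 _) hs]
    exact hsr _
  refine ⟨fun ψ => ?_, fun ψ φ => ?_⟩
  · rw [integrable_coord_sq_iff]
    refine ⟨hdom ψ, fun h2 => ?_⟩
    have hm : Measurable fun s : ι → ℝ => ((s μ : ℝ) : ℂ) - Complex.I := by fun_prop
    have hm2 : MemLp (fun s : ι → ℝ => ((s μ : ℝ) : ℂ) - Complex.I) 2 (E.meas ψ) :=
      h2.sub (memLp_const _)
    have hone : (fun s : ι → ℝ => resolventFun μ s * (((s μ : ℝ) : ℂ) - Complex.I)) = fun _ => 1 := by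
      ext s
      exact inv_mul_cancel₀ (ofReal_sub_I_ne_zero _)
    have h3 : R μ (E.cyc ψ fun s => ((s μ : ℝ) : ℂ) - Complex.I) = ψ := by
      rw [hRc, E.cyc_cyc hm hm2 hr (by rw [hone]; exact memLp_const 1), hone, E.cyc_one]
    obtain ⟨h, -⟩ := (hR μ).1 (E.cyc ψ fun s => ((s μ : ℝ) : ℂ) - Complex.I)
    rwa [h3] at h
  · rw [E.integral_eq_inner_cyc hs (hdom ψ ψ.2)]
    congr 1
    set χ : H := X μ ψ - Complex.I • (ψ : H) with hχ
    have h1 : R μ χ = ψ := (hR μ).2 ψ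
    have h4 : E.cyc (ψ : H) (fun s => ((s μ : ℝ) : ℂ)) = χ + Complex.I • (ψ : H) := by
      conv_lhs => rw [← h1, hRc]
      rw [E.cyc_cyc hr (hr2 _) hs (hsr _)]
      have : (fun s : ι → ℝ => ((s μ : ℝ) : ℂ) * resolventFun μ s) =
          (fun _ => 1) + Complex.I • resolventFun μ := by
        ext s; exact coord_mul_resolventFun μ s
      rw [this, E.cyc_add (memLp_const 1) ((hr2 _).const_smul _), E.cyc_smul (hr2 _), E.cyc_one,
        ← hRc, h1]
    rw [h4, hχ, sub_add_cancel]

theorem exists_isJointSpectralMeasure [Countable ι] {X : ι → H →ₗ.[ℂ] H}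
    (hX : IsCommutingSelfAdjoint X) : ∃ E, IsJointSpectralMeasure X E := by
  choose R hR using fun μ => exists_isResolventAt (hX.1 μ) (z := Complex.I) (by simp) (by simp)
  choose R' hR' using fun μ => exists_isResolventAt (hX.1 μ) (z := starRingEnd ℂ Complex.I)
    (by simp) (by simp)
  have hstar : ∀ μ, star (R μ) = R' μ := fun μ => star_resolvent (hX.1 μ) (hR μ) (hR' μ)
  obtain ⟨E, hE⟩ := exists_pvm_of_resolvents R
    (fun i j => hX.2 i j _ _ (by simp) (by simp) _ _ (hR i) (hR j))
    (fun i j => by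
      rw [hstar]
      exact hX.2 i j _ _ (by simp) (by simp) _ _ (hR i) (hR' j))
    (fun i => by
      rw [hstar, resolvent_identity (hR i) (hR' i), Complex.conj_I]
      congr 1
      ring)
    (fun i φ h => by
      obtain ⟨h1, h2⟩ := (hR i).1 φ
      have : (⟨R i φ, h1⟩ : (X i).domain) = 0 := Subtype.ext h
      rw [this, LinearPMap.map_zero, h, smul_zero, sub_zero] at h2
      exact h2.symm)
  exact ⟨E, isJointSpectralMeasure_of_calculus_eq hR hE⟩

theorem isJointSpectralMeasure_jointSpectralMeasure [Countable ι] {X : ι → H →ₗ.[ℂ] H}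
    (hX : IsCommutingSelfAdjoint X) : IsJointSpectralMeasure X (jointSpectralMeasure X) :=
  Classical.epsilon_spec (exists_isJointSpectralMeasure hX)

theorem IsJointSpectralMeasure.memLp_coord {X : ι → H →ₗ.[ℂ] H} {E : PVM (ι → ℝ) H}
    (hE : IsJointSpectralMeasure X E) (μ : ι) {ψ : H} (hψ : ψ ∈ (X μ).domain) :
    MemLp (fun s : ι → ℝ => ((s μ : ℝ) : ℂ)) 2 (E.meas ψ) :=
  (integrable_coord_sq_iff E μ ψ).1 (((hE μ).1 ψ).1 hψ)

theorem IsJointSpectralMeasure.apply_eq_cyc {X : ι → H →ₗ.[ℂ] H} {E : PVM (ι → ℝ) H}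
    (hE : IsJointSpectralMeasure X E) (μ : ι) (ψ : (X μ).domain) :
    X μ ψ = E.cyc ψ fun s => ((s μ : ℝ) : ℂ) := by
  refine ext_inner_left ℂ fun φ => ?_
  rw [(hE μ).2 ψ φ, E.integral_eq_inner_cyc (measurable_coord μ) (hE.memLp_coord μ ψ.2)]

/-- By induction: the spectral measure of `X_μ ψ` is `s_μ²` times that of `ψ`, so each further
application of `X_μ` buys one more power. -/
theorem IsJointSpectralMeasure.memLp_coord_pow {X : ι → H →ₗ.[ℂ] H} {E : PVM (ι → ℝ) H}
    (hE : IsJointSpectralMeasure X E) (μ : ι) (k : ℕ) {ψ : H} (hψ : ψ ∈ powDomain (X μ) k) :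
    MemLp (fun s : ι → ℝ => ((s μ : ℝ) : ℂ) ^ k) 2 (E.meas ψ) := by
  induction k generalizing ψ with
  | zero => simpa using memLp_const (1 : ℂ)
  | succ k ih =>
    obtain ⟨x, hx, rfl⟩ := hψ
    have h1 : X μ x ∈ powDomain (X μ) k := hx
    have h2 := ih h1
    rw [hE.apply_eq_cyc, E.memLp_cyc_iff (measurable_coord μ) (hE.memLp_coord μ x.2)
      (by fun_prop)] at h2
    simpa [pow_succ] using h2

/-- The norm on `ℝ^ι` is the sup norm, attained in one coordinate. Powers of the single operators
therefore suffice, and no mixed products are needed. -/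
theorem IsJointSpectralMeasure.memLp_one_add_norm_pow [Fintype ι] {X : ι → H →ₗ.[ℂ] H}
    {E : PVM (ι → ℝ) H} (hE : IsJointSpectralMeasure X E) (k : ℕ) {ψ : H}
    (hψ : ψ ∈ smoothDomain X) : MemLp (fun s : ι → ℝ => (1 + ‖s‖) ^ k) 2 (E.meas ψ) := by
  have h1 : ∀ μ, MemLp (fun s : ι → ℝ => ((s μ : ℝ) : ℂ) ^ k) 2 (E.meas ψ) := fun μ => by
    refine hE.memLp_coord_pow μ k ?_
    have := (Submodule.mem_iInf _).1 ((Submodule.mem_iInf _).1 hψ μ) k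
    exact this
  have hc : MemLp (fun _ : ι → ℝ => (1 : ℝ)) 2 (E.meas ψ) := memLp_const 1
  have hs : MemLp (fun s : ι → ℝ => ∑ μ, ‖((s μ : ℝ) : ℂ) ^ k‖) 2 (E.meas ψ) :=
    memLp_finsetSum _ fun μ _ => (h1 μ).norm
  have h2 : MemLp (fun s : ι → ℝ => 2 ^ k * (1 + ∑ μ, ‖((s μ : ℝ) : ℂ) ^ k‖)) 2 (E.meas ψ) :=
    (hc.add hs).const_mul (2 ^ k)
  refine h2.mono' (Measurable.aestronglyMeasurable (by fun_prop)) (Eventually.of_forall fun s => ?_)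
  have hsum : ∀ μ, ‖((s μ : ℝ) : ℂ) ^ k‖ ≤ ∑ μ, ‖((s μ : ℝ) : ℂ) ^ k‖ := fun μ =>
    Finset.single_le_sum (f := fun μ => ‖((s μ : ℝ) : ℂ) ^ k‖) (fun _ _ => norm_nonneg _)
      (Finset.mem_univ μ)
  have hnn : 0 ≤ ∑ μ, ‖((s μ : ℝ) : ℂ) ^ k‖ := Finset.sum_nonneg fun _ _ => norm_nonneg _
  rw [Real.norm_of_nonneg (by positivity)]
  rcases le_total ‖s‖ 1 with hs | hs
  · calc (1 + ‖s‖) ^ k ≤ 2 ^ k := pow_le_pow_left₀ (by positivity) (by linarith) k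
      _ ≤ 2 ^ k * (1 + ∑ μ, ‖((s μ : ℝ) : ℂ) ^ k‖) :=
        le_mul_of_one_le_right (by positivity) (by linarith)
  · have hne : Nonempty ι := by
      by_contra hne
      rw [not_nonempty_iff] at hne
      have : s = 0 := Subsingleton.elim _ _
      rw [this, norm_zero] at hs
      linarith
    obtain ⟨μ, hμ⟩ := Finite.exists_max fun μ => ‖s μ‖
    have hle : ‖s‖ ≤ ‖s μ‖ := (pi_norm_le_iff_of_nonneg (norm_nonneg _)).2 hμ
    calc (1 + ‖s‖) ^ k ≤ (2 * ‖s μ‖) ^ k := pow_le_pow_left₀ (by positivity) (by linarith) k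
      _ = 2 ^ k * ‖((s μ : ℝ) : ℂ) ^ k‖ := by rw [mul_pow, norm_pow, Complex.norm_real]
      _ ≤ 2 ^ k * (1 + ∑ μ, ‖((s μ : ℝ) : ℂ) ^ k‖) := by
        have := hsum μ
        gcongr
        linarith

end Joint

/-! ### Product vectors and operators on the Hilbert space tensor product -/

section Tensor

variable {H K : Type*} [NormedAddCommGroup H] [InnerProductSpace ℂ H] [CompleteSpace H]
  [NormedAddCommGroup K] [InnerProductSpace ℂ K] [CompleteSpace K]

theorem inner_tmulVec (ψ ψ' : H) (φ φ' : K) :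
    ⟪tmulVec ψ φ, tmulVec ψ' φ'⟫_ℂ = ⟪ψ, ψ'⟫_ℂ * ⟪φ, φ'⟫_ℂ := by
  rw [tmulVec, tmulVec, UniformSpace.Completion.inner_coe, TensorProduct.inner_tmul]

theorem norm_tmulVec (ψ : H) (φ : K) : ‖tmulVec ψ φ‖ = ‖ψ‖ * ‖φ‖ := by
  rw [tmulVec, UniformSpace.Completion.norm_coe, TensorProduct.norm_tmul]

theorem tmulVec_add_left (ψ ψ' : H) (φ : K) : tmulVec (ψ + ψ') φ = tmulVec ψ φ + tmulVec ψ' φ := by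
  simp only [tmulVec, TensorProduct.add_tmul, UniformSpace.Completion.coe_add]

theorem tmulVec_add_right (ψ : H) (φ φ' : K) :
    tmulVec ψ (φ + φ') = tmulVec ψ φ + tmulVec ψ φ' := by
  simp only [tmulVec, TensorProduct.tmul_add, UniformSpace.Completion.coe_add]

theorem tmulVec_smul_left (c : ℂ) (ψ : H) (φ : K) : tmulVec (c • ψ) φ = c • tmulVec ψ φ := by
  simp only [tmulVec, ← TensorProduct.smul_tmul', UniformSpace.Completion.coe_smul]

theorem tmulVec_smul_right (c : ℂ) (ψ : H) (φ : K) : tmulVec ψ (c • φ) = c • tmulVec ψ φ := by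
  simp only [tmulVec, TensorProduct.tmul_smul, UniformSpace.Completion.coe_smul]

/-- `ψ ↦ ψ ⊗ φ` as a bounded operator. -/
def tmulLeft (φ : K) : H →L[ℂ] HilbertTensor H K :=
  LinearMap.mkContinuous
    { toFun := fun ψ => tmulVec ψ φ
      map_add' := fun ψ ψ' => tmulVec_add_left ψ ψ' φ
      map_smul' := fun c ψ => tmulVec_smul_left c ψ φ } ‖φ‖
    fun ψ => by rw [mul_comm]; exact (norm_tmulVec ψ φ).le

/-- `φ ↦ ψ ⊗ φ` as a bounded operator. -/
def tmulRight (ψ : H) : K →L[ℂ] HilbertTensor H K :=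
  LinearMap.mkContinuous
    { toFun := fun φ => tmulVec ψ φ
      map_add' := fun φ φ' => tmulVec_add_right ψ φ φ'
      map_smul' := fun c φ => tmulVec_smul_right c ψ φ } ‖ψ‖
    fun φ => (norm_tmulVec ψ φ).le

@[simp] theorem tmulLeft_apply (φ : K) (ψ : H) : tmulLeft φ ψ = tmulVec ψ φ := rfl

@[simp] theorem tmulRight_apply (ψ : H) (φ : K) : tmulRight ψ φ = tmulVec ψ φ := rfl

@[simp] theorem tensorOp_tmulVec (S : H →L[ℂ] H) (R : K →L[ℂ] K) (ψ : H) (φ : K) :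
    tensorOp S R (tmulVec ψ φ) = tmulVec (S ψ) (R φ) := by
  have h := ContinuousLinearMap.extend_eq
    ((UniformSpace.Completion.toComplL : H ⊗[ℂ] K →L[ℂ] HilbertTensor H K) ∘L
      TensorProduct.mapL S R) (e := UniformSpace.Completion.toComplL)
    (UniformSpace.Completion.denseRange_coe) (UniformSpace.Completion.isUniformInducing_coe _)
    (ψ ⊗ₜ[ℂ] φ)
  exact h

theorem induction_tmulVec {P : HilbertTensor H K → Prop} (hc : IsClosed {Ψ | P Ψ})
    (hadd : ∀ Ψ Φ, P Ψ → P Φ → P (Ψ + Φ)) (ht : ∀ ψ φ, P (tmulVec ψ φ)) (Ψ : HilbertTensor H K) :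
    P Ψ := by
  induction Ψ using UniformSpace.Completion.induction_on with
  | hp => exact hc
  | ih x =>
    induction x using TensorProduct.induction_on with
    | zero =>
      have := ht 0 0
      simpa [tmulVec] using this
    | tmul ψ φ => exact ht ψ φ
    | add x y hx hy =>
      rw [UniformSpace.Completion.coe_add]
      exact hadd _ _ hx hy

theorem ext_tmulVec {E : Type*} [NormedAddCommGroup E] [NormedSpace ℂ E]
    {S T : HilbertTensor H K →L[ℂ] E} (h : ∀ ψ φ, S (tmulVec ψ φ) = T (tmulVec ψ φ)) : S = T := by
  ext Ψ
  induction Ψ using induction_tmulVec with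
  | hc => exact isClosed_eq (by fun_prop) (by fun_prop)
  | hadd Ψ Φ h1 h2 => rw [map_add, map_add, h1, h2]
  | ht ψ φ => exact h ψ φ

theorem eq_zero_of_inner_tmulVec {Ψ : HilbertTensor H K} (h : ∀ ψ φ, ⟪Ψ, tmulVec ψ φ⟫_ℂ = 0) :
    Ψ = 0 := by
  have h1 : innerSL ℂ Ψ = 0 := ext_tmulVec fun ψ φ => by simpa using h ψ φ
  have h2 : ⟪Ψ, Ψ⟫_ℂ = 0 := congrArg (fun T => T Ψ) h1
  simpa using h2

theorem tensorOp_mul (S S' : H →L[ℂ] H) (R R' : K →L[ℂ] K) :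
    tensorOp S R * tensorOp S' R' = tensorOp (S * S') (R * R') :=
  ext_tmulVec fun ψ φ => by simp

theorem tensorOp_one : tensorOp (1 : H →L[ℂ] H) (1 : K →L[ℂ] K) = 1 :=
  ext_tmulVec fun ψ φ => by simp

theorem tensorOp_star (S : H →L[ℂ] H) (R : K →L[ℂ] K) :
    star (tensorOp S R) = tensorOp (star S) (star R) := by
  refine ext_tmulVec fun ψ φ => ?_
  rw [← sub_eq_zero]
  refine eq_zero_of_inner_tmulVec fun ψ' φ' => ?_
  rw [inner_sub_left, ContinuousLinearMap.star_eq_adjoint, ContinuousLinearMap.adjoint_inner_left,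
    tensorOp_tmulVec, tensorOp_tmulVec, inner_tmulVec, inner_tmulVec,
    ContinuousLinearMap.star_eq_adjoint, ContinuousLinearMap.star_eq_adjoint,
    ContinuousLinearMap.adjoint_inner_left, ContinuousLinearMap.adjoint_inner_left, sub_self]

theorem tensorOp_sub_left (S S' : H →L[ℂ] H) (R : K →L[ℂ] K) :
    tensorOp (S - S') R = tensorOp S R - tensorOp S' R :=
  ext_tmulVec fun ψ φ => by
    rw [sub_apply, tensorOp_tmulVec, tensorOp_tmulVec, tensorOp_tmulVec, sub_apply,
      ← tmulLeft_apply, map_sub]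
    rfl

theorem tensorOp_sub_right (S : H →L[ℂ] H) (R R' : K →L[ℂ] K) :
    tensorOp S (R - R') = tensorOp S R - tensorOp S R' :=
  ext_tmulVec fun ψ φ => by
    rw [sub_apply, tensorOp_tmulVec, tensorOp_tmulVec, tensorOp_tmulVec, sub_apply,
      ← tmulRight_apply, map_sub]
    rfl

theorem tensorOp_smul_left (c : ℂ) (S : H →L[ℂ] H) (R : K →L[ℂ] K) :
    tensorOp (c • S) R = c • tensorOp S R :=
  ext_tmulVec fun ψ φ => by simp [tmulVec_smul_left]

theorem tensorOp_smul_right (c : ℂ) (S : H →L[ℂ] H) (R : K →L[ℂ] K) :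
    tensorOp S (c • R) = c • tensorOp S R :=
  ext_tmulVec fun ψ φ => by simp [tmulVec_smul_right]

theorem denseRange_star_of_injective {S : H →L[ℂ] H} (hS : ∀ ψ, S ψ = 0 → ψ = 0) :
    DenseRange ((star S : H →L[ℂ] H) : H → H) := by
  have h : (LinearMap.range (star S : H →L[ℂ] H).toLinearMap)ᗮ = ⊥ := by
    rw [Submodule.eq_bot_iff]
    intro v hv
    refine hS v (ext_inner_right ℂ fun w => ?_)
    have := Submodule.inner_left_of_mem_orthogonal
      (LinearMap.mem_range_self (star S : H →L[ℂ] H).toLinearMap w) hv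
    rw [inner_zero_left, ← this, ContinuousLinearMap.coe_coe, ContinuousLinearMap.star_eq_adjoint,
      ContinuousLinearMap.adjoint_inner_right]
  rw [← Submodule.topologicalClosure_eq_top_iff] at h
  intro v
  have : v ∈ (LinearMap.range (star S : H →L[ℂ] H).toLinearMap).topologicalClosure := h ▸ trivial
  exact this

/-- If `S` is injective, then `S*` has dense range. A vector killed by `S ⊗ 1` is orthogonal to all
`S* ψ ⊗ φ`, hence to all product vectors. -/
theorem tensorOp_one_right_injective {S : H →L[ℂ] H} (hS : ∀ ψ, S ψ = 0 → ψ = 0)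
    (Ψ : HilbertTensor H K) (h : tensorOp S 1 Ψ = 0) : Ψ = 0 := by
  refine eq_zero_of_inner_tmulVec fun ψ φ => ?_
  induction ψ using (denseRange_star_of_injective hS).induction_on with
  | hp => exact isClosed_eq (continuous_const.inner (tmulLeft φ).continuous) continuous_const
  | ih ψ =>
    have h1 : tmulVec (star S ψ) φ = star (tensorOp S 1) (tmulVec ψ φ) := by
      rw [tensorOp_star, star_one, tensorOp_tmulVec]; rfl
    rw [h1, ContinuousLinearMap.star_eq_adjoint, ContinuousLinearMap.adjoint_inner_right, h,
      inner_zero_left]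

theorem tensorOp_one_left_injective {R : K →L[ℂ] K} (hR : ∀ φ, R φ = 0 → φ = 0)
    (Ψ : HilbertTensor H K) (h : tensorOp 1 R Ψ = 0) : Ψ = 0 := by
  refine eq_zero_of_inner_tmulVec fun ψ φ => ?_
  induction φ using (denseRange_star_of_injective hR).induction_on with
  | hp => exact isClosed_eq (continuous_const.inner (tmulRight ψ).continuous) continuous_const
  | ih φ =>
    have h1 : tmulVec ψ (star R φ) = star (tensorOp 1 R) (tmulVec ψ φ) := by
      rw [tensorOp_star, star_one, tensorOp_tmulVec]; rfl
    rw [h1, ContinuousLinearMap.star_eq_adjoint, ContinuousLinearMap.adjoint_inner_right, h,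
      inner_zero_left]

end Tensor

/-! ### Operators intertwining two spectral measures -/

section Intertwining

namespace PVM

theorem calculus_add {Ω : Type*} [MeasurableSpace Ω] {H : Type*} [NormedAddCommGroup H]
    [InnerProductSpace ℂ H] [CompleteSpace H] (E : PVM Ω H) {f g : Ω → ℂ} (hf : Measurable f)
    {C : ℝ} (hC : ∀ x, ‖f x‖ ≤ C) (hg : Measurable g) {D : ℝ} (hD : ∀ x, ‖g x‖ ≤ D) :
    E.calculus (fun x => f x + g x) = E.calculus f + E.calculus g := by
  ext φ
  rw [add_apply, E.calculus_apply hf hC, E.calculus_apply hg hD,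
    ← E.cyc_add (memLp_of_bound _ hf hC) (memLp_of_bound _ hg hD),
    E.calculus_apply (f := fun x => f x + g x) (hf.add hg) (C := C + D)
      fun x => (norm_add_le _ _).trans (add_le_add (hC x) (hD x))]
  rfl

theorem calculus_const {Ω : Type*} [MeasurableSpace Ω] {H : Type*} [NormedAddCommGroup H]
    [InnerProductSpace ℂ H] [CompleteSpace H] (E : PVM Ω H) (c : ℂ) :
    E.calculus (fun _ => c) = c • 1 := by
  ext φ
  rw [E.calculus_apply measurable_const (C := ‖c‖) (by simp)]
  have h := E.cyc_smul (memLp_const (1 : ℂ) : MemLp (fun _ => (1 : ℂ)) 2 (E.meas φ)) c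
  rw [cyc_one] at h
  have h2 : (c • fun _ : Ω => (1 : ℂ)) = fun _ => c := by ext; simp
  rw [← h2, h]
  rfl

theorem proj_add_proj_compl {Ω : Type*} [MeasurableSpace Ω] {H : Type*} [NormedAddCommGroup H]
    [InnerProductSpace ℂ H] [CompleteSpace H] (E : PVM Ω H) {B : Set Ω} (hB : MeasurableSet B)
    (χ : H) : E.proj B χ + E.proj Bᶜ χ = χ := by
  rw [← add_apply, ← E.proj_union hB hB.compl disjoint_compl_right, Set.union_compl_self,
    E.proj_univ]
  rfl

theorem integral_meas {Ω : Type*} [MeasurableSpace Ω] {H : Type*} [NormedAddCommGroup H]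
    [InnerProductSpace ℂ H] [CompleteSpace H] (E : PVM Ω H) {f : Ω → ℂ} (hf : Measurable f)
    {C : ℝ} (hC : ∀ x, ‖f x‖ ≤ C) (φ : H) :
    ∫ x, f x ∂E.meas φ = ⟪φ, E.calculus f φ⟫_ℂ := by
  have h := E.inner_cyc (φ := φ) (memLp_const 1) (memLp_of_bound _ hf hC)
  rw [cyc_one] at h
  rw [E.calculus_apply hf hC, h]
  simp

end PVM

/-- The resolvent functions as bounded continuous functions. -/
def resolventBCF {ι : Type*} (j : ι) : BoundedContinuousFunction (ι → ℝ) ℂ :=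
  BoundedContinuousFunction.ofNormedAddCommGroup (resolventFun j)
    (by
      unfold resolventFun
      refine Continuous.inv₀ (by fun_prop) fun s => ofReal_sub_I_ne_zero _) 1
    (norm_resolventFun_le j)

variable {ι : Type*} [Fintype ι] {H G : Type*} [NormedAddCommGroup H] [InnerProductSpace ℂ H]
  [CompleteSpace H] [NormedAddCommGroup G] [InnerProductSpace ℂ G] [CompleteSpace G]
  {E : PVM (ι → ℝ) H} {F : PVM (ι → ℝ) G} {V : H →L[ℂ] G} {c : ℝ}

/-- The bounded continuous functions whose integrals, together with their adjoints, are intertwined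
by `V` contain the star-algebra generated by the resolvent functions. This algebra separates points,
so it determines finite measures on `ℝ^ι`. The factor `c` allows `V` to be a multiple of an
isometry, such as `ψ ↦ ψ ⊗ φ` with `c = ‖φ‖²`. -/
theorem meas_eq_of_intertwining (hc : 0 ≤ c) (hV : ∀ a b, ⟪V a, V b⟫_ℂ = c * ⟪a, b⟫_ℂ)
    (h1 : ∀ j ψ, F.calculus (resolventFun j) (V ψ) = V (E.calculus (resolventFun j) ψ))
    (h2 : ∀ j ψ, star (F.calculus (resolventFun j)) (V ψ) =
      V (star (E.calculus (resolventFun j)) ψ)) (ψ : H) :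
    F.meas (V ψ) = ENNReal.ofReal c • E.meas ψ := by
  let A : StarSubalgebra ℂ (BoundedContinuousFunction (ι → ℝ) ℂ) :=
    StarAlgebra.adjoin ℂ (Set.range resolventBCF)
  have hA : ∀ g ∈ A, (∀ ψ, F.calculus g (V ψ) = V (E.calculus g ψ)) ∧
      ∀ ψ, star (F.calculus g) (V ψ) = V (star (E.calculus g) ψ) := by
    intro g hg
    have hm : ∀ g : BoundedContinuousFunction (ι → ℝ) ℂ, Measurable g :=
      fun g => g.continuous.measurable
    induction hg using StarAlgebra.adjoin_induction with
    | mem g hg =>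
      obtain ⟨j, rfl⟩ := hg
      exact ⟨h1 j, h2 j⟩
    | algebraMap r =>
      have e1 : ((algebraMap ℂ (BoundedContinuousFunction (ι → ℝ) ℂ) r :
          BoundedContinuousFunction (ι → ℝ) ℂ) : (ι → ℝ) → ℂ) = fun _ => r := rfl
      rw [e1, F.calculus_const, E.calculus_const]
      simp
    | add f g _ _ hf hg =>
      have e1 : ((f + g : BoundedContinuousFunction (ι → ℝ) ℂ) : (ι → ℝ) → ℂ) =
        fun x => f x + g x := rfl
      rw [e1, F.calculus_add (hm f) f.norm_coe_le_norm (hm g) g.norm_coe_le_norm,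
        E.calculus_add (hm f) f.norm_coe_le_norm (hm g) g.norm_coe_le_norm]
      simp [hf, hg]
    | mul f g _ _ hf hg =>
      have e1 : ((f * g : BoundedContinuousFunction (ι → ℝ) ℂ) : (ι → ℝ) → ℂ) =
        fun x => f x * g x := rfl
      rw [e1, F.calculus_mul (hm f) f.norm_coe_le_norm (hm g) g.norm_coe_le_norm,
        E.calculus_mul (hm f) f.norm_coe_le_norm (hm g) g.norm_coe_le_norm]
      simp [hf, hg]
    | star f _ hf =>
      have e1 : ((star f : BoundedContinuousFunction (ι → ℝ) ℂ) : (ι → ℝ) → ℂ) =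
        fun x => star (f x) := rfl
      rw [e1, F.calculus_star (hm f) f.norm_coe_le_norm,
        E.calculus_star (hm f) f.norm_coe_le_norm]
      exact ⟨hf.2, by simpa using hf.1⟩
  have : IsFiniteMeasure (ENNReal.ofReal c • E.meas ψ) :=
    Measure.smul_finite _ ENNReal.ofReal_ne_top
  refine ext_of_forall_mem_subalgebra_integral_eq_of_pseudoEMetric_complete_countable (A := A) ?_ ?_
  · intro s t hst
    obtain ⟨j, hj⟩ := Function.ne_iff.1 hst
    refine ⟨resolventFun j, ⟨(BoundedContinuousFunction.toContinuousMapStarₐ ℂ (resolventBCF j)),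
      ⟨resolventBCF j, StarAlgebra.subset_adjoin ℂ _ ⟨j, rfl⟩, rfl⟩, rfl⟩, fun h => hj ?_⟩
    have h3 := inv_injective h
    exact_mod_cast sub_left_injective h3
  · intro g hg
    rw [F.integral_meas g.continuous.measurable g.norm_coe_le_norm, (hA g hg).1, hV,
      integral_smul_measure, E.integral_meas g.continuous.measurable g.norm_coe_le_norm,
      ENNReal.toReal_ofReal hc]
    simp

/-- Equality of the measures shows that `F(C) V χ` vanishes whenever `E(C) χ` does. Applied to
`E(Bᶜ) ψ` with `C = B` and to `E(B) ψ` with `C = Bᶜ`, this leaves `F(B) V ψ = V E(B) ψ`. -/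
theorem proj_intertwining (hc : 0 ≤ c) (hV : ∀ a b, ⟪V a, V b⟫_ℂ = c * ⟪a, b⟫_ℂ)
    (h1 : ∀ j ψ, F.calculus (resolventFun j) (V ψ) = V (E.calculus (resolventFun j) ψ))
    (h2 : ∀ j ψ, star (F.calculus (resolventFun j)) (V ψ) =
      V (star (E.calculus (resolventFun j)) ψ)) {B : Set (ι → ℝ)} (hB : MeasurableSet B) (ψ : H) :
    F.proj B (V ψ) = V (E.proj B ψ) := by
  have hn : ∀ χ, ‖V χ‖ ^ 2 = c * ‖χ‖ ^ 2 := fun χ => by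
    have h := hV χ χ
    rw [inner_self_eq_norm_sq_to_K, inner_self_eq_norm_sq_to_K] at h
    exact Complex.ofReal_injective (by simpa using h)
  have hm : ∀ (C : Set (ι → ℝ)), MeasurableSet C → ∀ χ, ‖F.proj C (V χ)‖ ^ 2 =
      c * ‖E.proj C χ‖ ^ 2 := fun C hC χ => by
    have h := congrArg (fun μ : Measure (ι → ℝ) => μ.real C) (meas_eq_of_intertwining hc hV h1 h2 χ)
    simp only [measureReal_ennreal_smul_apply, ENNReal.toReal_ofReal hc] at h
    rwa [F.meas_real_apply _ hC, E.meas_real_apply _ hC] at h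
  have hz : ∀ (C : Set (ι → ℝ)), MeasurableSet C → ∀ χ, E.proj C χ = 0 → F.proj C (V χ) = 0 :=
    fun C hC χ h => by
      have := hm C hC χ
      rw [h, norm_zero] at this
      simpa using this
  have e1 : F.proj B (V (E.proj Bᶜ ψ)) = 0 := hz B hB _ (by
    rw [E.proj_proj hB hB.compl, Set.inter_compl_self, E.proj_empty]; rfl)
  have e2 : F.proj Bᶜ (V (E.proj B ψ)) = 0 := hz _ hB.compl _ (by
    rw [E.proj_proj hB.compl hB, Set.compl_inter_self, E.proj_empty]; rfl)
  have e3 := congrArg (fun χ => F.proj B (V χ)) (E.proj_add_proj_compl hB ψ)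
  have e4 := F.proj_add_proj_compl hB (V (E.proj B ψ))
  simp only [map_add, e1, add_zero] at e3
  rw [e2, add_zero] at e4
  rw [← e3, e4]

theorem calculus_intertwining {Ω : Type*} [MeasurableSpace Ω] {E : PVM Ω H} {F : PVM Ω G}
    (hp : ∀ B, MeasurableSet B → ∀ ψ, F.proj B (V ψ) = V (E.proj B ψ))
    {f : Ω → ℂ} (hf : Measurable f) {C : ℝ} (hC : ∀ x, ‖f x‖ ≤ C) (ψ : H) :
    F.calculus f (V ψ) = V (E.calculus f ψ) := by
  rw [F.calculus_apply hf hC, E.calculus_apply hf hC]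
  refine tendsto_nhds_unique (F.tendsto_cyc_approx hf (PVM.memLp_of_bound _ hf hC))
    (((V.continuous.tendsto _).comp
      (E.tendsto_cyc_approx hf (PVM.memLp_of_bound _ hf hC))).congr fun n => ?_)
  rw [Function.comp_apply, E.cyc_simpleFunc, F.cyc_simpleFunc, map_sum]
  refine Finset.sum_congr rfl fun c _ => ?_
  rw [map_smul, hp _ (SimpleFunc.measurableSet_fiber _ c)]

end Intertwining

/-! ### The product of two spectral measures -/

section Product

variable {ι : Type*} [Fintype ι] {H K : Type*} [NormedAddCommGroup H] [InnerProductSpace ℂ H]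
  [CompleteSpace H] [NormedAddCommGroup K] [InnerProductSpace ℂ K] [CompleteSpace K]

theorem calculus_resolventFun_injective (E : PVM (ι → ℝ) H) (j : ι) (ψ : H)
    (h : E.calculus (resolventFun j) ψ = 0) : ψ = 0 := by
  rw [E.calculus_apply (measurable_resolventFun j) (norm_resolventFun_le j)] at h
  have h2 := E.norm_cyc_sq (φ := ψ)
    (PVM.memLp_of_bound _ (measurable_resolventFun j) (norm_resolventFun_le j))
  rw [h, norm_zero, zero_pow two_ne_zero] at h2
  have h3 := (integral_eq_zero_iff_of_nonneg (fun s => sq_nonneg _)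
    (PVM.memLp_of_bound (E.meas ψ) (measurable_resolventFun j)
      (norm_resolventFun_le j)).norm.integrable_sq).1 h2.symm
  have h4 : ∀ᵐ _ ∂E.meas ψ, False := by
    filter_upwards [h3] with s hs
    have : resolventFun j s ≠ 0 := inv_ne_zero (ofReal_sub_I_ne_zero _)
    simp at hs
    exact this hs
  have h5 : E.meas ψ = 0 := by simpa using h4
  have h6 := E.meas_real_apply ψ MeasurableSet.univ
  rw [h5, E.proj_univ] at h6
  simpa using h6.symm

theorem resolventFun_sub_star (j : ι) (s : ι → ℝ) : resolventFun j s - star (resolventFun j s) =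
    (2 * Complex.I) * (star (resolventFun j s) * resolventFun j s) := by
  have h1 := ofReal_sub_I_ne_zero (s j)
  have h2 : (s j : ℂ) + Complex.I ≠ 0 := fun h => by
    have := congrArg Complex.im h
    simp at this
  have h3 : star (resolventFun j s) = ((s j : ℂ) + Complex.I)⁻¹ := by
    simp [resolventFun]
  rw [h3, resolventFun]
  field_simp
  ring

theorem calculus_resolventFun_commute (E : PVM (ι → ℝ) H) (i j : ι) :
    Commute (E.calculus (resolventFun i)) (E.calculus (resolventFun j)) := by
  have h := fun i j => E.calculus_mul (measurable_resolventFun i) (norm_resolventFun_le i)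
    (measurable_resolventFun j) (norm_resolventFun_le j)
  change _ * _ = _ * _
  rw [← h, ← h]
  simp only [mul_comm]

theorem star_calculus_resolventFun (E : PVM (ι → ℝ) H) (j : ι) :
    star (E.calculus (resolventFun j)) = E.calculus fun s => star (resolventFun j s) :=
  (E.calculus_star (measurable_resolventFun j) (norm_resolventFun_le j)).symm

theorem calculus_resolventFun_commute_star (E : PVM (ι → ℝ) H) (i j : ι) :
    Commute (E.calculus (resolventFun i)) (star (E.calculus (resolventFun j))) := by
  have hs : Measurable fun s => star (resolventFun j s) :=
    continuous_star.measurable.comp (measurable_resolventFun j)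
  have hs1 : ∀ s, ‖star (resolventFun j s)‖ ≤ 1 := fun s => by
    rw [norm_star]; exact norm_resolventFun_le j s
  change _ * _ = _ * _
  rw [star_calculus_resolventFun, ← E.calculus_mul (measurable_resolventFun i)
    (norm_resolventFun_le i) hs hs1, ← E.calculus_mul hs hs1 (measurable_resolventFun i)
    (norm_resolventFun_le i)]
  simp only [mul_comm]

theorem calculus_resolventFun_sub_star (E : PVM (ι → ℝ) H) (j : ι) :
    E.calculus (resolventFun j) - star (E.calculus (resolventFun j)) =
      (2 * Complex.I) • (star (E.calculus (resolventFun j)) * E.calculus (resolventFun j)) := by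
  have hr := measurable_resolventFun j
  have hr1 := norm_resolventFun_le j
  have hs : Measurable fun s => star (resolventFun j s) :=
    continuous_star.measurable.comp hr
  have hs1 : ∀ s, ‖star (resolventFun j s)‖ ≤ 1 := fun s => by
    rw [norm_star]; exact hr1 s
  rw [star_calculus_resolventFun, ← E.calculus_mul hs hs1 hr hr1]
  have hp1 : ∀ s, ‖star (resolventFun j s) * resolventFun j s‖ ≤ 1 := fun s => by
    rw [norm_mul]
    exact mul_le_one₀ (hs1 s) (norm_nonneg _) (hr1 s)
  ext φ
  have hl : ∀ {f : (ι → ℝ) → ℂ}, Measurable f → (∀ s, ‖f s‖ ≤ 1) → MemLp f 2 (E.meas φ) :=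
    fun hf h1 => PVM.memLp_of_bound _ hf h1
  rw [sub_apply, smul_apply, E.calculus_apply hr hr1, E.calculus_apply hs hs1,
    E.calculus_apply (f := fun s => star (resolventFun j s) * resolventFun j s) (hs.mul hr) hp1,
    ← E.cyc_sub (hl hr hr1) (hl hs hs1), ← E.cyc_smul
      (f := fun s => star (resolventFun j s) * resolventFun j s) (hl (hs.mul hr) hp1)]
  congr 1
  ext s
  exact resolventFun_sub_star j s

/-- The operators `(s_j - i)⁻¹ ⊗ 1` and `1 ⊗ (s_j - i)⁻¹`, with the functions evaluated in `E₁` and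
`E₂`, satisfy the hypotheses of `exists_pvm_of_resolvents`. The two marginals of the resulting
measure are identified through the maps `ψ ↦ ψ ⊗ φ` and `φ ↦ ψ ⊗ φ`, and a rectangle is the
intersection of two cylinders. -/
theorem exists_isProductPVM (E₁ : PVM (ι → ℝ) H) (E₂ : PVM (ι → ℝ) K) :
    ∃ F, IsProductPVM E₁ E₂ F := by
  let a : ι ⊕ ι → HilbertTensor H K →L[ℂ] HilbertTensor H K :=
    Sum.elim (fun j => tensorOp (E₁.calculus (resolventFun j)) 1)
      fun j => tensorOp 1 (E₂.calculus (resolventFun j))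
  obtain ⟨F, hF⟩ := exists_pvm_of_resolvents a
    (by
      rintro (i | i) (j | j) <;> simp only [a, Sum.elim_inl, Sum.elim_inr, tensorOp_mul, one_mul,
        mul_one]
      · rw [(calculus_resolventFun_commute E₁ i j).eq]
      · rw [(calculus_resolventFun_commute E₂ i j).eq])
    (by
      rintro (i | i) (j | j) <;> simp only [a, Sum.elim_inl, Sum.elim_inr, tensorOp_mul, one_mul,
        mul_one, tensorOp_star, star_one]
      · rw [(calculus_resolventFun_commute_star E₁ i j).eq]
      · rw [(calculus_resolventFun_commute_star E₂ i j).eq])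
    (by
      rintro (i | i) <;> simp only [a, Sum.elim_inl, Sum.elim_inr, tensorOp_star, tensorOp_mul,
        star_one, one_mul]
      · rw [← tensorOp_sub_left, calculus_resolventFun_sub_star, tensorOp_smul_left]
      · rw [← tensorOp_sub_right, calculus_resolventFun_sub_star, tensorOp_smul_right])
    (by
      rintro (i | i) Ψ h
      · exact tensorOp_one_right_injective (calculus_resolventFun_injective E₁ i) Ψ h
      · exact tensorOp_one_left_injective (calculus_resolventFun_injective E₂ i) Ψ h)
  refine ⟨F, fun B C hB hC => ?_⟩
  have hl : Measurable fun w : ι ⊕ ι → ℝ => w ∘ Sum.inl := by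
    exact measurable_pi_lambda _ fun i => measurable_pi_apply (Sum.inl i)
  have hr : Measurable fun w : ι ⊕ ι → ℝ => w ∘ Sum.inr := by
    exact measurable_pi_lambda _ fun i => measurable_pi_apply (Sum.inr i)
  have hFl : ∀ j, (F.map hl).calculus (resolventFun j) =
      tensorOp (E₁.calculus (resolventFun j)) 1 := fun j => by
    rw [F.calculus_map hl (measurable_resolventFun j) (norm_resolventFun_le j)]
    exact hF (Sum.inl j)
  have hFr : ∀ j, (F.map hr).calculus (resolventFun j) =
      tensorOp 1 (E₂.calculus (resolventFun j)) := fun j => by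
    rw [F.calculus_map hr (measurable_resolventFun j) (norm_resolventFun_le j)]
    exact hF (Sum.inr j)
  have e1 : ∀ ψ φ, F.proj ((fun w => w ∘ Sum.inl) ⁻¹' B) (tmulVec ψ φ) =
      tmulVec (E₁.proj B ψ) φ := fun ψ φ => by
    rw [← F.map_proj hl hB]
    refine proj_intertwining (V := tmulLeft φ) (c := ‖φ‖ ^ 2) (by positivity) (fun a b => ?_)
      (fun j ψ => ?_) (fun j ψ => ?_) hB ψ
    · rw [tmulLeft_apply, tmulLeft_apply, inner_tmulVec, inner_self_eq_norm_sq_to_K, mul_comm]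
      simp
    · rw [hFl, tmulLeft_apply, tensorOp_tmulVec]; rfl
    · rw [hFl, tensorOp_star, tmulLeft_apply, tensorOp_tmulVec, star_one]; rfl
  have e2 : ∀ ψ φ, F.proj ((fun w => w ∘ Sum.inr) ⁻¹' C) (tmulVec ψ φ) =
      tmulVec ψ (E₂.proj C φ) := fun ψ φ => by
    rw [← F.map_proj hr hC]
    refine proj_intertwining (V := tmulRight ψ) (c := ‖ψ‖ ^ 2) (by positivity) (fun a b => ?_)
      (fun j ψ => ?_) (fun j ψ => ?_) hC φ
    · rw [tmulRight_apply, tmulRight_apply, inner_tmulVec, inner_self_eq_norm_sq_to_K]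
      simp
    · rw [hFr, tmulRight_apply, tensorOp_tmulVec]; rfl
    · rw [hFr, tensorOp_star, tmulRight_apply, tensorOp_tmulVec, star_one]; rfl
  refine ext_tmulVec fun ψ φ => ?_
  have hset : {w : ι ⊕ ι → ℝ | w ∘ Sum.inl ∈ B ∧ w ∘ Sum.inr ∈ C} =
      ((fun w => w ∘ Sum.inl) ⁻¹' B) ∩ ((fun w => w ∘ Sum.inr) ⁻¹' C) := rfl
  rw [hset, ← F.proj_proj (hl hB) (hr hC), e2, e1, tensorOp_tmulVec]

end Product

/-! ### The unitary groups generated by a spectral measure -/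

section ExpFun

variable {ι : Type*} [Fintype ι]

/-- The character `s ↦ e^{i y·s}`. -/
def expFun (y s : ι → ℝ) : ℂ := Complex.exp (Complex.I * ((y ⬝ᵥ s : ℝ) : ℂ))

theorem norm_expFun (y s : ι → ℝ) : ‖expFun y s‖ = 1 := by
  rw [expFun, mul_comm, Complex.norm_exp_ofReal_mul_I]

theorem norm_expFun_le (y s : ι → ℝ) : ‖expFun y s‖ ≤ 1 := (norm_expFun y s).le

theorem continuous_uncurry_expFun : Continuous fun q : (ι → ℝ) × (ι → ℝ) => expFun q.1 q.2 := by
  unfold expFun dotProduct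
  fun_prop

theorem measurable_expFun (y : ι → ℝ) : Measurable (expFun y) :=
  (continuous_uncurry_expFun.comp (Continuous.prodMk_right y)).measurable

theorem expFun_zero (s : ι → ℝ) : expFun 0 s = 1 := by simp [expFun]

theorem expFun_comm (y s : ι → ℝ) : expFun y s = expFun s y := by
  rw [expFun, expFun, dotProduct_comm]

theorem expFun_add (y z s : ι → ℝ) : expFun (y + z) s = expFun y s * expFun z s := by
  rw [expFun, expFun, expFun, ← Complex.exp_add, add_dotProduct, Complex.ofReal_add, mul_add]

theorem expFun_add_right (y s t : ι → ℝ) : expFun y (s + t) = expFun y s * expFun y t := by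
  rw [expFun_comm, expFun_add, expFun_comm s, expFun_comm t]

theorem star_expFun (y s : ι → ℝ) : star (expFun y s) = expFun (-y) s := by
  rw [expFun, expFun, ← starRingEnd_apply, ← Complex.exp_conj]
  simp

theorem expFun_sum {κ : Type*} [Fintype κ] (p w : ι ⊕ κ → ℝ) :
    expFun p w = expFun (p ∘ Sum.inl) (w ∘ Sum.inl) * expFun (p ∘ Sum.inr) (w ∘ Sum.inr) := by
  rw [expFun, expFun, expFun, ← Complex.exp_add]
  simp only [dotProduct, Fintype.sum_sum_type, Function.comp_apply]
  push_cast
  rw [mul_add]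

end ExpFun

namespace PVM

section

variable {ι : Type*} [Fintype ι] {H : Type*} [NormedAddCommGroup H] [InnerProductSpace ℂ H]
  [CompleteSpace H] (E : PVM (ι → ℝ) H)

theorem calculus_expFun_zero : E.calculus (expFun 0) = 1 := by
  rw [← E.calculus_one]
  exact congrArg _ (funext expFun_zero)

theorem calculus_expFun_add (y z : ι → ℝ) :
    E.calculus (expFun (y + z)) = E.calculus (expFun y) * E.calculus (expFun z) := by
  rw [← E.calculus_mul (measurable_expFun y) (norm_expFun_le y) (measurable_expFun z)
    (norm_expFun_le z)]
  exact congrArg _ (funext (expFun_add y z))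

theorem star_calculus_expFun (y : ι → ℝ) :
    star (E.calculus (expFun y)) = E.calculus (expFun (-y)) := by
  rw [← E.calculus_star (measurable_expFun y) (norm_expFun_le y)]
  exact congrArg _ (funext (star_expFun y))

theorem continuous_calculus_expFun (ψ : H) : Continuous fun y => E.calculus (expFun y) ψ :=
  continuous_iff_seqContinuous.2 fun y y₀ hy =>
    E.tendsto_calculus (fun n => measurable_expFun (y n)) (measurable_expFun y₀)
      (fun n => norm_expFun_le (y n)) (fun s =>
        ((continuous_uncurry_expFun.comp (Continuous.prodMk_left s)).tendsto y₀).comp hy) ψ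

end

section

variable {Ω : Type*} [MeasurableSpace Ω] {H : Type*} [NormedAddCommGroup H]
  [InnerProductSpace ℂ H] [CompleteSpace H] (E : PVM Ω H)

theorem calculus_finsetSum {κ : Type*} (s : Finset κ) {f : κ → Ω → ℂ} (hf : ∀ k, Measurable (f k))
    {C : ℝ} (hC : ∀ k x, ‖f k x‖ ≤ C) :
    E.calculus (fun x => ∑ k ∈ s, f k x) = ∑ k ∈ s, E.calculus (f k) := by
  classical
  induction s using Finset.induction_on with
  | empty => simp [E.calculus_const]
  | insert k s hk ih =>
    simp only [Finset.sum_insert hk]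
    rw [← ih]
    refine E.calculus_add (hf k) (hC k) (Finset.measurable_sum _ fun i _ => hf i)
      (D := s.card • C) fun x => ?_
    exact (norm_sum_le _ _).trans (Finset.sum_le_card_nsmul _ _ _ fun i _ => hC i x)

end

end PVM

/-! ### Functions of a product spectral measure -/

section Product

variable {ι : Type*} [Fintype ι] {H K : Type*} [NormedAddCommGroup H] [InnerProductSpace ℂ H]
  [CompleteSpace H] [NormedAddCommGroup K] [InnerProductSpace ℂ K] [CompleteSpace K]
  {E₁ : PVM (ι → ℝ) H} {E₂ : PVM (ι → ℝ) K} {F : PVM (ι ⊕ ι → ℝ) (HilbertTensor H K)}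

theorem measurable_comp_inl : Measurable fun w : ι ⊕ ι → ℝ => w ∘ Sum.inl :=
  measurable_pi_lambda _ fun i => measurable_pi_apply (Sum.inl i)

theorem measurable_comp_inr : Measurable fun w : ι ⊕ ι → ℝ => w ∘ Sum.inr :=
  measurable_pi_lambda _ fun i => measurable_pi_apply (Sum.inr i)

theorem IsProductPVM.calculus_inl (hF : IsProductPVM E₁ E₂ F) {f : (ι → ℝ) → ℂ}
    (hf : Measurable f) {C : ℝ} (hC : ∀ x, ‖f x‖ ≤ C) :
    F.calculus (fun w => f (w ∘ Sum.inl)) = tensorOp (E₁.calculus f) 1 := by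
  refine ext_tmulVec fun ψ φ => ?_
  rw [← F.calculus_map measurable_comp_inl hf hC, tensorOp_tmulVec, one_apply_eq_self]
  refine calculus_intertwining (V := tmulLeft φ) (fun B hB ψ => ?_) hf hC ψ
  rw [F.map_proj measurable_comp_inl hB]
  have h := hF B Set.univ hB MeasurableSet.univ
  simp only [Set.mem_univ, and_true, E₂.proj_univ] at h
  rw [Set.preimage, h]
  simp

theorem IsProductPVM.calculus_inr (hF : IsProductPVM E₁ E₂ F) {f : (ι → ℝ) → ℂ}
    (hf : Measurable f) {C : ℝ} (hC : ∀ x, ‖f x‖ ≤ C) :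
    F.calculus (fun w => f (w ∘ Sum.inr)) = tensorOp 1 (E₂.calculus f) := by
  refine ext_tmulVec fun ψ φ => ?_
  rw [← F.calculus_map measurable_comp_inr hf hC, tensorOp_tmulVec, one_apply_eq_self]
  refine calculus_intertwining (V := tmulRight ψ) (fun B hB φ => ?_) hf hC φ
  rw [F.map_proj measurable_comp_inr hB]
  have h := hF Set.univ B MeasurableSet.univ hB
  simp only [Set.mem_univ, true_and, E₁.proj_univ] at h
  rw [Set.preimage, h]
  simp

theorem IsProductPVM.calculus_mul (hF : IsProductPVM E₁ E₂ F) {f g : (ι → ℝ) → ℂ}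
    (hf : Measurable f) {C : ℝ} (hC : ∀ x, ‖f x‖ ≤ C) (hg : Measurable g) {C' : ℝ}
    (hC' : ∀ x, ‖g x‖ ≤ C') : F.calculus (fun w => f (w ∘ Sum.inl) * g (w ∘ Sum.inr)) =
      tensorOp (E₁.calculus f) (E₂.calculus g) := by
  rw [F.calculus_mul (f := fun w => f (w ∘ Sum.inl)) (g := fun w => g (w ∘ Sum.inr))
    (hf.comp measurable_comp_inl) (fun w => hC _) (hg.comp measurable_comp_inr) (fun w => hC' _),
    hF.calculus_inl hf hC, hF.calculus_inr hg hC', tensorOp_mul, one_mul, mul_one]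

theorem IsProductPVM.calculus_expFun (hF : IsProductPVM E₁ E₂ F) (p : ι ⊕ ι → ℝ) :
    F.calculus (expFun p) =
      tensorOp (E₁.calculus (expFun (p ∘ Sum.inl))) (E₂.calculus (expFun (p ∘ Sum.inr))) := by
  rw [← hF.calculus_mul (measurable_expFun _) (norm_expFun_le _) (measurable_expFun _)
    (norm_expFun_le _)]
  exact congrArg _ (funext (expFun_sum p))

/-- With a simple function in place of the second variable, the exponential of the bilinear form
`x·y` becomes a finite sum of products of functions of one variable, to which the product formula
applies. -/
theorem IsProductPVM.calculus_expFun_simpleFunc (hF : IsProductPVM E₁ E₂ F)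
    (σ : SimpleFunc (ι → ℝ) (ι → ℝ)) (ψ : H) (φ : K) :
    F.calculus (fun w => expFun (-σ (w ∘ Sum.inr)) (w ∘ Sum.inl)) (tmulVec ψ φ) =
      ∑ r ∈ σ.range, tmulVec (E₁.calculus (expFun (-r)) ψ) (E₂.proj (σ ⁻¹' {r}) φ) := by
  have hi : ∀ r x, ‖(σ ⁻¹' {r}).indicator (fun _ => (1 : ℂ)) x‖ ≤ 1 := fun r x => by
    by_cases hx : x ∈ σ ⁻¹' {r} <;> simp [Set.indicator, hx]
  have hm : ∀ r, Measurable ((σ ⁻¹' {r}).indicator fun _ => (1 : ℂ)) := fun r =>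
    measurable_const.indicator (σ.measurableSet_fiber r)
  have h : (fun w : ι ⊕ ι → ℝ => expFun (-σ (w ∘ Sum.inr)) (w ∘ Sum.inl)) = fun w =>
      ∑ r ∈ σ.range, expFun (-r) (w ∘ Sum.inl) *
        (σ ⁻¹' {r}).indicator (fun _ => (1 : ℂ)) (w ∘ Sum.inr) := by
    ext w
    rw [Finset.sum_eq_single (σ (w ∘ Sum.inr))]
    · simp
    · intro r _ hr
      have : w ∘ Sum.inr ∉ σ ⁻¹' {r} := fun h => hr h.symm
      rw [Set.indicator_of_notMem this, mul_zero]
    · exact fun h => (h (σ.mem_range_self _)).elim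
  rw [h, F.calculus_finsetSum (f := fun r w => expFun (-r) (w ∘ Sum.inl) *
        (σ ⁻¹' {r}).indicator (fun _ => (1 : ℂ)) (w ∘ Sum.inr)) (C := 1) _
      (fun r => ((measurable_expFun _).comp measurable_comp_inl).mul
        ((hm r).comp measurable_comp_inr))
      (fun r w => by
        rw [norm_mul, norm_expFun, one_mul]
        exact hi r _), sum_apply]
  refine Finset.sum_congr rfl fun r _ => ?_
  rw [hF.calculus_mul (measurable_expFun _) (norm_expFun_le _) (hm r) (hi r),
    E₂.calculus_indicator (σ.measurableSet_fiber r), tensorOp_tmulVec]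

/-- Simple functions converging to the identity of `ℝ^ι`. -/
def idApprox (n : ℕ) : SimpleFunc (ι → ℝ) (ι → ℝ) :=
  SimpleFunc.approxOn (fun s => s) measurable_id Set.univ 0 trivial n

theorem tendsto_idApprox (s : ι → ℝ) : Tendsto (fun n => idApprox n s) atTop (𝓝 s) :=
  SimpleFunc.tendsto_approxOn _ _ (by simp)

theorem norm_idApprox_le (n : ℕ) (s : ι → ℝ) : ‖idApprox n s‖ ≤ ‖s‖ + ‖s‖ :=
  SimpleFunc.norm_approxOn_zero_le _ _ s n

end Product

/-! ### The unitaries generated by `X`, by `Y` and by `X ⊗ Y` -/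

section Unitaries

variable {ι : Type*} [Fintype ι] {H K : Type*} [NormedAddCommGroup H] [InnerProductSpace ℂ H]
  [CompleteSpace H] [NormedAddCommGroup K] [InnerProductSpace ℂ K] [CompleteSpace K]
  (X : ι → H →ₗ.[ℂ] H) (Y : ι → K →ₗ.[ℂ] K)

theorem isProductPVM_tensorSpectralMeasure :
    IsProductPVM (jointSpectralMeasure X) (jointSpectralMeasure Y) (tensorSpectralMeasure X Y) :=
  Classical.epsilon_spec (exists_isProductPVM _ _)

theorem expI_zero : expI X 0 = 1 := PVM.calculus_expFun_zero _

theorem expI_add (y z : ι → ℝ) : expI X (y + z) = expI X y * expI X z :=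
  PVM.calculus_expFun_add _ y z

theorem star_expI (y : ι → ℝ) : star (expI X y) = expI X (-y) := PVM.star_calculus_expFun _ y

theorem continuous_expI (ψ : H) : Continuous fun y => expI X y ψ :=
  PVM.continuous_calculus_expFun _ ψ

theorem expI_neg_mul (y : ι → ℝ) : expI X (-y) * expI X y = 1 := by
  rw [← expI_add, neg_add_cancel, expI_zero]

theorem expI_mul_neg (y : ι → ℝ) : expI X y * expI X (-y) = 1 := by
  rw [← expI_add, add_neg_cancel, expI_zero]

theorem inner_expI_right (y : ι → ℝ) (ψ φ : H) :
    ⟪ψ, expI X y φ⟫_ℂ = ⟪expI X (-y) ψ, φ⟫_ℂ := by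
  rw [← star_expI, ContinuousLinearMap.star_eq_adjoint, ContinuousLinearMap.adjoint_inner_left]

theorem norm_expI_apply (y : ι → ℝ) (ψ : H) : ‖expI X y ψ‖ = ‖ψ‖ := by
  have h : ⟪expI X y ψ, expI X y ψ⟫_ℂ = ⟪ψ, ψ⟫_ℂ := by
    rw [inner_expI_right, ← mul_apply_eq_comp, expI_neg_mul]; rfl
  rw [inner_self_eq_norm_sq_to_K, inner_self_eq_norm_sq_to_K] at h
  have h2 : ‖expI X y ψ‖ ^ 2 = ‖ψ‖ ^ 2 := by exact_mod_cast h
  exact (pow_left_inj₀ (norm_nonneg _) (norm_nonneg _) two_ne_zero).1 h2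

theorem inverse_rep (w : ι ⊕ ι → ℝ) : Ring.inverse (rep X Y w) = rep X Y (-w) := by
  have h1 : rep X Y w * rep X Y (-w) = 1 := by
    rw [rep, rep, tensorOp_mul]
    simp only [Pi.neg_comp, neg_neg]
    rw [expI_neg_mul, expI_mul_neg, tensorOp_one]
  have h2 : rep X Y (-w) * rep X Y w = 1 := by
    rw [rep, rep, tensorOp_mul]
    simp only [Pi.neg_comp, neg_neg]
    rw [expI_mul_neg, expI_neg_mul, tensorOp_one]
  exact Ring.inverse_unit (⟨_, _, h1, h2⟩ : (HilbertTensor H K →L[ℂ] HilbertTensor H K)ˣ)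

theorem expTensor_eq (t : ℝ) : expTensor X Y t =
    (tensorSpectralMeasure X Y).calculus fun w => expFun (t • (w ∘ Sum.inr)) (w ∘ Sum.inl) := by
  rw [expTensor]
  refine congrArg _ (funext fun w => ?_)
  rw [expFun, smul_dotProduct, smul_eq_mul, dotProduct]
  simp only [Function.comp_apply, mul_comm]

theorem continuous_expFun_inr_inl (t : ℝ) :
    Continuous fun w : ι ⊕ ι → ℝ => expFun (t • (w ∘ Sum.inr)) (w ∘ Sum.inl) := by
  unfold expFun dotProduct
  simp only [Pi.smul_apply, Function.comp_apply]
  fun_prop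

theorem star_expTensor (t : ℝ) : star (expTensor X Y t) = expTensor X Y (-t) := by
  rw [expTensor_eq, expTensor_eq, ← PVM.calculus_star _ (continuous_expFun_inr_inl t).measurable
    fun w => norm_expFun_le _ _]
  refine congrArg _ (funext fun w => ?_)
  rw [star_expFun, neg_smul]

theorem inner_expTensor_right (t : ℝ) (Ψ Φ : HilbertTensor H K) :
    ⟪Ψ, expTensor X Y t Φ⟫_ℂ = ⟪expTensor X Y (-t) Ψ, Φ⟫_ℂ := by
  rw [← star_expTensor, ContinuousLinearMap.star_eq_adjoint, ContinuousLinearMap.adjoint_inner_left]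

theorem measurable_expFun_simpleFunc (σ : SimpleFunc (ι → ℝ) (ι → ℝ)) :
    Measurable fun w : ι ⊕ ι → ℝ => expFun (-σ (w ∘ Sum.inr)) (w ∘ Sum.inl) := by
  unfold expFun
  have h : Measurable fun w : ι ⊕ ι → ℝ => σ (w ∘ Sum.inr) :=
    σ.measurable.comp measurable_comp_inr
  simp only [dotProduct, Function.comp_apply, Pi.neg_apply]
  refine Complex.measurable_exp.comp ((Complex.measurable_ofReal.comp ?_).const_mul _)
  exact Finset.measurable_sum _ fun i _ => ((measurable_pi_iff.1 h i).neg).mul (by fun_prop)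

theorem tendsto_expFun_idApprox (w : ι ⊕ ι → ℝ) :
    Tendsto (fun n => expFun (-idApprox n (w ∘ Sum.inr)) (w ∘ Sum.inl)) atTop
      (𝓝 (expFun ((-1 : ℝ) • (w ∘ Sum.inr)) (w ∘ Sum.inl))) := by
  have hc : Continuous fun s : ι → ℝ => expFun (-s) (w ∘ Sum.inl) :=
    continuous_uncurry_expFun.comp (continuous_neg.prodMk continuous_const)
  rw [neg_one_smul]
  exact (hc.tendsto _).comp (tendsto_idApprox _)

/-- The approximants are finite sums of product vectors, so `A ⊗ 1` can be evaluated on them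
directly when the orbit of `ψ` stays in the domain of `A`. -/
theorem tendsto_expTensor_neg_one (ψ : H) (φ : K) :
    Tendsto (fun n => ∑ r ∈ (idApprox n).range,
        tmulVec (expI X (-r) ψ) ((jointSpectralMeasure Y).proj (idApprox n ⁻¹' {r}) φ))
      atTop (𝓝 (expTensor X Y (-1) (tmulVec ψ φ))) := by
  have h := (tensorSpectralMeasure X Y).tendsto_calculus
    (fun n => measurable_expFun_simpleFunc (idApprox n))
    (continuous_expFun_inr_inl (-1)).measurable (fun n w => norm_expFun_le _ _)
    tendsto_expFun_idApprox (tmulVec ψ φ)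
  rw [expTensor_eq]
  refine h.congr fun n => ?_
  exact (isProductPVM_tensorSpectralMeasure X Y).calculus_expFun_simpleFunc (idApprox n) ψ φ

end Unitaries

/-! ### Closed graphs and weak limits -/

section Weak

variable {H G : Type*} [NormedAddCommGroup H] [InnerProductSpace ℂ H] [CompleteSpace H]
  [NormedAddCommGroup G] [InnerProductSpace ℂ G] [CompleteSpace G]

/-- A closed subspace is weakly closed, by Hahn–Banach. The product `H × G` carries the sup norm and
is no inner product space, so a functional is represented by a pair of vectors, one for each factor.
-/
theorem mem_topologicalClosure_of_forall_inner {S : Submodule ℂ (H × G)} {p : H × G}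
    (h : ∀ (a : H) (b : G), (∀ q ∈ S, ⟪a, q.1⟫_ℂ + ⟪b, q.2⟫_ℂ = 0) →
      ⟪a, p.1⟫_ℂ + ⟪b, p.2⟫_ℂ = 0) : p ∈ S.topologicalClosure := by
  by_contra hp
  have hconv : Convex ℝ (S.topologicalClosure : Set (H × G)) :=
    (S.topologicalClosure.restrictScalars ℝ).convex
  obtain ⟨f, u, hpu, hu⟩ := RCLike.geometric_hahn_banach_point_closed (𝕜 := ℂ) hconv
    S.isClosed_topologicalClosure hp
  -- A functional whose real part is bounded below by `u` on a subspace vanishes there; otherwise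
  -- scaling `b` would produce the value `u - 1`.
  have hf : ∀ b ∈ S, f b = 0 := fun b hb => by
    by_contra hne
    have h1 := hu _ (S.topologicalClosure.smul_mem (((u - 1 : ℝ) : ℂ) / f b)
      (S.le_topologicalClosure hb))
    rw [map_smul, smul_eq_mul, div_mul_cancel₀ _ hne] at h1
    simp at h1
    linarith
  have hu0 : u < 0 := by simpa using hu 0 S.topologicalClosure.zero_mem
  have key : ∀ q : H × G, ⟪(InnerProductSpace.toDual ℂ H).symm
        (f ∘L ContinuousLinearMap.inl ℂ H G), q.1⟫_ℂ +
      ⟪(InnerProductSpace.toDual ℂ G).symm (f ∘L ContinuousLinearMap.inr ℂ H G), q.2⟫_ℂ = f q := by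
    intro q
    rw [InnerProductSpace.toDual_symm_apply, InnerProductSpace.toDual_symm_apply,
      ContinuousLinearMap.comp_apply, ContinuousLinearMap.comp_apply, ← map_add]
    simp
  have h2 := h _ _ fun q hq => (key q).trans (hf q hq)
  rw [key p] at h2
  rw [h2] at hpu
  simp at hpu
  linarith

/-- Bounded sets are weakly compact, so a limit exists along an ultrafilter. The pair of limits is
in the closed subspace because that is weakly closed. Any scalar limit of `⟪w n, Ξ n⟫` along the
full sequence agrees with the ultrafilter limit and hence identifies the matrix element. -/
theorem exists_weak_limit {S : Submodule ℂ (H × G)} {z : ℕ → H} {z₀ : H} {Ξ : ℕ → G} {C : ℝ}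
    (hz : Tendsto z atTop (𝓝 z₀)) (hC : ∀ n, ‖Ξ n‖ ≤ C) (hS : ∀ n, (z n, Ξ n) ∈ S) :
    ∃ Ξ₀, (z₀, Ξ₀) ∈ S.topologicalClosure ∧ ∀ (w : ℕ → G) (w₀ : G) (L : ℂ),
      Tendsto w atTop (𝓝 w₀) → Tendsto (fun n => ⟪w n, Ξ n⟫_ℂ) atTop (𝓝 L) → ⟪w₀, Ξ₀⟫_ℂ = L := by
  let U : Ultrafilter ℕ := hyperfilter ℕ
  have hU : (U : Filter ℕ) ≤ atTop := Nat.hyperfilter_le_atTop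
  let g : ℕ → WeakDual ℂ G := fun n => StrongDual.toWeakDual (innerSL ℂ (Ξ n))
  have hmem : (U.map g : Filter (WeakDual ℂ G)) ≤ 𝓟 (WeakDual.toStrongDual ⁻¹'
      Metric.closedBall (0 : StrongDual ℂ G) C) := by
    rw [le_principal_iff, Ultrafilter.coe_map, mem_map]
    refine Eventually.of_forall fun n => ?_
    change innerSL ℂ (Ξ n) ∈ Metric.closedBall (0 : StrongDual ℂ G) C
    rw [mem_closedBall_zero_iff, innerSL_apply_norm]
    exact hC n
  obtain ⟨l, -, hl⟩ := (WeakDual.isCompact_closedBall (𝕜 := ℂ) (0 : StrongDual ℂ G)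
    C).ultrafilter_le_nhds (U.map g) hmem
  let Ξ₀ : G := (InnerProductSpace.toDual ℂ G).symm (WeakDual.toStrongDual l)
  have hev : ∀ x : G, Tendsto (fun n => ⟪x, Ξ n⟫_ℂ) U (𝓝 ⟪x, Ξ₀⟫_ℂ) := fun x => by
    have h1 : Tendsto g U (𝓝 l) := hl
    have h2 := ((WeakDual.eval_continuous x).tendsto l).comp h1
    have h3 : l x = ⟪Ξ₀, x⟫_ℂ := (InnerProductSpace.toDual_symm_apply (𝕜 := ℂ)).symm
    rw [h3] at h2
    have h4 := (Complex.continuous_conj.tendsto _).comp h2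
    rw [inner_conj_symm] at h4
    refine h4.congr fun n => ?_
    exact inner_conj_symm _ _
  -- Norm convergence of the test vectors and boundedness of `Ξ` allow the test vector to move.
  have hev' : ∀ (w : ℕ → G) (w₀ : G), Tendsto w atTop (𝓝 w₀) →
      Tendsto (fun n => ⟪w n, Ξ n⟫_ℂ) U (𝓝 ⟪w₀, Ξ₀⟫_ℂ) := fun w w₀ hw => by
    have h0 : Tendsto (fun n => ⟪w n - w₀, Ξ n⟫_ℂ) U (𝓝 0) := by
      refine squeeze_zero_norm (a := fun n => ‖w n - w₀‖ * C) (fun n => ?_) ?_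
      · exact (norm_inner_le_norm _ _).trans (mul_le_mul_of_nonneg_left (hC n) (norm_nonneg _))
      · have := (tendsto_iff_norm_sub_tendsto_zero.1 hw).mul_const C
        rw [zero_mul] at this
        exact this.mono_left hU
    have h1 := h0.add (hev w₀)
    rw [zero_add] at h1
    refine h1.congr fun n => ?_
    rw [← inner_add_left, sub_add_cancel]
  refine ⟨Ξ₀, mem_topologicalClosure_of_forall_inner fun a b hab => ?_, fun w w₀ L hw hL => ?_⟩
  · have h1 : Tendsto (fun n => ⟪a, z n⟫_ℂ + ⟪b, Ξ n⟫_ℂ) U (𝓝 (⟪a, z₀⟫_ℂ + ⟪b, Ξ₀⟫_ℂ)) :=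
      ((tendsto_const_nhds.inner hz).mono_left hU).add (hev b)
    refine tendsto_nhds_unique h1 (tendsto_const_nhds.congr fun n => ?_)
    exact (hab _ (hS n)).symm
  · exact tendsto_nhds_unique (hev' w w₀ hw) (hL.mono_left hU)

theorem continuous_inner_of_dense {P : Type*} [TopologicalSpace P] {S : Set H} (hS : Dense S)
    {f b : P → H} {C : P → ℝ} (hb : ∀ ξ ∈ S, Continuous fun p => ⟪ξ, b p⟫_ℂ) (hf : Continuous f)
    (hC : Continuous C) (hbC : ∀ p, ‖b p‖ ≤ C p) : Continuous fun p => ⟪f p, b p⟫_ℂ := by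
  rw [continuous_iff_continuousAt]
  intro p₀
  rw [ContinuousAt, Metric.tendsto_nhds]
  intro ε hε
  have hC0 : 0 ≤ C p₀ := (norm_nonneg _).trans (hbC p₀)
  -- The approximation of `f p₀` by `ξ` enters twice, each time multiplied by a norm bound tending
  -- to at most `C p₀`; the extra `2` covers `C p₀ = 0`.
  obtain ⟨ξ, hξS, hξ⟩ := Metric.mem_closure_iff.1 (hS (f p₀)) (ε / (2 * C p₀ + 2)) (by positivity)
  rw [dist_eq_norm] at hξ
  have hlim : Tendsto (fun p => ‖f p - f p₀‖ * C p + ‖f p₀ - ξ‖ * C p +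
      ‖⟪ξ, b p⟫_ℂ - ⟪ξ, b p₀⟫_ℂ‖ + ‖f p₀ - ξ‖ * C p₀) (𝓝 p₀) (𝓝 (‖f p₀ - f p₀‖ * C p₀ +
        ‖f p₀ - ξ‖ * C p₀ + ‖⟪ξ, b p₀⟫_ℂ - ⟪ξ, b p₀⟫_ℂ‖ + ‖f p₀ - ξ‖ * C p₀)) := by
    have := hb ξ hξS
    exact Continuous.tendsto (by fun_prop) p₀
  have hlt : ‖f p₀ - f p₀‖ * C p₀ + ‖f p₀ - ξ‖ * C p₀ + ‖⟪ξ, b p₀⟫_ℂ - ⟪ξ, b p₀⟫_ℂ‖ +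
      ‖f p₀ - ξ‖ * C p₀ < ε := by
    rw [sub_self, sub_self, norm_zero, norm_zero]
    rw [lt_div_iff₀ (by positivity)] at hξ
    nlinarith [norm_nonneg (f p₀ - ξ)]
  filter_upwards [hlim.eventually_lt_const hlt] with p hp
  refine lt_of_le_of_lt ?_ hp
  rw [dist_eq_norm]
  have e : ⟪f p, b p⟫_ℂ - ⟪f p₀, b p₀⟫_ℂ = ⟪f p - f p₀, b p⟫_ℂ + ⟪f p₀ - ξ, b p⟫_ℂ +
      (⟪ξ, b p⟫_ℂ - ⟪ξ, b p₀⟫_ℂ) - ⟪f p₀ - ξ, b p₀⟫_ℂ := by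
    simp only [inner_sub_left]
    ring
  rw [e]
  refine (norm_sub_le _ _).trans (add_le_add ((norm_add_le _ _).trans (add_le_add_left
    ((norm_add_le _ _).trans (add_le_add ?_ ?_)) _)) ?_)
  · exact (norm_inner_le_norm _ _).trans (mul_le_mul_of_nonneg_left (hbC p) (norm_nonneg _))
  · exact (norm_inner_le_norm _ _).trans (mul_le_mul_of_nonneg_left (hbC p) (norm_nonneg _))
  · exact (norm_inner_le_norm _ _).trans (mul_le_mul_of_nonneg_left (hbC p₀) (norm_nonneg _))

end Weak

/-! ### The operator `A ⊗ 1` -/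

section TensorOne

variable {H K : Type*} [NormedAddCommGroup H] [InnerProductSpace ℂ H] [CompleteSpace H]
  [NormedAddCommGroup K] [InnerProductSpace ℂ K] [CompleteSpace K]

theorem valueAt_of_mem {A : H →ₗ.[ℂ] H} {x : H} (h : x ∈ A.domain) : valueAt A x = A ⟨x, h⟩ :=
  dif_pos h

theorem valueAt_sandwich {A : H →ₗ.[ℂ] H} {S R : H →L[ℂ] H} {x : H} (h : R x ∈ A.domain) :
    valueAt (sandwich S A R) x = S (valueAt A (R x)) := by
  rw [valueAt_of_mem h, valueAt_of_mem (A := sandwich S A R) h]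
  rfl

/-- The domain of the adjoint of `A`, as a set. -/
def adjointDom (A : H →ₗ.[ℂ] H) : Set H := {ξ | ∃ η, ∀ x : A.domain, ⟪η, (x : H)⟫_ℂ = ⟪ξ, A x⟫_ℂ}

/-- If `v` is orthogonal to this set, then every pair orthogonal to the graph of `A` is orthogonal
to `(0, v)`, so `(0, v)` lies in the closed graph. Closability forces `v = 0`. -/
theorem dense_adjointDom {A : H →ₗ.[ℂ] H} (hA : A.IsClosable) : Dense (adjointDom A) := by
  let M : Submodule ℂ H :=
    { carrier := adjointDom A
      zero_mem' := ⟨0, fun x => by simp⟩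
      add_mem' := by
        rintro a b ⟨η, hη⟩ ⟨η', hη'⟩
        exact ⟨η + η', fun x => by rw [inner_add_left, inner_add_left, hη, hη']⟩
      smul_mem' := by
        rintro c a ⟨η, hη⟩
        exact ⟨c • η, fun x => by rw [inner_smul_left, inner_smul_left, hη]⟩ }
  have hM : Mᗮ = ⊥ := by
    rw [Submodule.eq_bot_iff]
    intro v hv
    have hmem : ((0 : H), v) ∈ A.graph.topologicalClosure := by
      refine mem_topologicalClosure_of_forall_inner fun a b hab => ?_
      have hb : b ∈ M := ⟨-a, fun x => by
        have := hab _ (A.mem_graph x)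
        rw [inner_neg_left]
        exact neg_eq_of_add_eq_zero_right this⟩
      rw [inner_zero_right, zero_add]
      exact Submodule.inner_right_of_mem_orthogonal hb hv
    obtain ⟨B, hB⟩ := hA
    rw [hB] at hmem
    exact B.graph_fst_eq_zero_snd hmem rfl
  rw [← Submodule.topologicalClosure_eq_top_iff] at hM
  intro v
  have : v ∈ M.topologicalClosure := hM ▸ trivial
  exact this

/-- Paired with a vector of the adjoint domain, `A` moves to the other side and continuity of `v`
suffices. Such vectors are dense, and the continuous bound `C` controls the error of approximation.
-/
theorem continuous_inner_valueAt {A : H →ₗ.[ℂ] H} (hA : A.IsClosable) {P : Type*}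
    [TopologicalSpace P] {f v : P → H} {C : P → ℝ} (hv : Continuous v)
    (hvA : ∀ p, v p ∈ A.domain) (hf : Continuous f) (hC : Continuous C)
    (hvC : ∀ p, ‖valueAt A (v p)‖ ≤ C p) : Continuous fun p => ⟪f p, valueAt A (v p)⟫_ℂ := by
  refine continuous_inner_of_dense (dense_adjointDom hA) ?_ hf hC hvC
  rintro ξ ⟨η, hη⟩
  have : (fun p => ⟪ξ, valueAt A (v p)⟫_ℂ) = fun p => ⟪η, v p⟫_ℂ := by
    ext p
    rw [valueAt_of_mem (hvA p), ← hη]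
  rw [this]
  fun_prop

/-- The graph of `ψ ⊗ φ ↦ A ψ ⊗ φ` on `D_A ⊙ K`. -/
def tensorOneGraph (K : Type*) [NormedAddCommGroup K] [InnerProductSpace ℂ K] [CompleteSpace K]
    (A : H →ₗ.[ℂ] H) : Submodule ℂ (HilbertTensor H K × HilbertTensor H K) :=
  Submodule.span ℂ {p : HilbertTensor H K × HilbertTensor H K |
    ∃ (ψ : A.domain) (φ : K), p = (tmulVec (ψ : H) φ, tmulVec (A ψ) φ)}

theorem mem_tensorOneGraph {A : H →ₗ.[ℂ] H} {ψ : H} (hψ : ψ ∈ A.domain) (φ : K) :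
    (tmulVec ψ φ, tmulVec (valueAt A ψ) φ) ∈ tensorOneGraph K A := by
  rw [valueAt_of_mem hψ]
  exact Submodule.subset_span ⟨⟨ψ, hψ⟩, φ, rfl⟩

/-- For `ξ` in the adjoint domain, `ξ ⊗ κ` is in the adjoint domain of `A ⊙ 1`, a relation that
survives the closure. These vectors are total, so the closure of the graph is single valued and
`tensorOne A` really has it as its graph. -/
theorem eq_zero_of_mem_closure_tensorOneGraph {A : H →ₗ.[ℂ] H} (hA : A.IsClosable)
    (p : HilbertTensor H K × HilbertTensor H K) (hp : p ∈ (tensorOneGraph K A).topologicalClosure)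
    (hp1 : p.1 = 0) : p.2 = 0 := by
  have key : ∀ (ξ η : H) (κ : K), (∀ x : A.domain, ⟪η, (x : H)⟫_ℂ = ⟪ξ, A x⟫_ℂ) →
      ∀ q ∈ (tensorOneGraph K A).topologicalClosure, ⟪tmulVec η κ, q.1⟫_ℂ = ⟪tmulVec ξ κ, q.2⟫_ℂ := by
    intro ξ η κ h q hq
    refine closure_minimal (s := (tensorOneGraph K A : Set (HilbertTensor H K × HilbertTensor H K)))
      (t := {q | ⟪tmulVec η κ, q.1⟫_ℂ = ⟪tmulVec ξ κ, q.2⟫_ℂ}) (fun q hq => ?_)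
      (isClosed_eq (by fun_prop) (by fun_prop)) hq
    change ⟪tmulVec η κ, q.1⟫_ℂ = ⟪tmulVec ξ κ, q.2⟫_ℂ
    refine Submodule.span_induction ?_ ?_ ?_ ?_ hq
    · rintro _ ⟨ψ, φ, rfl⟩
      rw [inner_tmulVec, inner_tmulVec, h]
    · simp
    · intro a b _ _ ha hb
      rw [Prod.fst_add, Prod.snd_add, inner_add_right, inner_add_right, ha, hb]
    · intro c a _ ha
      rw [Prod.smul_fst, Prod.smul_snd, inner_smul_right, inner_smul_right, ha]
  have h0 : ∀ ξ κ, ⟪p.2, tmulVec ξ κ⟫_ℂ = 0 := by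
    intro ξ κ
    refine (dense_adjointDom hA).induction (P := fun ξ => ⟪p.2, tmulVec ξ κ⟫_ℂ = 0) ?_
      (isClosed_eq (continuous_const.inner (tmulLeft κ).continuous) continuous_const) ξ
    rintro ξ ⟨η, hη⟩
    have := key ξ η κ hη p hp
    rw [hp1, inner_zero_right] at this
    rw [← inner_conj_symm, ← this, map_zero]
  exact eq_zero_of_inner_tmulVec h0

theorem tensorOne_graph {A : H →ₗ.[ℂ] H} (hA : A.IsClosable) :
    (tensorOne A : HilbertTensor H K →ₗ.[ℂ] HilbertTensor H K).graph =
      (tensorOneGraph K A).topologicalClosure :=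
  Submodule.toLinearPMap_graph_eq _ (eq_zero_of_mem_closure_tensorOneGraph hA)

theorem mem_domain_tensorOne {A : H →ₗ.[ℂ] H} (hA : A.IsClosable) {x y : HilbertTensor H K}
    (h : (x, y) ∈ (tensorOneGraph K A).topologicalClosure) : x ∈ (tensorOne A).domain := by
  rw [← tensorOne_graph hA] at h
  exact LinearPMap.mem_domain_of_mem_graph h

theorem valueAt_tensorOne {A : H →ₗ.[ℂ] H} (hA : A.IsClosable) {x y : HilbertTensor H K}
    (h : (x, y) ∈ (tensorOneGraph K A).topologicalClosure) : valueAt (tensorOne A) x = y := by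
  have hx := mem_domain_tensorOne hA h
  rw [← tensorOne_graph hA] at h
  rw [valueAt_of_mem hx]
  exact (LinearPMap.image_iff hx).2 h |>.symm

theorem tmulVec_mem_domain_tensorOne {A : H →ₗ.[ℂ] H} (hA : A.IsClosable) {ψ : H}
    (hψ : ψ ∈ A.domain) (φ : K) : tmulVec ψ φ ∈ (tensorOne A).domain :=
  mem_domain_tensorOne hA ((tensorOneGraph K A).le_topologicalClosure (mem_tensorOneGraph hψ φ))

theorem valueAt_tensorOne_tmulVec {A : H →ₗ.[ℂ] H} (hA : A.IsClosable) {ψ : H}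
    (hψ : ψ ∈ A.domain) (φ : K) :
    valueAt (tensorOne A) (tmulVec ψ φ) = tmulVec (valueAt A ψ) φ :=
  valueAt_tensorOne hA ((tensorOneGraph K A).le_topologicalClosure (mem_tensorOneGraph hψ φ))

end TensorOne

/-! ### The support of a spectral measure -/

namespace PVM

section Support

variable {Ω : Type*} [TopologicalSpace Ω] [SecondCountableTopology Ω] [MeasurableSpace Ω]
  [OpensMeasurableSpace Ω] {H : Type*} [NormedAddCommGroup H] [InnerProductSpace ℂ H]
  [CompleteSpace H] (E : PVM Ω H)

theorem compl_support : E.supportᶜ = ⋃₀ {O | IsOpen O ∧ E.proj O = 0} := by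
  ext a
  simp only [support, Set.mem_compl_iff, Set.mem_ofPred_eq, Set.mem_sUnion]
  push Not
  exact ⟨fun ⟨O, h1, h2, h3⟩ => ⟨O, ⟨h1, h3⟩, h2⟩, fun ⟨O, ⟨h1, h3⟩, h2⟩ => ⟨O, h1, h2, h3⟩⟩

theorem measurableSet_support : MeasurableSet E.support := by
  refine MeasurableSet.of_compl ?_
  rw [compl_support]
  exact (isOpen_sUnion fun O h => h.1).measurableSet

/-- By second countability the complement of the support is a countable union of open sets with zero
projection. -/
theorem meas_compl_support (φ : H) : E.meas φ E.supportᶜ = 0 := by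
  obtain ⟨T, hT, hTs, hTu⟩ := TopologicalSpace.isOpen_sUnion_countable
    {O | IsOpen O ∧ E.proj O = 0} fun O h => h.1
  rw [compl_support, ← hTu, measure_sUnion_null_iff hT]
  intro O hO
  rw [meas_apply _ _ (hTs hO).1.measurableSet, (hTs hO).2]
  simp

theorem proj_inter_support {B : Set Ω} (hB : MeasurableSet B) (φ : H) :
    E.proj (B ∩ E.support) φ = E.proj B φ := by
  have h : E.proj E.supportᶜ φ = 0 := by
    have := E.meas_real_apply φ E.measurableSet_support.compl
    rw [measureReal_def, E.meas_compl_support, ENNReal.toReal_zero] at this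
    simpa using this.symm
  have h2 := congrArg (E.proj B) (E.proj_add_proj_compl E.measurableSet_support φ)
  rw [map_add, h, map_zero, add_zero, E.proj_proj hB E.measurableSet_support] at h2
  exact h2

theorem matrixElement_restrict_support (φ ψ : H) :
    (E.matrixElement φ ψ).restrict E.support = E.matrixElement φ ψ := by
  ext B hB
  rw [VectorMeasure.restrict_apply _ E.measurableSet_support hB]
  change ⟪φ, E.proj (B ∩ E.support) ψ⟫_ℂ = ⟪φ, E.proj B ψ⟫_ℂ
  rw [E.proj_inter_support hB]

end Support

/-! ### Vector-valued integrals of simple functions -/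

section SimpleTensor

variable {Ω α : Type*} [MeasurableSpace Ω] {H K : Type*} [NormedAddCommGroup H]
  [InnerProductSpace ℂ H] [CompleteSpace H] [NormedAddCommGroup K] [InnerProductSpace ℂ K]
  [CompleteSpace K] (E : PVM Ω K)

theorem cyc_comp_simpleFunc (φ : K) (σ : SimpleFunc Ω α) (c : α → ℂ) :
    E.cyc φ (fun y => c (σ y)) = ∑ r ∈ σ.range, c r • E.proj (σ ⁻¹' {r}) φ := by
  classical
  have h : (fun y => c (σ y)) = ∑ r ∈ σ.range, (σ ⁻¹' {r}).indicator fun _ => c r := by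
    ext y
    rw [Finset.sum_apply, Finset.sum_eq_single (σ y)]
    · simp
    · intro r _ hr
      simp [Set.indicator, hr.symm]
    · intro h
      exact (h (σ.mem_range_self y)).elim
  rw [h, cyc_finsetSum _ _ fun r _ => memLp_indicator _ (σ.measurableSet_fiber r) (c r)]
  exact Finset.sum_congr rfl fun r _ => E.cyc_indicator φ (σ.measurableSet_fiber r) (c r)

/-- The vector `∫ a(σ(y)) ⊗ dE(y) φ` for a simple function `σ`. -/
def simpleTensor (σ : SimpleFunc Ω α) (a : α → H) (φ : K) : HilbertTensor H K :=
  ∑ r ∈ σ.range, tmulVec (a r) (E.proj (σ ⁻¹' {r}) φ)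

/-- Different fibres of `σ` have orthogonal projections, so the double sum collapses to its
diagonal, and the inner product is one spectral integral. -/
theorem inner_simpleTensor (σ : SimpleFunc Ω α) (a b : α → H) (φ φ' : K) :
    ⟪E.simpleTensor σ a φ, E.simpleTensor σ b φ'⟫_ℂ =
      ⟪φ, E.cyc φ' fun y => ⟪a (σ y), b (σ y)⟫_ℂ⟫_ℂ := by
  rw [E.cyc_comp_simpleFunc φ' σ fun r => ⟪a r, b r⟫_ℂ, simpleTensor, simpleTensor, sum_inner,
    inner_sum]
  refine Finset.sum_congr rfl fun r hr => ?_
  rw [inner_sum, Finset.sum_eq_single r, inner_tmulVec,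
    E.inner_proj_proj (σ.measurableSet_fiber r) (σ.measurableSet_fiber r), Set.inter_self,
    inner_smul_right]
  · intro s _ hs
    have : σ ⁻¹' {r} ∩ σ ⁻¹' {s} = ∅ := by
      ext y
      simp only [Set.mem_inter_iff, Set.mem_preimage, Set.mem_singleton_iff, Set.mem_empty_iff_false,
        iff_false, not_and]
      exact fun h1 h2 => hs (h2.symm.trans h1)
    rw [inner_tmulVec, E.inner_proj_proj (σ.measurableSet_fiber r) (σ.measurableSet_fiber s), this,
      E.proj_empty]
    simp
  · exact fun h => (h hr).elim

theorem norm_simpleTensor_sq_le (σ : SimpleFunc Ω α) (a : α → H) {φ : K} {b : Ω → ℝ}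
    (hb : MemLp b 2 (E.meas φ)) (h : ∀ y, ‖a (σ y)‖ ≤ b y) :
    ‖E.simpleTensor σ a φ‖ ^ 2 ≤ ∫ y, b y ^ 2 ∂E.meas φ := by
  have hm : MemLp (fun y => ⟪a (σ y), a (σ y)⟫_ℂ) 2 (E.meas φ) :=
    (σ.map fun r => ⟪a r, a r⟫_ℂ).memLp_of_isFiniteMeasure 2 _
  have h1 := E.inner_simpleTensor σ a a φ φ
  have h2 := E.inner_cyc (φ := φ) (memLp_const 1) hm
  rw [cyc_one] at h2
  rw [h2, inner_self_eq_norm_sq_to_K] at h1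
  have h3 : ∀ y, ⟪a (σ y), a (σ y)⟫_ℂ * star (1 : ℂ) = ((‖a (σ y)‖ ^ 2 : ℝ) : ℂ) := fun y => by
    rw [inner_self_eq_norm_sq_to_K]
    simp
  simp_rw [h3] at h1
  rw [integral_complex_ofReal] at h1
  have h4 : ‖E.simpleTensor σ a φ‖ ^ 2 = ∫ y, ‖a (σ y)‖ ^ 2 ∂E.meas φ :=
    Complex.ofReal_injective (by rw [← h1, Complex.ofReal_pow]; rfl)
  rw [h4]
  refine integral_mono_of_nonneg (Eventually.of_forall fun y => by positivity) hb.integrable_sq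
    (Eventually.of_forall fun y => ?_)
  exact pow_le_pow_left₀ (norm_nonneg _) (h y) 2

end SimpleTensor

end PVM

/-! ### Conjugation of `A ⊗ 1` by `e^{i X⊗Y}` -/

section Conjugation

variable {ι : Type*} [Fintype ι] {H K : Type*} [NormedAddCommGroup H] [InnerProductSpace ℂ H]
  [CompleteSpace H] [NormedAddCommGroup K] [InnerProductSpace ℂ K] [CompleteSpace K]

/-- The vector `ψ` stays in the domain of `A` under `e^{-i y·X}` and `A e^{-i y·X} ψ` is
polynomially bounded in `y`. -/
structure IsPolyBoundedAt (X : ι → H →ₗ.[ℂ] H) (A : H →ₗ.[ℂ] H) (ψ : H) (c : ℝ) (m : ℕ) :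
    Prop where
  mem_domain : ∀ y, expI X (-y) ψ ∈ A.domain
  norm_le : ∀ y, ‖valueAt A (expI X (-y) ψ)‖ ≤ c * (1 + ‖y‖) ^ m

variable {X : ι → H →ₗ.[ℂ] H} {Y : ι → K →ₗ.[ℂ] K} {A : H →ₗ.[ℂ] H} {ψ : H} {c : ℝ} {m : ℕ}

theorem IsPolyBoundedAt.nonneg (h : IsPolyBoundedAt X A ψ c m) : 0 ≤ c := by
  have := (norm_nonneg _).trans (h.norm_le 0)
  simpa using this

/-- The matrix element `⟪ψ', e^{i q·X} e^{i y·X} A e^{-i y·X} ψ⟫`. -/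
def orbitElement (X : ι → H →ₗ.[ℂ] H) (A : H →ₗ.[ℂ] H) (ψ' ψ : H) (q y : ι → ℝ) : ℂ :=
  ⟪expI X (-y) (expI X (-q) ψ'), valueAt A (expI X (-y) ψ)⟫_ℂ

/-- The left vector is `e^{-i(y+q)·X} ψ'`, norm continuous in both parameters jointly. The right
vector is only weakly continuous, with a polynomial bound. -/
theorem IsPolyBoundedAt.continuous_orbitElement (hA : A.IsClosable)
    (h : IsPolyBoundedAt X A ψ c m) (ψ' : H) :
    Continuous fun p : (ι → ℝ) × (ι → ℝ) => orbitElement X A ψ' ψ p.1 p.2 := by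
  have h1 : Continuous fun p : (ι → ℝ) × (ι → ℝ) => expI X (-p.2) (expI X (-p.1) ψ') := by
    have h2 : (fun p : (ι → ℝ) × (ι → ℝ) => expI X (-p.2) (expI X (-p.1) ψ')) =
        fun p => expI X (-p.2 + -p.1) ψ' := by
      ext p
      rw [expI_add]
      rfl
    rw [h2]
    exact (continuous_expI X ψ').comp (continuous_snd.neg.add continuous_fst.neg)
  exact continuous_inner_valueAt hA ((continuous_expI X ψ).comp continuous_snd.neg)
    (fun p => h.mem_domain p.2) h1 (by fun_prop : Continuous fun p : (ι → ℝ) × (ι → ℝ) =>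
      c * (1 + ‖p.2‖) ^ m) fun p => h.norm_le p.2

theorem IsPolyBoundedAt.norm_orbitElement_le (h : IsPolyBoundedAt X A ψ c m) (ψ' : H)
    (q y : ι → ℝ) : ‖orbitElement X A ψ' ψ q y‖ ≤ ‖ψ'‖ * c * (1 + ‖y‖) ^ m := by
  refine (norm_inner_le_norm _ _).trans ?_
  rw [norm_expI_apply, norm_expI_apply, mul_assoc]
  exact mul_le_mul_of_nonneg_left (h.norm_le y) (norm_nonneg _)

theorem IsPolyBoundedAt.continuous_orbitElement_right (hA : A.IsClosable)
    (h : IsPolyBoundedAt X A ψ c m) (ψ' : H) (q : ι → ℝ) :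
    Continuous (orbitElement X A ψ' ψ q) := by
  have h1 := (h.continuous_orbitElement hA ψ').comp (Continuous.prodMk_right q)
  simp only [Function.comp_def] at h1
  exact h1

theorem memLp_poly (hY : IsCommutingSelfAdjoint Y) {φ : K} (hφ : φ ∈ smoothDomain Y) (c : ℝ)
    (m : ℕ) : MemLp (fun s : ι → ℝ => c * (1 + ‖s‖) ^ m) 2 ((jointSpectralMeasure Y).meas φ) :=
  ((isJointSpectralMeasure_jointSpectralMeasure hY).memLp_one_add_norm_pow m hφ).const_mul c

theorem one_add_norm_idApprox_pow_le (n m : ℕ) (y : ι → ℝ) :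
    (1 + ‖idApprox n y‖) ^ m ≤ 2 ^ m * (1 + ‖y‖) ^ m := by
  rw [← mul_pow]
  have := norm_idApprox_le n y
  exact pow_le_pow_left₀ (by positivity) (by linarith [norm_nonneg y]) m

/-- The analytic core of the conjugation formula. The approximants `e^{-iσ_n(y)·X} ψ` tensored with
`dE(y) φ` converge in norm, their images under `A ⊗ 1` are bounded by a moment of `φ`, and a weak
limit `Ξ` is the value of `A ⊗ 1`. Testing against vectors built with the same `σ_n` makes the
matrix elements computable. -/
theorem IsPolyBoundedAt.exists_tensorOne (hY : IsCommutingSelfAdjoint Y) (hA : A.IsClosable)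
    (h : IsPolyBoundedAt X A ψ c m) {φ : K} (hφ : φ ∈ smoothDomain Y) :
    ∃ Ξ, (expTensor X Y (-1) (tmulVec ψ φ), Ξ) ∈ (tensorOneGraph K A).topologicalClosure ∧
      ∀ ψ' φ', ⟪expTensor X Y (-1) (tmulVec ψ' φ'), Ξ⟫_ℂ =
        ⟪φ', (jointSpectralMeasure Y).cyc φ (orbitElement X A ψ' ψ 0)⟫_ℂ := by
  set E := jointSpectralMeasure Y
  have hc := h.nonneg
  have hz : ∀ ψ φ, Tendsto (fun n => E.simpleTensor (idApprox n) (fun r => expI X (-r) ψ) φ) atTop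
      (𝓝 (expTensor X Y (-1) (tmulVec ψ φ))) := fun ψ φ => tendsto_expTensor_neg_one X Y ψ φ
  -- The factor `2 ^ m` appears because the approximants of the identity satisfy only `‖σ_n(y)‖ ≤
  -- 2‖y‖`.
  have hb : ∀ n y, ‖valueAt A (expI X (-idApprox n y) ψ)‖ ≤ c * 2 ^ m * (1 + ‖y‖) ^ m :=
    fun n y => (h.norm_le _).trans (by
      rw [mul_assoc]
      exact mul_le_mul_of_nonneg_left (one_add_norm_idApprox_pow_le n m y) hc)
  obtain ⟨Ξ, h1, h2⟩ := exists_weak_limit (hz ψ φ)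
    (Ξ := fun n => E.simpleTensor (idApprox n) (fun r => valueAt A (expI X (-r) ψ)) φ)
    (C := √(∫ y, (c * 2 ^ m * (1 + ‖y‖) ^ m) ^ 2 ∂E.meas φ)) (S := tensorOneGraph K A)
    (fun n => Real.le_sqrt_of_sq_le (E.norm_simpleTensor_sq_le _
      (fun r => valueAt A (expI X (-r) ψ)) (memLp_poly hY hφ _ m) (hb n)))
    (fun n => by
      have : ∀ s : Finset (ι → ℝ), (∑ r ∈ s, tmulVec (expI X (-r) ψ) (E.proj (idApprox n ⁻¹' {r}) φ),
          ∑ r ∈ s, tmulVec (valueAt A (expI X (-r) ψ)) (E.proj (idApprox n ⁻¹' {r}) φ)) ∈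
            tensorOneGraph K A := fun s => by
        have h5 := (tensorOneGraph K A).sum_mem fun r (_ : r ∈ s) =>
          mem_tensorOneGraph (h.mem_domain r) (E.proj (idApprox n ⁻¹' {r}) φ)
        refine Eq.subst (motive := fun p => p ∈ tensorOneGraph K A) ?_ h5
        exact Prod.ext Prod.fst_sum Prod.snd_sum
      exact this _)
  refine ⟨Ξ, h1, fun ψ' φ' => h2 _ _ _ (hz ψ' φ') ?_⟩
  have hg := h.continuous_orbitElement_right hA ψ' 0
  have h3 : Tendsto (fun n => E.cyc φ fun y => orbitElement X A ψ' ψ 0 (idApprox n y)) atTop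
      (𝓝 (E.cyc φ (orbitElement X A ψ' ψ 0))) := by
    refine E.tendsto_cyc (fun n => (hg.measurable.comp (idApprox n).measurable).aestronglyMeasurable)
      (memLp_poly hY hφ (‖ψ'‖ * c * 2 ^ m) m) (fun n => Eventually.of_forall fun y => ?_)
      (Eventually.of_forall fun y => (hg.tendsto y).comp (tendsto_idApprox y))
    refine (h.norm_orbitElement_le ψ' 0 _).trans ?_
    rw [mul_assoc _ (2 ^ m)]
    exact mul_le_mul_of_nonneg_left (one_add_norm_idApprox_pow_le n m y) (by positivity)
  refine ((tendsto_const_nhds (x := φ')).inner h3).congr fun n => ?_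
  rw [E.inner_simpleTensor]
  simp only [orbitElement, neg_zero, expI_zero]
  rfl

theorem IsPolyBoundedAt.tmulVec_mem_domain (hY : IsCommutingSelfAdjoint Y) (hA : A.IsClosable)
    (h : IsPolyBoundedAt X A ψ c m) {φ : K} (hφ : φ ∈ smoothDomain Y) :
    expTensor X Y (-1) (tmulVec ψ φ) ∈ (tensorOne A).domain := by
  obtain ⟨Ξ, h1, -⟩ := h.exists_tensorOne hY hA hφ
  exact mem_domain_tensorOne hA h1

theorem IsPolyBoundedAt.inner_valueAt (hY : IsCommutingSelfAdjoint Y) (hA : A.IsClosable)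
    (h : IsPolyBoundedAt X A ψ c m) {φ : K} (hφ : φ ∈ smoothDomain Y) (ψ' : H) (φ' : K) :
    ⟪tmulVec ψ' φ', valueAt (sandwich (expTensor X Y 1) (tensorOne A) (expTensor X Y (-1)))
      (tmulVec ψ φ)⟫_ℂ = ∫ y, orbitElement X A ψ' ψ 0 y *
        (jointSpectralMeasure Y).density φ' φ y ∂(jointSpectralMeasure Y).meas φ := by
  obtain ⟨Ξ, h1, h2⟩ := h.exists_tensorOne hY hA hφ
  have hm : MemLp (orbitElement X A ψ' ψ 0) 2 ((jointSpectralMeasure Y).meas φ) :=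
    (memLp_poly hY hφ (‖ψ'‖ * c) m).mono'
      (h.continuous_orbitElement_right hA ψ' 0).measurable.aestronglyMeasurable
      (Eventually.of_forall fun y => h.norm_orbitElement_le ψ' 0 y)
  rw [valueAt_sandwich (mem_domain_tensorOne hA h1), valueAt_tensorOne hA h1,
    inner_expTensor_right, h2, PVM.inner_cyc_eq_integral _ _ hm]

theorem algTensor_le_domain (hY : IsCommutingSelfAdjoint Y) (hA : A.IsClosable)
    {D : Submodule ℂ H} (hD : ∀ ψ ∈ D, ∃ c, IsPolyBoundedAt X A ψ c m) :
    algTensor D (smoothDomain Y) ≤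
      (sandwich (expTensor X Y 1) (tensorOne A) (expTensor X Y (-1))).domain := by
  refine Submodule.span_le.2 ?_
  rintro _ ⟨ψ, hψ, φ, hφ, rfl⟩
  obtain ⟨c, hc⟩ := hD ψ hψ
  exact hc.tmulVec_mem_domain hY hA hφ

theorem isWeakTensorIntegral_conjugation (hY : IsCommutingSelfAdjoint Y) (hA : A.IsClosable)
    {D : Submodule ℂ H} (hD : ∀ ψ ∈ D, ∃ c, IsPolyBoundedAt X A ψ c m) :
    IsWeakTensorIntegral (jointSpectralMeasure Y).support
      (fun y => sandwich (expI X y) A (expI X (-y))) (jointSpectralMeasure Y) D (smoothDomain Y)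
      (sandwich (expTensor X Y 1) (tensorOne A) (expTensor X Y (-1))) := by
  intro ψ hψ φ hφ
  obtain ⟨c, h⟩ := hD ψ hψ
  refine ⟨fun y _ => h.mem_domain y, fun ψ' φ' => ?_⟩
  have e : (fun y => ⟪ψ', valueAt (sandwich (expI X y) A (expI X (-y))) ψ⟫_ℂ) =
      orbitElement X A ψ' ψ 0 := by
    ext y
    rw [valueAt_sandwich (h.mem_domain y), inner_expI_right, orbitElement, neg_zero, expI_zero]
    rfl
  have hc := h.continuous_orbitElement_right hA ψ' 0
  have hi : Integrable (fun y => orbitElement X A ψ' ψ 0 y *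
      (jointSpectralMeasure Y).density φ' φ y) ((jointSpectralMeasure Y).meas φ) :=
    PVM.integrable_mul_density _ φ' ((memLp_poly hY hφ (‖ψ'‖ * c) m).mono'
      hc.measurable.aestronglyMeasurable
      (Eventually.of_forall fun y => h.norm_orbitElement_le ψ' 0 y))
  rw [e, PVM.setIntegral, VectorMeasure.IntegrableOn, PVM.matrixElement_restrict_support,
    h.inner_valueAt hY hA hφ]
  exact ⟨(PVM.integrable_matrixElement_iff _ hc.measurable).2 hi,
    (PVM.integral_eq_integral_density _ hc.measurable hi).symm⟩

end Conjugation

/-! ### Partial Fourier transforms of Schwartz functions -/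

section Decay

variable {E : Type*} [NormedAddCommGroup E] [NormedSpace ℝ E] [FiniteDimensional ℝ E]
  [MeasurableSpace E] [BorelSpace E] (μ : Measure E) [μ.IsAddHaarMeasure]

theorem integrable_inv_one_add_norm_pow {k : ℕ} (hk : Module.finrank ℝ E < k) :
    Integrable (fun x : E => ((1 + ‖x‖) ^ k)⁻¹) μ := by
  have h := integrable_one_add_norm (μ := μ) (E := E) (r := k) (by exact_mod_cast hk)
  refine h.congr (Eventually.of_forall fun x => ?_)
  change (1 + ‖x‖) ^ (-(k : ℝ)) = _
  rw [Real.rpow_neg (by positivity), Real.rpow_natCast]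

end Decay

theorem exists_iteratedFDeriv_le {E F : Type*} [NormedAddCommGroup E] [NormedSpace ℝ E]
    [NormedAddCommGroup F] [NormedSpace ℝ F] (χ : 𝓢(E, F)) (k j : ℕ) :
    ∃ C, 0 ≤ C ∧ ∀ x, ‖iteratedFDeriv ℝ j χ x‖ ≤ C * ((1 + ‖x‖) ^ k)⁻¹ := by
  have h : ∀ x, (1 + ‖x‖) ^ k * ‖iteratedFDeriv ℝ j χ x‖ ≤ 2 ^ k *
      (Finset.Iic (k, j)).sup (fun m => SchwartzMap.seminorm ℝ m.1 m.2) χ := fun x =>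
    SchwartzMap.one_add_le_sup_seminorm_apply (𝕜 := ℝ) (m := (k, j)) le_rfl le_rfl χ x
  refine ⟨_, (by positivity : (0 : ℝ) ≤ _).trans (h 0), fun x => ?_⟩
  rw [← div_eq_mul_inv, le_div_iff₀ (by positivity), mul_comm]
  exact h x

theorem exists_norm_le {E F : Type*} [NormedAddCommGroup E] [NormedSpace ℝ E]
    [NormedAddCommGroup F] [NormedSpace ℝ F] (χ : 𝓢(E, F)) (k : ℕ) :
    ∃ C, 0 ≤ C ∧ ∀ x, ‖χ x‖ ≤ C * ((1 + ‖x‖) ^ k)⁻¹ := by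
  obtain ⟨C, h0, hC⟩ := exists_iteratedFDeriv_le χ k 0
  exact ⟨C, h0, fun x => by simpa using hC x⟩

section Partial

variable {n : Type*} [Fintype n]

/-- The slice `x ↦ χ(x, w)` of a Schwartz function, on Euclidean space. -/
def slice (χ : 𝓢((n → ℝ) × (n → ℝ), ℂ)) (w : n → ℝ) (x : EuclideanSpace ℝ n) : ℂ :=
  χ (WithLp.ofLp x, w)

/-- The linear part of `x ↦ (x, w)`. -/
def sliceL (n : Type*) [Fintype n] : EuclideanSpace ℝ n →L[ℝ] (n → ℝ) × (n → ℝ) :=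
  ContinuousLinearMap.inl ℝ (n → ℝ) (n → ℝ) ∘L
    (EuclideanSpace.equiv n ℝ : EuclideanSpace ℝ n →L[ℝ] (n → ℝ))

theorem slice_eq (χ : 𝓢((n → ℝ) × (n → ℝ), ℂ)) (w : n → ℝ) :
    slice χ w = (fun q => χ (q + (0, w))) ∘ sliceL n := by
  ext x
  simp [slice, sliceL]
  rfl

theorem contDiff_slice (χ : 𝓢((n → ℝ) × (n → ℝ), ℂ)) (w : n → ℝ) (k : ℕ∞) :
    ContDiff ℝ k (slice χ w) := by
  rw [slice_eq]
  exact ((χ.smooth k).comp (contDiff_id.add contDiff_const)).comp (sliceL n).contDiff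

theorem exists_antilipschitz_sliceL (n : Type*) [Fintype n] :
    ∃ c : ℝ, 0 < c ∧ c ≤ 1 ∧ ∀ (x : EuclideanSpace ℝ n) (w : n → ℝ),
      c * (1 + ‖x‖) ≤ 1 + ‖(WithLp.ofLp x, w)‖ := by
  obtain ⟨K, hK⟩ : ∃ K : NNReal, AntilipschitzWith K (EuclideanSpace.equiv n ℝ) :=
    ⟨_, (EuclideanSpace.equiv n ℝ).antilipschitz⟩
  refine ⟨(1 + K : ℝ)⁻¹, by positivity, inv_le_one_of_one_le₀ (by simp), fun x w => ?_⟩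
  have h1 : ‖x‖ ≤ K * ‖(WithLp.ofLp x)‖ := by
    have := hK.le_mul_dist x 0
    rw [map_zero, dist_zero_right, dist_zero_right] at this
    exact this
  have h2 : ‖WithLp.ofLp x‖ ≤ ‖(WithLp.ofLp x, w)‖ := norm_fst_le (WithLp.ofLp x, w)
  rw [inv_mul_le_iff₀ (by positivity)]
  have h3 : (K : ℝ) * ‖(WithLp.ofLp x)‖ ≤ K * ‖(WithLp.ofLp x, w)‖ :=
    mul_le_mul_of_nonneg_left h2 K.2
  nlinarith [norm_nonneg (WithLp.ofLp x, w), K.2]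

theorem exists_iteratedFDeriv_slice_le (χ : 𝓢((n → ℝ) × (n → ℝ), ℂ)) (k j : ℕ) :
    ∃ C, 0 ≤ C ∧ ∀ w x, ‖iteratedFDeriv ℝ j (slice χ w) x‖ ≤ C * ((1 + ‖x‖) ^ k)⁻¹ := by
  obtain ⟨C, h0, hC⟩ := exists_iteratedFDeriv_le χ k j
  obtain ⟨c, hc0, hc1, hc⟩ := exists_antilipschitz_sliceL n
  refine ⟨C * (c ^ k)⁻¹ * ‖sliceL n‖ ^ j, by positivity, fun w x => ?_⟩
  have hsm : ContDiff ℝ j fun q => χ (q + (0, w)) :=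
    (χ.smooth j).comp (contDiff_id.add contDiff_const)
  rw [slice_eq, (sliceL n).iteratedFDeriv_comp_right hsm x le_rfl, iteratedFDeriv_comp_add_right]
  refine (ContinuousMultilinearMap.norm_compContinuousLinearMap_le _ _).trans ?_
  rw [Finset.prod_const, Finset.card_univ, Fintype.card_fin]
  have e : sliceL n x + (0, w) = (WithLp.ofLp x, w) := by
    simp [sliceL]
    rfl
  rw [e, mul_right_comm _ (‖sliceL n‖ ^ j)]
  refine mul_le_mul_of_nonneg_right ((hC _).trans ?_) (by positivity)
  rw [mul_assoc, ← mul_inv, ← mul_pow]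
  refine mul_le_mul_of_nonneg_left (inv_anti₀ (by positivity) ?_) h0
  exact pow_le_pow_left₀ (by positivity) (hc x w) k

/-- Powers of the frequency are traded for derivatives of the slice, whose `L¹` norms are bounded
uniformly in the frozen variable `w`. -/
theorem exists_fourier_slice_le (χ : 𝓢((n → ℝ) × (n → ℝ), ℂ)) (M : ℕ) :
    ∃ C, 0 ≤ C ∧ ∀ w x, ‖FourierTransform.fourier (slice χ w) x‖ ≤ C * ((1 + ‖x‖) ^ M)⁻¹ := by
  have hint : Integrable fun x : EuclideanSpace ℝ n =>
      ((1 + ‖x‖) ^ (Module.finrank ℝ (EuclideanSpace ℝ n) + 1))⁻¹ :=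
    integrable_inv_one_add_norm_pow _ (Nat.lt_succ_self _)
  choose C h0 hC using fun j => exists_iteratedFDeriv_slice_le χ
    (Module.finrank ℝ (EuclideanSpace ℝ n) + 1) j
  have key : ∀ k : ℕ, ∃ B, ∀ w x, ‖x‖ ^ k * ‖FourierTransform.fourier (slice χ w) x‖ ≤ B := by
    intro k
    refine ⟨2 ^ k * ∑ p ∈ Finset.range (0 + 1) ×ˢ Finset.range (k + 1), C p.2 *
      ∫ x : EuclideanSpace ℝ n, ((1 + ‖x‖) ^ (Module.finrank ℝ (EuclideanSpace ℝ n) + 1))⁻¹,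
      fun w x => ?_⟩
    have hi : ∀ j, Integrable fun v => ‖iteratedFDeriv ℝ j (slice χ w) v‖ := fun j =>
      (hint.const_mul (C j)).mono' ((contDiff_slice χ w ⊤).continuous_iteratedFDeriv
        (m := j) (by exact_mod_cast le_top)).norm.aestronglyMeasurable
        (Eventually.of_forall fun v => by rw [norm_norm]; exact hC j w v)
    have h := Real.pow_mul_norm_iteratedFDeriv_fourier_le (V := EuclideanSpace ℝ n) (K := 0)
      (N := k) (f := slice χ w) (contDiff_slice χ w k) (fun a b ha _ => by
        have : a = 0 := by simpa using ha
        subst this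
        simpa using hi b) (k := 0) (n := k) le_rfl le_rfl x
    rw [norm_iteratedFDeriv_zero] at h
    refine h.trans ?_
    simp only [pow_zero, one_mul, Nat.cast_zero, mul_zero, zero_add]
    refine mul_le_mul_of_nonneg_left (Finset.sum_le_sum fun p hp => ?_) (by positivity)
    have hp1 : p.1 = 0 := by simpa using (Finset.mem_product.1 hp).1
    simp only [hp1, pow_zero, one_mul]
    rw [← integral_const_mul]
    exact integral_mono (hi _) (hint.const_mul _) fun v => hC p.2 w v
  obtain ⟨B0, hB0⟩ := key 0
  obtain ⟨B1, hB1⟩ := key M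
  have hnn : 0 ≤ B0 + B1 :=
    add_nonneg ((by positivity : (0 : ℝ) ≤ _).trans (hB0 0 0))
      ((by positivity : (0 : ℝ) ≤ _).trans (hB1 0 0))
  refine ⟨2 ^ (M - 1) * (B0 + B1), by positivity, fun w x => ?_⟩
  rw [← div_eq_mul_inv, le_div_iff₀ (by positivity)]
  have h1 := add_pow_le zero_le_one (norm_nonneg x) M
  have h2 := hB0 w x
  have h3 := hB1 w x
  rw [pow_zero, one_mul] at h2
  calc _ ≤ ‖FourierTransform.fourier (slice χ w) x‖ * (2 ^ (M - 1) * (1 ^ M + ‖x‖ ^ M)) :=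
        mul_le_mul_of_nonneg_left h1 (norm_nonneg _)
    _ = 2 ^ (M - 1) * (‖FourierTransform.fourier (slice χ w) x‖ +
        ‖x‖ ^ M * ‖FourierTransform.fourier (slice χ w) x‖) := by ring
    _ ≤ _ := mul_le_mul_of_nonneg_left (add_le_add h2 h3) (by positivity)

/-- The Fourier transform of a Schwartz function in the first of two variables. -/
def partialFourier (χ : 𝓢((n → ℝ) × (n → ℝ), ℂ)) (u w : n → ℝ) : ℂ :=
  ∫ a, χ (a, w) * expFun (-a) u

/-- `Real.fourier_eq'` uses the phase `-2π⟪a, u⟫` on Euclidean space, hence the rescaling by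
`(2π)⁻¹` and the passage from the sup norm. -/
theorem partialFourier_eq (χ : 𝓢((n → ℝ) × (n → ℝ), ℂ)) (u w : n → ℝ) :
    partialFourier χ u w =
      FourierTransform.fourier (slice χ w) (WithLp.toLp 2 ((2 * Real.pi)⁻¹ • u)) := by
  rw [Real.fourier_eq', partialFourier,
    ← (PiLp.volume_preserving_toLp n).integral_comp (MeasurableEquiv.toLp 2 _).measurableEmbedding]
  refine integral_congr_ae (Eventually.of_forall fun a => ?_)
  simp only [slice, smul_eq_mul]
  rw [mul_comm, expFun]
  congr 2
  have : ⟪WithLp.toLp 2 a, WithLp.toLp 2 ((2 * Real.pi)⁻¹ • u)⟫_ℝ = (2 * Real.pi)⁻¹ * (a ⬝ᵥ u) := by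
    rw [EuclideanSpace.inner_toLp_toLp]
    simp [dotProduct_comm]
  rw [this, neg_dotProduct, mul_comm Complex.I]
  congr 2
  field_simp

theorem exists_partialFourier_le (χ : 𝓢((n → ℝ) × (n → ℝ), ℂ)) (M : ℕ) :
    ∃ C, 0 ≤ C ∧ ∀ u w, ‖partialFourier χ u w‖ ≤ C * ((1 + ‖u‖) ^ M)⁻¹ := by
  obtain ⟨C, h0, hC⟩ := exists_fourier_slice_le χ M
  have hp : 1 ≤ 2 * Real.pi := by linarith [Real.pi_gt_three]
  refine ⟨C * (2 * Real.pi) ^ M, by positivity, fun u w => ?_⟩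
  rw [partialFourier_eq]
  refine (hC w _).trans ?_
  rw [mul_assoc]
  refine mul_le_mul_of_nonneg_left ?_ h0
  rw [← div_eq_mul_inv, inv_eq_one_div, div_le_div_iff₀ (by positivity) (by positivity), one_mul,
    ← mul_pow]
  refine pow_le_pow_left₀ (by positivity) ?_ M
  have h1 : ‖(2 * Real.pi)⁻¹ • u‖ ≤ ‖WithLp.toLp 2 ((2 * Real.pi)⁻¹ • u)‖ := by
    rw [pi_norm_le_iff_of_nonneg (norm_nonneg _)]
    exact fun i => PiLp.norm_apply_le (WithLp.toLp 2 ((2 * Real.pi)⁻¹ • u)) i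
  rw [norm_smul, Real.norm_of_nonneg (by positivity), inv_mul_le_iff₀ (by positivity)] at h1
  linarith

theorem continuous_partialFourier (χ : 𝓢((n → ℝ) × (n → ℝ), ℂ)) :
    Continuous fun q : (n → ℝ) × (n → ℝ) => partialFourier χ q.1 q.2 := by
  obtain ⟨C, h0, hC⟩ := exists_norm_le χ (Module.finrank ℝ (n → ℝ) + 1)
  have he : Continuous fun q : (n → ℝ) × (n → ℝ) => expFun (-q.1) q.2 := by
    unfold expFun dotProduct
    simp only [Pi.neg_apply]
    fun_prop
  refine continuous_of_dominated
    (bound := fun a => C * ((1 + ‖a‖) ^ (Module.finrank ℝ (n → ℝ) + 1))⁻¹) (fun q => ?_)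
    (fun q => Eventually.of_forall fun a => ?_)
    ((integrable_inv_one_add_norm_pow _ (Nat.lt_succ_self _)).const_mul C)
    (Eventually.of_forall fun a => ?_)
  · have h1 : Continuous fun a : n → ℝ => expFun (-a) q.1 :=
      he.comp (continuous_id.prodMk continuous_const)
    have h2 : Continuous fun a : n → ℝ => χ (a, q.2) :=
      χ.continuous.comp (continuous_id.prodMk continuous_const)
    exact (h2.mul h1).aestronglyMeasurable
  · rw [norm_mul, norm_expFun, mul_one]
    refine (hC _).trans (mul_le_mul_of_nonneg_left (inv_anti₀ (by positivity) ?_) h0)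
    exact pow_le_pow_left₀ (by positivity) (by linarith [norm_fst_le (a, q.2)]) _
  · have h1 : Continuous fun q : (n → ℝ) × (n → ℝ) => expFun (-a) q.1 :=
      he.comp (continuous_const.prodMk continuous_fst)
    have h2 : Continuous fun q : (n → ℝ) × (n → ℝ) => χ (a, q.2) :=
      χ.continuous.comp (continuous_const.prodMk continuous_snd)
    exact h2.mul h1

/-- Fourier inversion at the origin; the power of `2π` is the Jacobian of the rescaling. -/
theorem integral_partialFourier_zero (χ : 𝓢((n → ℝ) × (n → ℝ), ℂ)) :
    ∫ u, partialFourier χ u 0 = (((2 * Real.pi) ^ Fintype.card n : ℝ) : ℂ) * χ 0 := by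
  have hp : 0 < 2 * Real.pi := by positivity
  rw [integral_congr_ae (Eventually.of_forall fun u => partialFourier_eq χ u 0),
    Measure.integral_comp_smul volume
      (fun v => FourierTransform.fourier (slice χ 0) (WithLp.toLp 2 v)) (2 * Real.pi)⁻¹,
    (PiLp.volume_preserving_toLp n).integral_comp (MeasurableEquiv.toLp 2 _).measurableEmbedding]
  obtain ⟨C, h0, hC⟩ := exists_fourier_slice_le χ (Module.finrank ℝ (EuclideanSpace ℝ n) + 1)
  obtain ⟨C', h0', hC'⟩ := exists_iteratedFDeriv_slice_le χ
    (Module.finrank ℝ (EuclideanSpace ℝ n) + 1) 0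
  have hint : Integrable fun x : EuclideanSpace ℝ n =>
      ((1 + ‖x‖) ^ (Module.finrank ℝ (EuclideanSpace ℝ n) + 1))⁻¹ :=
    integrable_inv_one_add_norm_pow _ (Nat.lt_succ_self _)
  have hc : Continuous (slice χ 0) := (contDiff_slice χ 0 0).continuous
  have hi : Integrable (slice χ 0) := (hint.const_mul C').mono' hc.aestronglyMeasurable
    (Eventually.of_forall fun x => by simpa using hC' 0 x)
  have hfc : Continuous (FourierTransform.fourier (slice χ 0)) :=
    VectorFourier.fourierIntegral_continuous Real.continuous_fourierChar
      (by exact continuous_inner) hi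
  have hfi : Integrable (FourierTransform.fourier (slice χ 0)) :=
    (hint.const_mul C).mono' hfc.aestronglyMeasurable (Eventually.of_forall fun x => hC 0 x)
  have h2 := congrFun (hc.fourierInv_fourier_eq hi hfi) 0
  rw [Real.fourierInv_eq'] at h2
  simp only [inner_zero_right, mul_zero, Complex.ofReal_zero, zero_mul, Complex.exp_zero,
    one_smul] at h2
  rw [h2, abs_of_pos (by positivity), inv_pow, inv_inv, Module.finrank_fintype_fun_eq_card,
    Complex.real_smul]
  rfl

end Partial

/-! ### Regularised oscillatory integrals -/

section Oscillatory

variable {n : Type*} [Fintype n] (χ : 𝓢((n → ℝ) × (n → ℝ), ℂ)) {g : (n → ℝ) → ℂ} {c : ℝ} {m : ℕ}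
  {ε : ℝ}

theorem continuous_expFun_neg : Continuous fun q : (n → ℝ) × (n → ℝ) => expFun (-q.1) q.2 := by
  unfold expFun dotProduct
  simp only [Pi.neg_apply]
  fun_prop

theorem integrable_norm_mul_pow (m : ℕ) (hε : 0 < ε) :
    Integrable fun v : (n → ℝ) × (n → ℝ) => ‖χ (ε • v)‖ * (1 + ‖v.2‖) ^ m := by
  let r := Module.finrank ℝ ((n → ℝ) × (n → ℝ)) + 1
  obtain ⟨C, h0, hC⟩ := exists_norm_le χ (m + r)
  have : (volume : Measure ((n → ℝ) × (n → ℝ))).IsAddHaarMeasure := by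
    exact Measure.prod.instIsAddHaarMeasure volume volume
  have hint : Integrable fun v : (n → ℝ) × (n → ℝ) => ((1 + ‖ε • v‖) ^ r)⁻¹ :=
    (integrable_inv_one_add_norm_pow (volume : Measure ((n → ℝ) × (n → ℝ)))
      (Nat.lt_succ_self _)).comp_smul hε.ne'
  refine (hint.const_mul (C * (1 + ε⁻¹) ^ m)).mono' ?_ (Eventually.of_forall fun v => ?_)
  · have : Continuous fun v : (n → ℝ) × (n → ℝ) => ‖χ (ε • v)‖ * (1 + ‖v.2‖) ^ m := by
      have := χ.continuous
      fun_prop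
    exact this.aestronglyMeasurable
  · rw [norm_mul, norm_norm, Real.norm_of_nonneg (by positivity)]
    -- This bound converts the polynomial weight into powers of `1 + ‖ε v‖`, which the decay of the
    -- cutoff absorbs for fixed `ε`.
    have h1 : 1 + ‖v.2‖ ≤ (1 + ε⁻¹) * (1 + ‖ε • v‖) := by
      have h2 := norm_snd_le v
      rw [norm_smul, Real.norm_of_nonneg hε.le]
      have h3 : (1 + ε⁻¹) * (1 + ε * ‖v‖) = 1 + ε⁻¹ + ε * ‖v‖ + ‖v‖ := by
        field_simp
        ring
      have h4 : 0 ≤ ε * ‖v‖ := by positivity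
      have h5 : 0 < ε⁻¹ := by positivity
      linarith
    calc ‖χ (ε • v)‖ * (1 + ‖v.2‖) ^ m
        ≤ (C * ((1 + ‖ε • v‖) ^ (m + r))⁻¹) * ((1 + ε⁻¹) * (1 + ‖ε • v‖)) ^ m :=
          mul_le_mul (hC _) (pow_le_pow_left₀ (by positivity) h1 m) (by positivity) (by positivity)
      _ = C * (1 + ε⁻¹) ^ m * ((1 + ‖ε • v‖) ^ r)⁻¹ := by
          rw [mul_pow, pow_add]
          field_simp

theorem integral_schwartz_mul_expFun (hε : 0 < ε) (t w : n → ℝ) :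
    ∫ a, χ (ε • (a, w)) * expFun (-a) t =
      ((ε ^ Module.finrank ℝ (n → ℝ))⁻¹ : ℝ) • partialFourier χ (ε⁻¹ • t) (ε • w) := by
  have h := Measure.integral_comp_smul volume
    (fun a : n → ℝ => χ (a, ε • w) * expFun (-a) (ε⁻¹ • t)) ε
  rw [abs_of_pos (by positivity)] at h
  rw [partialFourier, ← h]
  refine integral_congr_ae (Eventually.of_forall fun a => ?_)
  simp only [expFun, Prod.smul_mk]
  congr 4
  rw [neg_dotProduct, neg_dotProduct, smul_dotProduct, dotProduct_smul, smul_smul,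
    mul_inv_cancel₀ hε.ne', one_smul]

/-- The kernel which remains of a regularised oscillatory integral after one integration. -/
def oscKernel (g : (n → ℝ) → ℂ) (ε : ℝ) (t : n → ℝ) : ℂ :=
  ∫ u, g (ε • u + t) * partialFourier χ u (ε • (ε • u + t))

theorem integrable_oscillatory (hg : Continuous g) (hgm : ∀ v, ‖g v‖ ≤ c * (1 + ‖v‖) ^ m)
    (hε : 0 < ε) (t : n → ℝ) : Integrable fun v : (n → ℝ) × (n → ℝ) =>
      χ (ε • v) * expFun (-v.1) (v.2 - t) * g v.2 := by
  refine ((integrable_norm_mul_pow χ m hε).const_mul c).mono' ?_ (Eventually.of_forall fun v => ?_)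
  · have h1 : Continuous fun v : (n → ℝ) × (n → ℝ) => expFun (-v.1) (v.2 - t) :=
      continuous_expFun_neg.comp (continuous_fst.prodMk (continuous_snd.sub continuous_const))
    have h2 := χ.continuous
    have h3 : Continuous fun v : (n → ℝ) × (n → ℝ) =>
        χ (ε • v) * expFun (-v.1) (v.2 - t) * g v.2 :=
      ((h2.comp (continuous_const_smul ε)).mul h1).mul (hg.comp continuous_snd)
    exact h3.aestronglyMeasurable
  · rw [norm_mul, norm_mul, norm_expFun, mul_one, mul_left_comm]
    exact mul_le_mul_of_nonneg_left (hgm _) (norm_nonneg _)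

/-- The integral over the first variable gives `ε^{-d}` times the partial Fourier transform at `(w -
t)/ε`. The substitution `w = εu + t` cancels this power and leaves a kernel with a limit at `ε = 0`.
-/
theorem integral_oscillatory (hg : Continuous g) (hgm : ∀ v, ‖g v‖ ≤ c * (1 + ‖v‖) ^ m)
    (hε : 0 < ε) (t : n → ℝ) : ∫ v : (n → ℝ) × (n → ℝ),
      χ (ε • v) * expFun (-v.1) (v.2 - t) * g v.2 = oscKernel χ g ε t := by
  have hi := integrable_oscillatory χ hg hgm hε t
  have h1 : ∀ w : n → ℝ, ∫ a, χ (ε • (a, w)) * expFun (-a) (w - t) * g w =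
      ((ε ^ Module.finrank ℝ (n → ℝ))⁻¹ : ℝ) •
        (g w * partialFourier χ (ε⁻¹ • (w - t)) (ε • w)) := fun w => by
    rw [integral_mul_const, integral_schwartz_mul_expFun χ hε, smul_mul_assoc, mul_comm (g w)]
  have h2 := Measure.integral_comp_smul volume
    (fun w : n → ℝ => g (w + t) * partialFourier χ (ε⁻¹ • (w + t - t)) (ε • (w + t))) ε
  rw [abs_of_pos (by positivity), integral_add_right_eq_self
    (fun w : n → ℝ => g w * partialFourier χ (ε⁻¹ • (w - t)) (ε • w)) t] at h2
  rw [Measure.volume_eq_prod] at hi ⊢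
  rw [integral_prod_symm _ hi]
  simp only [h1]
  rw [integral_smul, ← h2, oscKernel]
  refine integral_congr_ae (Eventually.of_forall fun u => ?_)
  simp only [add_sub_cancel_right, smul_smul, inv_mul_cancel₀ hε.ne', one_smul]

/-- For `ε ≤ 1` one has `1 + ‖εu + t‖ ≤ (1 + ‖u‖)(1 + ‖t‖)`. The power in `u` is beaten by the decay
of the partial Fourier transform, and the power in `t` is left for the spectral measure to
integrate. -/
theorem exists_oscKernel_integrand_le (hc : 0 ≤ c) (hgm : ∀ v, ‖g v‖ ≤ c * (1 + ‖v‖) ^ m) :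
    ∃ b : (n → ℝ) → ℝ, Integrable b ∧ ∀ ε : ℝ, 0 < ε → ε ≤ 1 → ∀ t u w,
      ‖g (ε • u + t) * partialFourier χ u w‖ ≤ (1 + ‖t‖) ^ m * b u := by
  let r := Module.finrank ℝ (n → ℝ) + 1
  obtain ⟨C, h0, hC⟩ := exists_partialFourier_le χ (m + r)
  refine ⟨fun u => c * C * ((1 + ‖u‖) ^ r)⁻¹,
    (integrable_inv_one_add_norm_pow _ (Nat.lt_succ_self _)).const_mul _,
    fun ε hε hε1 t u w => ?_⟩
  have h1 : 1 + ‖ε • u + t‖ ≤ (1 + ‖u‖) * (1 + ‖t‖) := by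
    have h2 : ‖ε • u + t‖ ≤ ‖u‖ + ‖t‖ := (norm_add_le _ _).trans (by
      rw [norm_smul, Real.norm_of_nonneg hε.le]
      have := mul_le_of_le_one_left (norm_nonneg u) hε1
      linarith)
    nlinarith [mul_nonneg (norm_nonneg u) (norm_nonneg t)]
  rw [norm_mul]
  calc _ ≤ (c * ((1 + ‖u‖) * (1 + ‖t‖)) ^ m) * (C * ((1 + ‖u‖) ^ (m + r))⁻¹) :=
        mul_le_mul ((hgm _).trans (mul_le_mul_of_nonneg_left
          (pow_le_pow_left₀ (by positivity) h1 m) hc)) (hC _ _) (norm_nonneg _) (by positivity)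
    _ = _ := by
        rw [mul_pow, pow_add]
        field_simp

theorem stronglyMeasurable_oscKernel (hg : Continuous g) (ε : ℝ) :
    StronglyMeasurable (oscKernel χ g ε) := by
  have h1 : Continuous fun q : (n → ℝ) × (n → ℝ) =>
      partialFourier χ q.2 (ε • (ε • q.2 + q.1)) := by
    have h2 : Continuous fun q : (n → ℝ) × (n → ℝ) => (q.2, ε • (ε • q.2 + q.1)) := by fun_prop
    exact (continuous_partialFourier χ).comp h2
  have h3 : Continuous fun q : (n → ℝ) × (n → ℝ) =>
      g (ε • q.2 + q.1) * partialFourier χ q.2 (ε • (ε • q.2 + q.1)) := by fun_prop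
  exact h3.stronglyMeasurable.integral_prod_right'

theorem tendsto_oscKernel (hc : 0 ≤ c) (hg : Continuous g)
    (hgm : ∀ v, ‖g v‖ ≤ c * (1 + ‖v‖) ^ m) (t : n → ℝ) :
    Tendsto (fun ε => oscKernel χ g ε t) (𝓝[>] 0)
      (𝓝 (g t * ((((2 * Real.pi) ^ Fintype.card n : ℝ) : ℂ) * χ 0))) := by
  obtain ⟨b, hb, hle⟩ := exists_oscKernel_integrand_le χ hc hgm
  have h0 : ∫ u, g t * partialFourier χ u 0 =
      g t * ((((2 * Real.pi) ^ Fintype.card n : ℝ) : ℂ) * χ 0) := by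
    rw [integral_const_mul, integral_partialFourier_zero]
  rw [← h0]
  have hcont : ∀ u, Continuous fun ε : ℝ =>
      g (ε • u + t) * partialFourier χ u (ε • (ε • u + t)) := fun u => by
    have h1 : Continuous fun ε : ℝ => partialFourier χ u (ε • (ε • u + t)) := by
      have h2 : Continuous fun ε : ℝ => (u, ε • (ε • u + t)) := by fun_prop
      exact (continuous_partialFourier χ).comp h2
    fun_prop
  refine tendsto_integral_filter_of_dominated_convergence (fun u => (1 + ‖t‖) ^ m * b u)
    (Eventually.of_forall fun ε => ?_) ?_ (hb.const_mul _) (Eventually.of_forall fun u => ?_)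
  · have h1 : Continuous fun u => partialFourier χ u (ε • (ε • u + t)) := by
      have h2 : Continuous fun u : n → ℝ => (u, ε • (ε • u + t)) := by fun_prop
      exact (continuous_partialFourier χ).comp h2
    have h3 : Continuous fun u => g (ε • u + t) * partialFourier χ u (ε • (ε • u + t)) := by
      fun_prop
    exact h3.aestronglyMeasurable
  · filter_upwards [Ioc_mem_nhdsGT (zero_lt_one' ℝ)] with ε hε
    exact Eventually.of_forall fun u => hle ε hε.1 hε.2 t u _
  · have := (hcont u).tendsto 0
    simp only [zero_smul, zero_add] at this
    exact this.mono_left nhdsWithin_le_nhds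

variable {S : Type*} [MeasurableSpace S] {μ : Measure S} [SFinite μ] {τ : S → n → ℝ} {ρ : S → ℂ}

theorem integrable_oscillatory_prod (hg : Continuous g) (hgm : ∀ v, ‖g v‖ ≤ c * (1 + ‖v‖) ^ m)
    (hτ : Measurable τ) (hρ : Integrable ρ μ) (hε : 0 < ε) :
    Integrable (fun p : ((n → ℝ) × (n → ℝ)) × S =>
      χ (ε • p.1) * expFun (-p.1.1) p.1.2 * (g p.1.2 * (expFun p.1.1 (τ p.2) * ρ p.2)))
      (volume.prod μ) := by
  have h1 := (integrable_oscillatory χ hg hgm hε 0).mul_prod hρ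
  have h2 : Measurable fun p : ((n → ℝ) × (n → ℝ)) × S => expFun p.1.1 (τ p.2) := by
    have h3 : Measurable fun p : ((n → ℝ) × (n → ℝ)) × S => (p.1.1, τ p.2) :=
      measurable_fst.fst.prodMk (hτ.comp measurable_snd)
    exact continuous_uncurry_expFun.measurable.comp h3
  refine (h1.bdd_mul (c := 1) h2.aestronglyMeasurable
    (Eventually.of_forall fun p => norm_expFun_le _ _)).congr (Eventually.of_forall fun p => ?_)
  simp only [sub_zero]
  ring

/-- Fubini, legitimate for each fixed `ε > 0` because of the cutoff; the factor `e^{iz·τ(s)}` shifts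
the frequency to `p - τ(s)`. -/
theorem integral_oscillatory_prod (hg : Continuous g) (hgm : ∀ v, ‖g v‖ ≤ c * (1 + ‖v‖) ^ m)
    (hτ : Measurable τ) (hρ : Integrable ρ μ) (hε : 0 < ε) :
    ∫ v : (n → ℝ) × (n → ℝ), χ (ε • v) * expFun (-v.1) v.2 *
      (g v.2 * ∫ s, expFun v.1 (τ s) * ρ s ∂μ) = ∫ s, ρ s * oscKernel χ g ε (τ s) ∂μ := by
  have h := integrable_oscillatory_prod χ hg hgm hτ hρ hε
  have h1 : ∀ v : (n → ℝ) × (n → ℝ), χ (ε • v) * expFun (-v.1) v.2 *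
      (g v.2 * ∫ s, expFun v.1 (τ s) * ρ s ∂μ) =
      ∫ s, χ (ε • v) * expFun (-v.1) v.2 * (g v.2 * (expFun v.1 (τ s) * ρ s)) ∂μ := fun v => by
    rw [integral_const_mul, integral_const_mul]
  simp only [h1]
  rw [integral_integral_swap h]
  refine integral_congr_ae (Eventually.of_forall fun s => ?_)
  simp only
  rw [← integral_oscillatory χ hg hgm hε, ← integral_const_mul]
  refine integral_congr_ae (Eventually.of_forall fun v => ?_)
  have e : expFun (-v.1) (v.2 - τ s) = expFun (-v.1) v.2 * expFun v.1 (τ s) := by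
    rw [sub_eq_add_neg, expFun_add_right]
    congr 1
    simp [expFun]
  simp only [e]
  ring

theorem integrable_oscillatory_matrix (hg : Continuous g)
    (hgm : ∀ v, ‖g v‖ ≤ c * (1 + ‖v‖) ^ m) (hτ : Measurable τ) (hρ : Integrable ρ μ) (hε : 0 < ε) :
    Integrable fun v : (n → ℝ) × (n → ℝ) => χ (ε • v) * expFun (-v.1) v.2 *
      (g v.2 * ∫ s, expFun v.1 (τ s) * ρ s ∂μ) := by
  refine (integrable_oscillatory_prod χ hg hgm hτ hρ hε).integral_prod_left.congr
    (Eventually.of_forall fun v => ?_)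
  simp only
  rw [integral_const_mul, integral_const_mul]

/-- The kernel tends to `(2π)^n g(τ(s))` since `χ(0) = 1`, and the moment condition `hρm` dominates
it uniformly for `ε ≤ 1`. -/
theorem tendsto_oscillatory (hc : 0 ≤ c) (hg : Continuous g)
    (hgm : ∀ v, ‖g v‖ ≤ c * (1 + ‖v‖) ^ m) (hτ : Measurable τ) (hρ : Integrable ρ μ)
    (hρm : Integrable (fun s => (1 + ‖τ s‖) ^ m * ‖ρ s‖) μ) (hχ : χ 0 = 1) :
    Tendsto (fun ε : ℝ => ((((2 * Real.pi) ^ Fintype.card n)⁻¹ : ℝ) : ℂ) *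
      ∫ v : (n → ℝ) × (n → ℝ), χ (ε • v) * expFun (-v.1) v.2 *
        (g v.2 * ∫ s, expFun v.1 (τ s) * ρ s ∂μ)) (𝓝[>] 0) (𝓝 (∫ s, g (τ s) * ρ s ∂μ)) := by
  obtain ⟨b, hb, hle⟩ := exists_oscKernel_integrand_le χ hc hgm
  have hp : (((2 * Real.pi) ^ Fintype.card n : ℝ) : ℂ) ≠ 0 := by
    exact_mod_cast (by positivity : (2 * Real.pi) ^ Fintype.card n ≠ 0)
  have h1 : Tendsto (fun ε : ℝ => ∫ s, ρ s * oscKernel χ g ε (τ s) ∂μ) (𝓝[>] 0)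
      (𝓝 (∫ s, ρ s * (g (τ s) * ((((2 * Real.pi) ^ Fintype.card n : ℝ) : ℂ) * χ 0)) ∂μ)) := by
    refine tendsto_integral_filter_of_dominated_convergence
      (fun s => (∫ u, b u) * ((1 + ‖τ s‖) ^ m * ‖ρ s‖)) (Eventually.of_forall fun ε => ?_) ?_
      (hρm.const_mul _)
      (Eventually.of_forall fun s => (tendsto_oscKernel χ hc hg hgm (τ s)).const_mul _)
    · exact hρ.aestronglyMeasurable.mul
        ((stronglyMeasurable_oscKernel χ hg ε).comp_measurable hτ).aestronglyMeasurable
    · filter_upwards [Ioc_mem_nhdsGT (zero_lt_one' ℝ)] with ε hε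
      refine Eventually.of_forall fun s => ?_
      rw [norm_mul]
      have h2 : ‖oscKernel χ g ε (τ s)‖ ≤ (1 + ‖τ s‖) ^ m * ∫ u, b u := by
        rw [← integral_const_mul]
        exact norm_integral_le_of_norm_le (hb.const_mul _)
          (Eventually.of_forall fun u => hle ε hε.1 hε.2 _ u _)
      calc _ ≤ ‖ρ s‖ * ((1 + ‖τ s‖) ^ m * ∫ u, b u) :=
            mul_le_mul_of_nonneg_left h2 (norm_nonneg _)
        _ = _ := by ring
  have h3 := h1.const_mul ((((2 * Real.pi) ^ Fintype.card n)⁻¹ : ℝ) : ℂ)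
  have e : ((((2 * Real.pi) ^ Fintype.card n)⁻¹ : ℝ) : ℂ) *
      ∫ s, ρ s * (g (τ s) * ((((2 * Real.pi) ^ Fintype.card n : ℝ) : ℂ) * χ 0)) ∂μ =
      ∫ s, g (τ s) * ρ s ∂μ := by
    rw [← integral_const_mul]
    refine integral_congr_ae (Eventually.of_forall fun s => ?_)
    simp only [hχ, Complex.ofReal_inv]
    field_simp
  rw [e] at h3
  refine h3.congr' ?_
  filter_upwards [self_mem_nhdsWithin] with ε hε
  rw [integral_oscillatory_prod χ hg hgm hτ hρ hε]

end Oscillatory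

/-! ### Limits of regularised integrals -/

/-- The integrals of `I ε` converge absolutely for `ε > 0`, and `k ∫ I ε → L` as `ε → 0+`. -/
def HasRegularizedLimit {V : Type*} [MeasureSpace V] (I : ℝ → V → ℂ) (k L : ℂ) : Prop :=
  (∀ ε, 0 < ε → Integrable (I ε)) ∧ Tendsto (fun ε => k * ∫ q, I ε q) (𝓝[>] 0) (𝓝 L)

namespace HasRegularizedLimit

variable {V : Type*} [MeasureSpace V] {I I' : ℝ → V → ℂ} {k L L' : ℂ}

theorem zero : HasRegularizedLimit (fun _ (_ : V) => 0) k 0 :=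
  ⟨fun _ _ => integrable_zero _ _ _, by simp⟩

theorem add (h : HasRegularizedLimit I k L) (h' : HasRegularizedLimit I' k L') :
    HasRegularizedLimit (fun ε q => I ε q + I' ε q) k (L + L') := by
  refine ⟨fun ε hε => (h.1 ε hε).add (h'.1 ε hε), (h.2.add h'.2).congr' ?_⟩
  filter_upwards [self_mem_nhdsWithin] with ε hε
  rw [integral_add (h.1 ε hε) (h'.1 ε hε), mul_add]

theorem const_mul (h : HasRegularizedLimit I k L) (a : ℂ) :
    HasRegularizedLimit (fun ε q => a * I ε q) k (a * L) := by
  refine ⟨fun ε hε => (h.1 ε hε).const_mul a, (h.2.const_mul a).congr fun ε => ?_⟩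
  rw [integral_const_mul, mul_left_comm]

end HasRegularizedLimit

theorem valueAt_add {G : Type*} [NormedAddCommGroup G] [InnerProductSpace ℂ G] [CompleteSpace G]
    {A : G →ₗ.[ℂ] G} {x y : G} (hx : x ∈ A.domain) (hy : y ∈ A.domain) :
    valueAt A (x + y) = valueAt A x + valueAt A y := by
  rw [valueAt_of_mem hx, valueAt_of_mem hy, valueAt_of_mem (A.domain.add_mem hx hy), ← A.map_add]
  rfl

theorem valueAt_smul {G : Type*} [NormedAddCommGroup G] [InnerProductSpace ℂ G] [CompleteSpace G]
    {A : G →ₗ.[ℂ] G} (a : ℂ) {x : G} (hx : x ∈ A.domain) :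
    valueAt A (a • x) = a • valueAt A x := by
  rw [valueAt_of_mem hx, valueAt_of_mem (A.domain.smul_mem a hx), ← A.map_smul]
  rfl

theorem valueAt_zero {G : Type*} [NormedAddCommGroup G] [InnerProductSpace ℂ G] [CompleteSpace G]
    (A : G →ₗ.[ℂ] G) : valueAt A 0 = 0 := by
  rw [valueAt_of_mem A.domain.zero_mem]
  exact A.map_zero

/-- Weak oscillatory integrals may be checked on generating sets of the test and of the domain
vectors. -/
theorem isWeakOscillatoryIntegral_span {n : Type*} [Fintype n] {G : Type*} [NormedAddCommGroup G]
    [InnerProductSpace ℂ G] [CompleteSpace G] {E : PVM (n → ℝ) G} {F : (n → ℝ) → G →ₗ.[ℂ] G}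
    {T : G →ₗ.[ℂ] G} {s t : Set G} (hT : ∀ Ψ ∈ t, Ψ ∈ T.domain)
    (hF : ∀ Ψ ∈ t, ∀ z, Ψ ∈ (F z).domain)
    (h : ∀ Ψ ∈ t, ∀ Φ ∈ s, ∀ χ : 𝓢((n → ℝ) × (n → ℝ), ℂ), χ 0 = 1 →
      HasRegularizedLimit (fun ε => oscIntegrand E F χ ε Φ Ψ)
        ((((2 * Real.pi) ^ Fintype.card n)⁻¹ : ℝ) : ℂ) ⟪Φ, valueAt T Ψ⟫_ℂ) :
    IsWeakOscillatoryIntegral E F (Submodule.span ℂ s) (Submodule.span ℂ t) T := by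
  have hT' : ∀ Ψ ∈ Submodule.span ℂ t, Ψ ∈ T.domain := fun Ψ hΨ => Submodule.span_le.2 hT hΨ
  have hF' : ∀ Ψ ∈ Submodule.span ℂ t, ∀ z, Ψ ∈ (F z).domain := fun Ψ hΨ z =>
    (Submodule.span_le (p := (F z).domain)).2 (fun Ψ hΨ => hF Ψ hΨ z) hΨ
  refine fun Ψ hΨ => ⟨hF' Ψ hΨ, fun Φ hΦ χ hχ => ?_⟩
  change HasRegularizedLimit (fun ε => oscIntegrand E F χ ε Φ Ψ) _ _
  have h1 : ∀ Φ ∈ s, HasRegularizedLimit (fun ε => oscIntegrand E F χ ε Φ Ψ)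
      ((((2 * Real.pi) ^ Fintype.card n)⁻¹ : ℝ) : ℂ) ⟪Φ, valueAt T Ψ⟫_ℂ := by
    intro Φ hΦ
    induction hΨ using Submodule.span_induction with
    | mem Ψ hΨ => exact h Ψ hΨ Φ hΦ χ hχ
    | zero =>
      have e : (fun ε => oscIntegrand E F χ ε Φ 0) = fun _ _ => 0 := by
        ext ε q
        rw [oscIntegrand, valueAt_zero, map_zero, inner_zero_right, mul_zero]
      rw [e, valueAt_zero, inner_zero_right]
      exact HasRegularizedLimit.zero
    | add Ψ Ψ' hΨ hΨ' ih ih' =>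
      convert! ih.add ih' using 1
      · ext ε q
        rw [oscIntegrand, valueAt_add (hF' Ψ hΨ _) (hF' Ψ' hΨ' _), map_add, inner_add_right, mul_add]
        rfl
      · rw [valueAt_add (hT' Ψ hΨ) (hT' Ψ' hΨ'), inner_add_right]
    | smul a Ψ hΨ ih =>
      convert! ih.const_mul a using 1
      · ext ε q
        rw [oscIntegrand, valueAt_smul a (hF' Ψ hΨ _), ContinuousLinearMap.map_smul, inner_smul_right, mul_left_comm]
        rfl
      · rw [valueAt_smul a (hT' Ψ hΨ), inner_smul_right]
  induction hΦ using Submodule.span_induction with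
  | mem Φ hΦ => exact h1 Φ hΦ
  | zero =>
    have e : (fun ε => oscIntegrand E F χ ε 0 Ψ) = fun _ _ => 0 := by
      ext ε q
      rw [oscIntegrand, inner_zero_left, mul_zero]
    rw [e, inner_zero_left]
    exact HasRegularizedLimit.zero
  | add Φ Φ' _ _ ih ih' =>
    convert! ih.add ih' using 1
    · ext ε q
      rw [oscIntegrand, inner_add_left, mul_add]
      rfl
    · rw [inner_add_left]
  | smul a Φ _ ih =>
    convert! ih.const_mul (starRingEnd ℂ a) using 1
    · ext ε q
      rw [oscIntegrand, inner_smul_left, mul_left_comm]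
      rfl
    · rw [inner_smul_left]

/-! ### A change of coordinates -/

section Mix

variable {ι : Type*} [Fintype ι]

/-- The involution `((x, y), (p, q)) ↦ ((x, q), (p, y))`. -/
def mixLinear (ι : Type*) :
    ((ι ⊕ ι → ℝ) × (ι ⊕ ι → ℝ)) →ₗ[ℝ] ((ι ⊕ ι → ℝ) × (ι ⊕ ι → ℝ)) where
  toFun v := (Sum.elim (v.1 ∘ Sum.inl) (v.2 ∘ Sum.inr), Sum.elim (v.2 ∘ Sum.inl) (v.1 ∘ Sum.inr))
  map_add' v w := by
    ext (i | i) <;> simp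
  map_smul' a v := by
    ext (i | i) <;> simp

theorem mixLinear_mixLinear (v : (ι ⊕ ι → ℝ) × (ι ⊕ ι → ℝ)) :
    mixLinear ι (mixLinear ι v) = v := by
  ext (i | i) <;> simp [mixLinear]

/-- The involution `((x, y), (p, q)) ↦ ((x, q), (p, y))` as a homeomorphism. -/
def mix (ι : Type*) [Fintype ι] :
    ((ι ⊕ ι → ℝ) × (ι ⊕ ι → ℝ)) ≃L[ℝ] ((ι ⊕ ι → ℝ) × (ι ⊕ ι → ℝ)) :=
  (LinearEquiv.ofInvolutive (mixLinear ι) mixLinear_mixLinear).toContinuousLinearEquiv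

theorem mix_apply (v : (ι ⊕ ι → ℝ) × (ι ⊕ ι → ℝ)) : mix ι v =
    (Sum.elim (v.1 ∘ Sum.inl) (v.2 ∘ Sum.inr), Sum.elim (v.2 ∘ Sum.inl) (v.1 ∘ Sum.inr)) := rfl

theorem mix_mix (v : (ι ⊕ ι → ℝ) × (ι ⊕ ι → ℝ)) : mix ι (mix ι v) = v := mixLinear_mixLinear v

/-- The determinant of a linear involution squares to `1`, so its absolute value is `1`. -/
theorem measurePreserving_mix : MeasurePreserving (mix ι) := by
  have : (volume : Measure ((ι ⊕ ι → ℝ) × (ι ⊕ ι → ℝ))).IsAddHaarMeasure :=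
    Measure.prod.instIsAddHaarMeasure volume volume
  refine ⟨(mix ι).continuous.measurable, ?_⟩
  have hd : LinearMap.det (mixLinear ι) * LinearMap.det (mixLinear ι) = 1 := by
    rw [← map_mul]
    have : mixLinear ι * mixLinear ι = 1 := LinearMap.ext mixLinear_mixLinear
    rw [this, map_one]
  have h0 : LinearMap.det (mixLinear ι) ≠ 0 := fun h => by
    rw [h] at hd
    simp at hd
  have h1 : |(LinearMap.det (mixLinear ι))⁻¹| = 1 := by
    rw [abs_inv]
    have := congrArg abs hd
    rw [abs_mul, abs_one] at this
    have h2 : |LinearMap.det (mixLinear ι)| = 1 := by nlinarith [abs_nonneg (LinearMap.det (mixLinear ι))]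
    rw [h2, inv_one]
  have h2 := Measure.map_linearMap_addHaar_eq_smul_addHaar
    (volume : Measure ((ι ⊕ ι → ℝ) × (ι ⊕ ι → ℝ))) h0
  rw [h1, ENNReal.ofReal_one, one_smul] at h2
  exact h2

/-- The phase `x·p + y·q` is symmetric under exchanging `y` and `q`. So the regrouped integral is
again of the standard oscillatory form. -/
theorem expFun_mix (v : (ι ⊕ ι → ℝ) × (ι ⊕ ι → ℝ)) :
    expFun (-(mix ι v).1) (mix ι v).2 = Complex.exp (-(Complex.I * ((v.1 ⬝ᵥ v.2 : ℝ) : ℂ))) := by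
  rw [expFun, neg_dotProduct, Complex.ofReal_neg, mul_neg, mix_apply]
  congr 4
  simp only [dotProduct, Fintype.sum_sum_type, Sum.elim_inl, Sum.elim_inr, Function.comp_apply]
  congr 1
  exact Finset.sum_congr rfl fun i _ => mul_comm _ _

end Mix

theorem stdSymplectic_mulVec {ι : Type*} [Fintype ι] [DecidableEq ι] (z : ι ⊕ ι → ℝ) :
    (stdSymplectic ι).mulVec z = Sum.elim (z ∘ Sum.inr) (-(z ∘ Sum.inl)) := by
  rw [stdSymplectic, Matrix.fromBlocks_mulVec]
  simp [Matrix.neg_mulVec]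

/-! ### The warped convolution of `A ⊗ 1` -/

section Warped

variable {ι : Type*} [Fintype ι] [DecidableEq ι] {H K : Type*} [NormedAddCommGroup H]
  [InnerProductSpace ℂ H] [CompleteSpace H] [NormedAddCommGroup K] [InnerProductSpace ℂ K]
  [CompleteSpace K] {X : ι → H →ₗ.[ℂ] H} {Y : ι → K →ₗ.[ℂ] K} {A : H →ₗ.[ℂ] H} {ψ : H} {c : ℝ}
  {m : ℕ}

/-- The operator `U(Θz)⁻¹ (A ⊗ 1) U(Θz)`. -/
def warpedIntegrand (X : ι → H →ₗ.[ℂ] H) (Y : ι → K →ₗ.[ℂ] K) (A : H →ₗ.[ℂ] H) (z : ι ⊕ ι → ℝ) :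
    HilbertTensor H K →ₗ.[ℂ] HilbertTensor H K :=
  sandwich (Ring.inverse (rep X Y ((stdSymplectic ι).mulVec z))) (tensorOne A)
    (rep X Y ((stdSymplectic ι).mulVec z))

/-- For `z = (x, y)` one has `Θz = (y, -x)`: the `X`-translation is governed by the second half of
`z`, as in the integral over `Spec Y`. -/
theorem rep_stdSymplectic_tmulVec (z : ι ⊕ ι → ℝ) (ψ : H) (φ : K) :
    rep X Y ((stdSymplectic ι).mulVec z) (tmulVec ψ φ) =
      tmulVec (expI X (-(z ∘ Sum.inr)) ψ) (expI Y (-(z ∘ Sum.inl)) φ) := by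
  rw [rep, stdSymplectic_mulVec, tensorOp_tmulVec, Sum.elim_comp_inl, Sum.elim_comp_inr]

theorem inverse_rep_stdSymplectic_tmulVec (z : ι ⊕ ι → ℝ) (ψ : H) (φ : K) :
    Ring.inverse (rep X Y ((stdSymplectic ι).mulVec z)) (tmulVec ψ φ) =
      tmulVec (expI X (z ∘ Sum.inr) ψ) (expI Y (z ∘ Sum.inl) φ) := by
  rw [inverse_rep, rep, tensorOp_tmulVec, Pi.neg_comp, Pi.neg_comp, stdSymplectic_mulVec,
    Sum.elim_comp_inl, Sum.elim_comp_inr, neg_neg, neg_neg]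

theorem IsPolyBoundedAt.mem_domain_warpedIntegrand (hA : A.IsClosable)
    (h : IsPolyBoundedAt X A ψ c m) (φ : K) (z : ι ⊕ ι → ℝ) :
    tmulVec ψ φ ∈ (warpedIntegrand X Y A z).domain := by
  change rep X Y ((stdSymplectic ι).mulVec z) (tmulVec ψ φ) ∈ (tensorOne A).domain
  rw [rep_stdSymplectic_tmulVec]
  exact tmulVec_mem_domain_tensorOne hA (h.mem_domain _) _

/-- `A ⊗ 1` does not touch the second factor, so the exponentials of `Y` cancel and only the second
half of `z` survives. -/
theorem IsPolyBoundedAt.valueAt_warpedIntegrand (hA : A.IsClosable)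
    (h : IsPolyBoundedAt X A ψ c m) (φ : K) (z : ι ⊕ ι → ℝ) :
    valueAt (warpedIntegrand X Y A z) (tmulVec ψ φ) =
      tmulVec (expI X (z ∘ Sum.inr) (valueAt A (expI X (-(z ∘ Sum.inr)) ψ))) φ := by
  rw [warpedIntegrand, valueAt_sandwich (h.mem_domain_warpedIntegrand (Y := Y) hA φ z),
    rep_stdSymplectic_tmulVec, valueAt_tensorOne_tmulVec hA (h.mem_domain _),
    inverse_rep_stdSymplectic_tmulVec, ← mul_apply_eq_comp, expI_mul_neg]
  rfl

/-- After `mix`, the orbit element depends only on the second group of variables, while the matrix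
element of `e^{iq·Y}` depends only on the first and is a superposition of characters at the points
`(0, s)`. This is the form treated by `tendsto_oscillatory`. -/
theorem IsPolyBoundedAt.oscIntegrand_eq (hA : A.IsClosable) (h : IsPolyBoundedAt X A ψ c m)
    (ψ' : H) (φ' φ : K) (χ : 𝓢((ι ⊕ ι → ℝ) × (ι ⊕ ι → ℝ), ℂ)) (ε : ℝ)
    (v : (ι ⊕ ι → ℝ) × (ι ⊕ ι → ℝ)) :
    oscIntegrand (tensorSpectralMeasure X Y) (warpedIntegrand X Y A) χ ε (tmulVec ψ' φ')
      (tmulVec ψ φ) v =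
      SchwartzMap.compCLMOfContinuousLinearEquiv ℂ (mix ι) χ (ε • mix ι v) *
        expFun (-(mix ι v).1) (mix ι v).2 *
        (orbitElement X A ψ' ψ ((mix ι v).2 ∘ Sum.inl) ((mix ι v).2 ∘ Sum.inr) *
          ∫ s, expFun (mix ι v).1 (Sum.elim 0 s) * (jointSpectralMeasure Y).density φ' φ s
            ∂(jointSpectralMeasure Y).meas φ) := by
  rw [oscIntegrand, h.valueAt_warpedIntegrand hA, expFun_mix,
    SchwartzMap.compCLMOfContinuousLinearEquiv_apply, Function.comp_apply,
    ContinuousLinearEquiv.map_smul, mix_mix]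
  congr 1
  have h1 := (isProductPVM_tensorSpectralMeasure X Y).calculus_expFun v.2
  have h2 : ∀ s : ι → ℝ, expFun (mix ι v).1 (Sum.elim 0 s) = expFun (v.2 ∘ Sum.inr) s := fun s => by
    rw [expFun_sum, mix_apply, Sum.elim_comp_inl, Sum.elim_comp_inr, Sum.elim_comp_inl,
      Sum.elim_comp_inr, expFun_comm, expFun_zero, one_mul]
  simp only [h2]
  rw [← PVM.inner_cyc_eq_integral _ _ (PVM.memLp_of_bound _ (measurable_expFun _)
    (norm_expFun_le _)), ← PVM.calculus_apply _ (measurable_expFun _) (norm_expFun_le _)]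
  change ⟪tmulVec ψ' φ', (tensorSpectralMeasure X Y).calculus (expFun v.2) _⟫_ℂ = _
  rw [h1, tensorOp_tmulVec, inner_tmulVec]
  congr 1
  change ⟪ψ', expI X (v.2 ∘ Sum.inl) _⟫_ℂ = _
  rw [inner_expI_right, inner_expI_right, orbitElement, mix_apply, Sum.elim_comp_inl,
    Sum.elim_comp_inr]

theorem IsPolyBoundedAt.hasRegularizedLimit (hY : IsCommutingSelfAdjoint Y) (hA : A.IsClosable)
    (h : IsPolyBoundedAt X A ψ c m) (ψ' : H) (φ' : K) {φ : K} (hφ : φ ∈ smoothDomain Y)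
    (χ : 𝓢((ι ⊕ ι → ℝ) × (ι ⊕ ι → ℝ), ℂ)) (hχ : χ 0 = 1) :
    HasRegularizedLimit (fun ε => oscIntegrand (tensorSpectralMeasure X Y) (warpedIntegrand X Y A)
        χ ε (tmulVec ψ' φ') (tmulVec ψ φ))
      ((((2 * Real.pi) ^ Fintype.card (ι ⊕ ι))⁻¹ : ℝ) : ℂ)
      ⟪tmulVec ψ' φ', valueAt (sandwich (expTensor X Y 1) (tensorOne A) (expTensor X Y (-1)))
        (tmulVec ψ φ)⟫_ℂ := by
  set E := jointSpectralMeasure Y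
  let χ' := SchwartzMap.compCLMOfContinuousLinearEquiv ℂ (mix ι) χ
  have hχ' : χ' 0 = 1 := by
    change χ (mix ι 0) = 1
    rw [map_zero, hχ]
  let g : (ι ⊕ ι → ℝ) → ℂ := fun v => orbitElement X A ψ' ψ (v ∘ Sum.inl) (v ∘ Sum.inr)
  have hg : Continuous g := by
    have h1 : Continuous fun v : ι ⊕ ι → ℝ => (v ∘ Sum.inl, v ∘ Sum.inr) := by
      refine Continuous.prodMk ?_ ?_
      · exact continuous_pi fun i => continuous_apply (Sum.inl i)
      · exact continuous_pi fun i => continuous_apply (Sum.inr i)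
    have h2 := (h.continuous_orbitElement hA ψ').comp h1
    exact h2
  have hc := h.nonneg
  have hgm : ∀ v, ‖g v‖ ≤ ‖ψ'‖ * c * (1 + ‖v‖) ^ m := fun v => by
    refine (h.norm_orbitElement_le ψ' _ _).trans (mul_le_mul_of_nonneg_left ?_ (by positivity))
    refine pow_le_pow_left₀ (by positivity) ?_ m
    have : ‖v ∘ Sum.inr‖ ≤ ‖v‖ := by
      rw [pi_norm_le_iff_of_nonneg (norm_nonneg _)]
      exact fun i => norm_le_pi_norm v (Sum.inr i)
    linarith
  -- The second group of variables is localised at `(0, s)`: the zero removes the extra `e^{iq·X}`,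
  -- and `s` runs over the spectral measure of `Y`.
  have hτ : Measurable fun s : ι → ℝ => (Sum.elim 0 s : ι ⊕ ι → ℝ) := by
    refine measurable_pi_lambda _ ?_
    rintro (i | i)
    · exact measurable_const
    · exact measurable_pi_apply i
  have hρ : Integrable (E.density φ' φ) (E.meas φ) := E.integrable_density φ' φ
  have hρm : Integrable (fun s : ι → ℝ => (1 + ‖(Sum.elim 0 s : ι ⊕ ι → ℝ)‖) ^ m *
      ‖E.density φ' φ s‖) (E.meas φ) := by
    have h1 : Integrable (fun s : ι → ℝ => (1 * (1 + ‖s‖) ^ m) * ‖E.density φ' φ s‖) (E.meas φ) :=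
      (memLp_poly hY hφ 1 m).integrable_mul (E.memLp_density φ' φ).norm
    refine h1.mono' ?_ (Eventually.of_forall fun s => ?_)
    · have h2 : Measurable fun s : ι → ℝ => (1 + ‖(Sum.elim 0 s : ι ⊕ ι → ℝ)‖) ^ m := by fun_prop
      exact h2.aestronglyMeasurable.mul hρ.aestronglyMeasurable.norm
    · rw [norm_mul, norm_norm, Real.norm_of_nonneg (by positivity), one_mul]
      refine mul_le_mul_of_nonneg_right (pow_le_pow_left₀ (by positivity) ?_ m) (norm_nonneg _)
      have : ‖(Sum.elim 0 s : ι ⊕ ι → ℝ)‖ ≤ ‖s‖ := by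
        rw [pi_norm_le_iff_of_nonneg (norm_nonneg _)]
        rintro (i | i)
        · simp
        · exact norm_le_pi_norm s i
      linarith
  let J : ℝ → (ι ⊕ ι → ℝ) × (ι ⊕ ι → ℝ) → ℂ := fun ε v => χ' (ε • v) * expFun (-v.1) v.2 *
    (g v.2 * ∫ s, expFun v.1 (Sum.elim 0 s) * E.density φ' φ s ∂E.meas φ)
  have hJ : ∀ ε, oscIntegrand (tensorSpectralMeasure X Y) (warpedIntegrand X Y A) χ ε
      (tmulVec ψ' φ') (tmulVec ψ φ) = J ε ∘ mix ι := fun ε =>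
    funext fun v => h.oscIntegrand_eq hA ψ' φ' φ χ ε v
  have hemb : MeasurableEmbedding (mix ι) := (mix ι).toHomeomorph.measurableEmbedding
  have hlim := tendsto_oscillatory χ' (by positivity) hg hgm hτ hρ hρm hχ'
  have hval : ∫ s, g (Sum.elim 0 s) * E.density φ' φ s ∂E.meas φ =
      ⟪tmulVec ψ' φ', valueAt (sandwich (expTensor X Y 1) (tensorOne A) (expTensor X Y (-1)))
        (tmulVec ψ φ)⟫_ℂ := by
    rw [h.inner_valueAt hY hA hφ]
    rfl
  rw [hval] at hlim
  refine ⟨fun ε hε => ?_, hlim.congr fun ε => ?_⟩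
  · simp only [hJ]
    exact (measurePreserving_mix.integrable_comp_emb hemb).2
      (integrable_oscillatory_matrix χ' hg hgm hτ hρ hε)
  · simp only [hJ]
    congr 1
    exact (measurePreserving_mix.integral_comp hemb (J ε)).symm

theorem isWarpedConvolution_conjugation (hY : IsCommutingSelfAdjoint Y) (hA : A.IsClosable)
    {D : Submodule ℂ H} (hD : ∀ ψ ∈ D, ∃ c, IsPolyBoundedAt X A ψ c m) :
    IsWarpedConvolution (tensorSpectralMeasure X Y) (rep X Y) (stdSymplectic ι) (tensorOne A)
      (algTensor ⊤ ⊤) (algTensor D (smoothDomain Y))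
      (sandwich (expTensor X Y 1) (tensorOne A) (expTensor X Y (-1))) := by
  refine isWeakOscillatoryIntegral_span (F := warpedIntegrand X Y A) ?_ ?_ ?_
  · rintro _ ⟨ψ, hψ, φ, hφ, rfl⟩
    obtain ⟨c, h⟩ := hD ψ hψ
    exact h.tmulVec_mem_domain hY hA hφ
  · rintro _ ⟨ψ, hψ, φ, hφ, rfl⟩ z
    obtain ⟨c, h⟩ := hD ψ hψ
    exact h.mem_domain_warpedIntegrand hA φ z
  · rintro _ ⟨ψ, hψ, φ, hφ, rfl⟩ _ ⟨ψ', -, φ', -, rfl⟩ χ hχ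
    obtain ⟨c, h⟩ := hD ψ hψ
    exact h.hasRegularizedLimit hY hA ψ' φ' hφ χ hχ

end Warped

/-! ### Comparison of norms and conclusion -/

/-- The growth hypothesis is stated with the Euclidean norm, while the estimates use the sup norm of
`ℝ^ι`; the two are equivalent. -/
theorem exists_rpow_dotProduct_le {ι : Type*} [Fintype ι] (m : ℕ) :
    ∃ C : ℝ, ∀ y : ι → ℝ, (1 + y ⬝ᵥ y) ^ ((m : ℝ) / 2) ≤ C * (1 + ‖y‖) ^ m := by
  refine ⟨(1 + Fintype.card ι : ℝ) ^ ((m : ℝ) / 2), fun y => ?_⟩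
  have h1 : y ⬝ᵥ y ≤ Fintype.card ι * ‖y‖ ^ 2 := by
    rw [dotProduct, ← nsmul_eq_mul, ← Finset.card_univ]
    refine Finset.sum_le_card_nsmul _ _ _ fun i _ => ?_
    rw [← sq, ← sq_abs]
    exact pow_le_pow_left₀ (abs_nonneg _) (norm_le_pi_norm y i) 2
  have h0 : 0 ≤ y ⬝ᵥ y := Finset.sum_nonneg fun i _ => mul_self_nonneg _
  have h2 : 1 + y ⬝ᵥ y ≤ (1 + Fintype.card ι) * (1 + ‖y‖) ^ 2 := by
    have h3 : (0 : ℝ) ≤ Fintype.card ι := Nat.cast_nonneg _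
    nlinarith [norm_nonneg y, mul_nonneg h3 (norm_nonneg y), sq_nonneg ‖y‖]
  calc (1 + y ⬝ᵥ y) ^ ((m : ℝ) / 2)
      ≤ ((1 + Fintype.card ι) * (1 + ‖y‖) ^ 2) ^ ((m : ℝ) / 2) :=
        Real.rpow_le_rpow (by linarith) h2 (by positivity)
    _ = (1 + Fintype.card ι : ℝ) ^ ((m : ℝ) / 2) * (1 + ‖y‖) ^ m := by
        rw [Real.mul_rpow (by positivity) (by positivity), ← Real.rpow_natCast (1 + ‖y‖) 2,
          ← Real.rpow_mul (by positivity)]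
        congr 1
        rw [Nat.cast_ofNat, mul_div_cancel₀ _ two_ne_zero, Real.rpow_natCast]

end WarpedConv

end

theorem mainTheorem1 {H K : Type*}
    [NormedAddCommGroup H] [InnerProductSpace ℂ H] [CompleteSpace H]
    [NormedAddCommGroup K] [InnerProductSpace ℂ K] [CompleteSpace K]
    (N : ℕ) (X : Fin N → H →ₗ.[ℂ] H) (Y : Fin N → K →ₗ.[ℂ] K)
    (hX : WarpedConv.IsCommutingSelfAdjoint X) (hY : WarpedConv.IsCommutingSelfAdjoint Y)
    (A : H →ₗ.[ℂ] H) (hA : A.IsClosable)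
    (D : Submodule ℂ H) (hD : Dense (D : Set H))
    (hAD : ∀ ψ ∈ D, ∃ h : ψ ∈ A.domain, A ⟨ψ, h⟩ ∈ D)
    (hXD : ∀ μ, ∀ ψ ∈ D, ∃ h : ψ ∈ (X μ).domain, X μ ⟨ψ, h⟩ ∈ D)
    (hUD : ∀ x : Fin N → ℝ, ∀ ψ ∈ D, WarpedConv.expI X (-x) ψ ∈ D)
    (m : ℕ)
    (hbound : ∀ ψ ∈ D, ∃ c : ℝ, ∀ y : Fin N → ℝ,
      ‖WarpedConv.valueAt A (WarpedConv.expI X (-y) ψ)‖ ≤ c * (1 + y ⬝ᵥ y) ^ ((m : ℝ) / 2)) :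
    let DY : Submodule ℂ K := WarpedConv.smoothDomain Y
    let 𝒟 : Submodule ℂ (WarpedConv.HilbertTensor H K) := WarpedConv.algTensor D DY
    let A1 : WarpedConv.HilbertTensor H K →ₗ.[ℂ] WarpedConv.HilbertTensor H K :=
      WarpedConv.tensorOne A
    let T : WarpedConv.HilbertTensor H K →ₗ.[ℂ] WarpedConv.HilbertTensor H K :=
      WarpedConv.sandwich (WarpedConv.expTensor X Y 1) A1 (WarpedConv.expTensor X Y (-1))
    𝒟 ≤ T.domain ∧
    WarpedConv.IsWeakTensorIntegral (WarpedConv.jointSpectralMeasure Y).support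
      (fun y => WarpedConv.sandwich (WarpedConv.expI X y) A (WarpedConv.expI X (-y)))
      (WarpedConv.jointSpectralMeasure Y) D DY T ∧
    WarpedConv.IsWarpedConvolution (WarpedConv.tensorSpectralMeasure X Y) (WarpedConv.rep X Y)
      (WarpedConv.stdSymplectic (Fin N)) A1 (WarpedConv.algTensor ⊤ ⊤) 𝒟 T := by
  have hP : ∀ ψ ∈ D, ∃ c, WarpedConv.IsPolyBoundedAt X A ψ c m := by
    intro ψ hψ
    obtain ⟨c, hc⟩ := hbound ψ hψ
    obtain ⟨C, hC⟩ := WarpedConv.exists_rpow_dotProduct_le (ι := Fin N) m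
    -- The constant `c` is not assumed nonnegative, so it is replaced by `|c|`. The orbit stays in
    -- `D`, hence in the domain of `A`.
    refine ⟨|c| * C, fun y => (hAD _ (hUD y ψ hψ)).1, fun y => (hc y).trans ?_⟩
    have h0 : 0 ≤ y ⬝ᵥ y := Finset.sum_nonneg fun i _ => mul_self_nonneg _
    rw [mul_assoc]
    exact mul_le_mul (le_abs_self c) (hC y) (by positivity) (abs_nonneg c)
  exact ⟨WarpedConv.algTensor_le_domain hY hA hP,
    WarpedConv.isWeakTensorIntegral_conjugation hY hA hP,
    WarpedConv.isWarpedConvolution_conjugation hY hA hP⟩
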